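/- **Meromorphy of the generalized resolvent and existence of Siegert states.** Let $\varepsilon:\mathbb R^2\to\mathbb R$, $(x,z)\mapsto\varepsilon(x,z)$, be a bounded measurable function with $\varepsilon\ge 1$ and $\varepsilon(x+1,z)=\varepsilon(x,z)$, such that $\varepsilon(x,z)=1$ whenever $z\notin[z_-,z_+]$, where $z_-<z_+$. Let $D=[0,1]\times[z_-,z_+]$, let $k_x\in\mathbb R$ be fixed, and put $k_{x,m}=k_x+2\pi m$ for $m\in\mathbb Z$. Let $\sqrt w=e^{\frac12\log w}$ ($w\neq0$) with $\log w=\ln|w|+i\arg w$, $-\frac{\pi}{2}<\arg w<\frac{3\pi}{2}$, and let $$\mathcal C_{k_x}=\mathbb C\setminus\bigcup_{m\in\mathbb Z}\{k_{x,m}^2-is:\ s\ge 0\},\qquad H(\mathcal E;x,z)=\frac{i\mathcal E}{2}\sum_{m\in\mathbb Z}\frac{e^{i\left(xk_{x,m}+|z|\sqrt{\mathcal E-k_{x,m}^2}\right)}}{\sqrt{\mathcal E-k_{x,m}^2}}\quad(\mathcal E\in\mathcal C_{k_x}).$$ For $x\in\mathbb R$ and $z\ne0$ the series converges absolutely for every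 $\mathcal E\in\mathcal C_{k_x}$, and $\mathcal E\mapsto H(\mathcal E;x,z)$ is analytic on $\mathcal C_{k_x}$. Moreover there is a family of bounded operators $\hat H(\mathcal E)$ on $L^2(D)$ with the following properties. 1. (Lippmann–Schwinger operator.) If $k>0$ and $k^2\in\mathcal C_{k_x}$, then for every $E\in L^2(D)$ and almost every $\mathbf r\in D$, $$\hat H(k^2)[E](\mathbf r)=\frac{k^2}{4\pi}\int_{\mathbb R^2}(\varepsilon(\mathbf r_0)-1)\,G_k(\mathbf r|\mathbf r_0)\,E(\mathbf r_0)\,d\mathbf r_0,\qquad G_k(\mathbf r|\mathbf r_0)=i\pi H^{(1)}_0(k|\mathbf r-\mathbf r_0|),$$ where $E$ is extended from $0\le x<1$ by Bloch's condition $E(x+1,z)=e^{ik_x}E(x,z)$, $H_0^{(1)}$ is the Hankel function of the first kind of order $0$, and the integral is the limit of the absolutely convergent integrals over $-R_1<x_0\le R_2$ as $R_1,R_2\to\infty$ independently. 2. (Kernel.) For every $\mathcal E\in\mathcal C_{k_x}$, every $E\in L^2(D)$ and almost every $\mathbf r\in D$, $\hat H(\mathcal E)[E](\mathbf r)=\int_D(\varepsilon(\mathbf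 r_0)-1)H(\mathcal E;\mathbf r-\mathbf r_0)E(\mathbf r_0)\,d\mathbf r_0$, with an absolutely convergent integral. 3. For every $\mathcal E\in\mathcal C_{k_x}$ the kernel $(\mathbf r,\mathbf r_0)\mapsto(\varepsilon(\mathbf r_0)-1)H(\mathcal E;\mathbf r-\mathbf r_0)$ is square integrable on $D\times D$, and $\hat H(\mathcal E)$ is a Hilbert–Schmidt operator, hence compact. 4. $\mathcal E\mapsto\hat H(\mathcal E)$ is analytic on $\mathcal C_{k_x}$ in the operator norm. 5. The generalized resolvent $\mathcal E\mapsto[1-\hat H(\mathcal E)]^{-1}$ is meromorphic on $\mathcal C_{k_x}$: its poles have no accumulation point in $\mathcal C_{k_x}$, and a point $\mathcal E\in\mathcal C_{k_x}$ is a pole exactly when $1-\hat H(\mathcal E)$ has no bounded inverse. 6. At each pole $\mathcal E_n\in\mathcal C_{k_x}$ there is a nonzero $E_n\in L^2(D)$ (a Siegert state) with $\hat H(\mathcal E_n)[E_n]=E_n$. -/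

import Mathlib

open MeasureTheory Set Filter Topology

namespace SiegertStates

noncomputable section

/-- The `x`-wave numbers `k_{x,m} = k_x + 2πm` of the diffraction orders. -/
def waveNumber (kx : ℝ) (m : ℤ) : ℝ := kx + 2 * Real.pi * m

/-- The logarithm whose branch cut is the negative imaginary axis: for `w` off that half line it is
`ln |w| + i arg w` with `-π/2 < arg w < 3π/2`. -/
def cutLog (w : ℂ) : ℂ := Complex.log (-Complex.I * w) + Complex.I * (Real.pi / 2)

/-- The square root defined by `cutLog`; it is only used at `w ≠ 0`. -/
def cutSqrt (w : ℂ) : ℂ := Complex.exp (cutLog w / 2)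

theorem exp_cutLog {w : ℂ} (hw : w ≠ 0) : Complex.exp (cutLog w) = w := by
  have h : -Complex.I * w ≠ 0 := mul_ne_zero (neg_ne_zero.mpr Complex.I_ne_zero) hw
  have h2 : Complex.I * ((Real.pi : ℂ) / 2) = (Real.pi : ℂ) / 2 * Complex.I := by ring
  rw [cutLog, Complex.exp_add, Complex.exp_log h, h2, Complex.exp_pi_div_two_mul_I]
  linear_combination (-w) * Complex.I_mul_I

theorem cutSqrt_sq {w : ℂ} (hw : w ≠ 0) : cutSqrt w ^ 2 = w := by
  rw [cutSqrt, ← Complex.exp_nat_mul]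
  convert exp_cutLog hw using 2
  push_cast
  ring

theorem cutLog_im_mem {w : ℂ} (hw : ¬ (w.re = 0 ∧ w.im ≤ 0)) :
    (cutLog w).im ∈ Ioo (-(Real.pi / 2)) (3 * Real.pi / 2) := by
  have him : (cutLog w).im = Complex.arg (-Complex.I * w) + Real.pi / 2 := by
    have h2 : Complex.I * ((Real.pi : ℂ) / 2) = ((Real.pi / 2 : ℝ) : ℂ) * Complex.I := by
      push_cast; ring
    rw [cutLog, Complex.add_im, Complex.log_im, h2, Complex.im_ofReal_mul, Complex.I_im, mul_one]
  have h1 := Complex.neg_pi_lt_arg (-Complex.I * w)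
  have h2 := Complex.arg_le_pi (-Complex.I * w)
  have h3 : Complex.arg (-Complex.I * w) ≠ Real.pi := by
    rw [Ne, Complex.arg_eq_pi_iff]
    rintro ⟨hr, hi⟩
    simp at hr hi
    exact hw ⟨hi, hr.le⟩
  have h4 := lt_of_le_of_ne h2 h3
  rw [him]
  constructor <;> linarith

/-- The complex plane cut along the vertical half lines that run from the diffraction thresholds
`k_{x,m}²` downwards. -/
def cutPlane (kx : ℝ) : Set ℂ :=
  {E | ∀ (m : ℤ) (s : ℝ), 0 ≤ s → E ≠ (waveNumber kx m : ℂ) ^ 2 - Complex.I * s}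

/-- The `m`-th term of the series for the kernel. -/
def seriesTerm (kx : ℝ) (E : ℂ) (x z : ℝ) (m : ℤ) : ℂ :=
  Complex.exp (Complex.I * (x * waveNumber kx m
      + |z| * cutSqrt (E - (waveNumber kx m : ℂ) ^ 2)))
    / cutSqrt (E - (waveNumber kx m : ℂ) ^ 2)

/-- `H(E; x, z) = (iE/2) ∑_m exp (i (x k_{x,m} + |z| √(E - k_{x,m}²))) / √(E - k_{x,m}²)`. -/
def blochSeries (kx : ℝ) (E : ℂ) (x z : ℝ) : ℂ :=
  Complex.I * E / 2 * ∑' m : ℤ, seriesTerm kx E x z m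

/-- The kernel `(ε(r₀) - 1) H(E; r - r₀)`. -/
def lsKernel (ε : ℝ × ℝ → ℝ) (kx : ℝ) (E : ℂ) (r r₀ : ℝ × ℝ) : ℂ :=
  ((ε r₀ - 1 : ℝ) : ℂ) * blochSeries kx E (r.1 - r₀.1) (r.2 - r₀.2)

/-- The Hankel function of the first kind of order `0` at `x > 0`, by Hankel's integral
`H₀⁽¹⁾(x) = √(2/(πx)) e^{i(x-π/4)} Γ(1/2)⁻¹ ∫₀^∞ e^{-u} u^{-1/2} (1 + iu/(2x))^{-1/2} du`. -/
def hankelH0 (x : ℝ) : ℂ :=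
  (Real.sqrt (2 / (Real.pi * x)) : ℂ) * Complex.exp (Complex.I * (x - Real.pi / 4))
    * ((Real.sqrt Real.pi : ℂ))⁻¹
    * ∫ u in Ioi (0 : ℝ), ((Real.exp (-u) * u ^ (-(1 / 2) : ℝ) : ℝ) : ℂ)
        * (1 + Complex.I * u / (2 * x)) ^ (-(1 / 2) : ℂ)

/-- The outgoing Green's function `G_k(r|r₀) = iπ H₀⁽¹⁾(k|r - r₀|)` of the Helmholtz equation
`(Δ + k²) G = -4πδ` in the plane, with the Euclidean distance `|r - r₀|`. -/
def greenFn (k : ℝ) (r r₀ : ℝ × ℝ) : ℂ :=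
  Complex.I * Real.pi * hankelH0 (k * Real.sqrt ((r.1 - r₀.1) ^ 2 + (r.2 - r₀.2) ^ 2))

/-- The rectangle `D = [0,1] × [z₋, z₊]` in the `(x,z)`-plane. -/
def rect (zm zp : ℝ) : Set (ℝ × ℝ) := Icc 0 1 ×ˢ Icc zm zp

/-- The Hilbert space `L²(D)`. -/
abbrev L2D (zm zp : ℝ) := Lp ℂ 2 ((volume : Measure (ℝ × ℝ)).restrict (rect zm zp))

/-- The extension of a function on `0 ≤ x < 1` by Bloch's condition
`f(x+1,z) = e^{i k_x} f(x,z)`. -/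
def blochExt (kx : ℝ) (f : ℝ × ℝ → ℂ) (r : ℝ × ℝ) : ℂ :=
  Complex.exp (Complex.I * kx * ⌊r.1⌋) * f (Int.fract r.1, r.2)

/-- The integrand `(k²/4π) (ε(r₀) - 1) G_k(r|r₀) f(r₀)` of the Lippmann–Schwinger operator, for the
field that extends `f` by Bloch's condition. -/
def lsIntegrand (ε : ℝ × ℝ → ℝ) (kx k : ℝ) (f : ℝ × ℝ → ℂ) (r r₀ : ℝ × ℝ) : ℂ :=
  (k ^ 2 / (4 * Real.pi) : ℝ) * ((ε r₀ - 1 : ℝ) : ℂ) * greenFn k r r₀ * blochExt kx f r₀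

/-- The value of the Lippmann–Schwinger integral over the plane at `r` is `v`. The integral
is only conditionally convergent along the structure: it is the limit of the (absolutely convergent)
integrals over `-R₁ < x ≤ R₂`, as `R₁` and `R₂` tend to infinity independently. -/
def HasLSIntegral (ε : ℝ × ℝ → ℝ) (kx k : ℝ) (f : ℝ × ℝ → ℂ) (r : ℝ × ℝ) (v : ℂ) : Prop :=
  (∀ R₁ R₂ : ℝ, IntegrableOn (lsIntegrand ε kx k f r) (Ioc (-R₁) R₂ ×ˢ univ)) ∧
  Tendsto (fun R : ℝ × ℝ => ∫ r₀ in Ioc (-R.1) R.2 ×ˢ univ, lsIntegrand ε kx k f r r₀)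
    atTop (𝓝 v)

/-- Hilbert–Schmidt operators: `∑ ‖A b_i‖² < ∞` for every Hilbert basis. -/
def IsHilbertSchmidt {V : Type*} [NormedAddCommGroup V] [InnerProductSpace ℂ V]
    [CompleteSpace V] (A : V →L[ℂ] V) : Prop :=
  ∀ (w : Set V) (b : HilbertBasis w ℂ V), Summable fun i => ‖A (b i)‖ ^ 2

/-- The generalized resolvent `E ↦ [1 - T(E)]⁻¹`; the value is `0` where `1 - T(E)` has no bounded
inverse. -/
def genResolvent {V : Type*} [NormedAddCommGroup V] [NormedSpace ℂ V]
    (T : ℂ → V →L[ℂ] V) (E : ℂ) : V →L[ℂ] V := Ring.inverse (1 - T E)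

/-- `E₀` is a pole of `R`: `R` is meromorphic at `E₀` and of negative order there. -/
def IsPole {W : Type*} [NormedAddCommGroup W] [NormedSpace ℂ W] (R : ℂ → W) (E₀ : ℂ) : Prop :=
  MeromorphicAt R E₀ ∧ meromorphicOrderAt R E₀ < 0

end

end SiegertStates

namespace SiegertStates

noncomputable section

/-! ### The square root and the cut plane -/

/-! The operator is built from the periodized kernel, and everything about it rests on one estimate.
For all but finitely many `m` the root of `E - k_{x,m}²` has imaginary part at least `|m|/2`, so the
terms decay like `exp (-|m||z|/2) / |m|`. Trading part of the exponential for a power bounds the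
series by `C |z|^(-1/4)`, uniformly in `x`, in bounded `z` and locally in `E`
(`exists_seriesTerm_bound`). The square of this weight is integrable, so the kernel lies in `L²(D ×
D)` and is dominated there locally uniformly in `E`. Cauchy estimates make it analytic as an `L²`
family (`differentiableAt_Lp_of_dominated`), and the continuous linear map `kernelOp` carries this
to the operator norm. Bessel's inequality on the slices of the kernel gives the Hilbert–Schmidt
property.

A Hilbert–Schmidt operator is a norm limit of operators of finite rank, so near each energy the
invertibility of `1 - T` is decided by the determinant of an analytic finite matrix
(`exists_local_resolvent`). The cut plane is connected because its cuts point downwards, and `1 - T`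
is invertible at a small positive imaginary energy because the prefactor `E` makes the kernel small.
Hence the exceptional set is discrete (`eventually_isUnit_one_sub`), the resolvent is meromorphic,
and its poles are exactly the exceptional points. There, by compactness, `1` is an eigenvalue of
`T`.

It remains to recognize the Lippmann–Schwinger operator at `E = k²`. Cutting the plane into unit
periods turns its integral into one over `D` with a quasi-periodic sum of Hankel functions as
kernel, and this sum must equal the series. For `k = iκ` it does by Poisson summation, since `K₀`
has the terms of the series as Fourier transform (`tsum_evanescent_eq`). The identity theorem
extends the equality to complex `k` with positive imaginary part near the positive axis
(`blochSeries_eq_tsum_latticeTerm`). On the real axis the sum converges only conditionally.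
Summation by parts bounds its tails uniformly down to the axis, because `exp (i (±k_x + k)) ≠ 1`
when `k²` is not a threshold (`exists_uniform_tail`). This uniformity also lets the strip ends `R₁`,
`R₂` tend to infinity independently. -/

/-- The plane without the closed negative imaginary axis. -/
def slitDown : Set ℂ := {w | ¬ (w.re = 0 ∧ w.im ≤ 0)}

theorem mem_slitDown_of_re_ne {w : ℂ} (h : w.re ≠ 0) : w ∈ slitDown := fun h' => h h'.1

theorem mem_slitDown_of_im_pos {w : ℂ} (h : 0 < w.im) : w ∈ slitDown := fun h' => h.not_ge h'.2

theorem ne_zero_of_mem_slitDown {w : ℂ} (h : w ∈ slitDown) : w ≠ 0 := by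
  rintro rfl
  exact h (by simp)

theorem neg_I_mul_mem_slitPlane {w : ℂ} (hw : w ∈ slitDown) : -Complex.I * w ∈ Complex.slitPlane := by
  rw [Complex.mem_slitPlane_iff]
  simp only [slitDown, mem_ofPred_eq, not_and_or, not_le] at hw
  rcases hw with h | h
  · right; simpa using h
  · left; simpa using h

theorem isOpen_slitDown : IsOpen slitDown := by
  have : slitDown = (fun w : ℂ => -Complex.I * w) ⁻¹' Complex.slitPlane := by
    ext w
    refine ⟨neg_I_mul_mem_slitPlane, fun h => ?_⟩
    rw [mem_preimage, Complex.mem_slitPlane_iff] at h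
    simp only [slitDown, mem_ofPred_eq, not_and_or, not_le]
    rcases h with h | h
    · right; simpa using h
    · left; simpa using h
  rw [this]
  exact Complex.isOpen_slitPlane.preimage (by fun_prop)

theorem cutSqrt_ne_zero (w : ℂ) : cutSqrt w ≠ 0 := Complex.exp_ne_zero _

theorem differentiableAt_cutSqrt {w : ℂ} (hw : w ∈ slitDown) : DifferentiableAt ℂ cutSqrt w := by
  have h := neg_I_mul_mem_slitPlane hw
  unfold cutSqrt cutLog
  refine DifferentiableAt.cexp (DifferentiableAt.div_const ?_ _)
  refine DifferentiableAt.add_const _ (DifferentiableAt.clog ?_ h)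
  fun_prop

theorem norm_cutSqrt_sq {w : ℂ} (hw : w ≠ 0) : ‖cutSqrt w‖ ^ 2 = ‖w‖ := by
  rw [← norm_pow, cutSqrt_sq hw]

/-- The argument of the root lies in `(-π/4, 3π/4)`. A negative imaginary part forces it into
`(-π/4, 0)`, where `sin (θ + π/4) > 0` says that the cosine exceeds minus the sine. -/
theorem neg_im_lt_re_cutSqrt {w : ℂ} (hw : w ∈ slitDown) (h : (cutSqrt w).im < 0) :
    -(cutSqrt w).im < (cutSqrt w).re := by
  have hm := cutLog_im_mem hw
  set θ := (cutLog w / 2).im with hθ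
  have hθ' : θ = (cutLog w).im / 2 := by simp [hθ]
  have hr := Real.exp_pos (cutLog w / 2).re
  have him : (cutSqrt w).im = Real.exp (cutLog w / 2).re * Real.sin θ := by
    rw [cutSqrt, Complex.exp_im]
  have hre : (cutSqrt w).re = Real.exp (cutLog w / 2).re * Real.cos θ := by
    rw [cutSqrt, Complex.exp_re]
  rw [him] at h
  have hs : Real.sin θ < 0 := by
    by_contra! h'
    exact h.not_ge (mul_nonneg hr.le h')
  have hπ := Real.pi_pos
  have hneg : θ < 0 := by
    by_contra! h'
    exact hs.not_ge (Real.sin_nonneg_of_nonneg_of_le_pi h' (by rw [hθ']; linarith [hm.2]))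
  have hlow : -(Real.pi / 4) < θ := by rw [hθ']; linarith [hm.1]
  have h1 : 0 < Real.sin (θ + Real.pi / 4) :=
    Real.sin_pos_of_pos_of_lt_pi (by linarith) (by linarith)
  rw [Real.sin_add, Real.cos_pi_div_four, Real.sin_pi_div_four] at h1
  have h2 : 0 < Real.sqrt 2 / 2 := by positivity
  have h3 : 0 < Real.sin θ + Real.cos θ := by
    by_contra! h'
    nlinarith
  rw [him, hre]
  nlinarith

theorem re_eq_cutSqrt {w : ℂ} (hw : w ≠ 0) : w.re = (cutSqrt w).re ^ 2 - (cutSqrt w).im ^ 2 := by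
  conv_lhs => rw [← cutSqrt_sq hw]
  rw [pow_two, Complex.mul_re]; ring

theorem im_eq_cutSqrt {w : ℂ} (hw : w ≠ 0) : w.im = 2 * (cutSqrt w).re * (cutSqrt w).im := by
  conv_lhs => rw [← cutSqrt_sq hw]
  rw [pow_two, Complex.mul_im]; ring

/-- Only the open fourth quadrant has roots below the real axis, that is, exponentially growing
waves: such a root has argument in `(-π/4, 0)` and its square has argument in `(-π/2, 0)`. -/
theorem im_cutSqrt_nonneg {w : ℂ} (hw : w ∈ slitDown) (h : 0 ≤ w.im ∨ w.re ≤ 0) :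
    0 ≤ (cutSqrt w).im := by
  by_contra! hlt
  have h1 := neg_im_lt_re_cutSqrt hw hlt
  have h0 := ne_zero_of_mem_slitDown hw
  rcases h with h | h
  · rw [im_eq_cutSqrt h0] at h
    nlinarith
  · rw [re_eq_cutSqrt h0] at h
    nlinarith

theorem norm_le_two_mul_im_cutSqrt_sq {w : ℂ} (hw : w ≠ 0) (h : w.re ≤ 0) :
    ‖w‖ ≤ 2 * (cutSqrt w).im ^ 2 := by
  rw [← norm_cutSqrt_sq hw, ← Complex.normSq_eq_norm_sq, Complex.normSq_apply]
  rw [re_eq_cutSqrt hw] at h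
  nlinarith

theorem mem_cutPlane_iff {kx : ℝ} {E : ℂ} :
    E ∈ cutPlane kx ↔ ∀ m, E - (waveNumber kx m : ℂ) ^ 2 ∈ slitDown := by
  refine ⟨fun h m ⟨h1, h2⟩ => h m (-(E - (waveNumber kx m : ℂ) ^ 2).im) (by linarith) ?_,
    fun h m s hs hE => h m ?_⟩
  · apply Complex.ext
    · simp only [Complex.sub_re] at h1
      simp
      linarith
    · simp
  · rw [hE]
    constructor
    · simp
    · simp only [Complex.sub_im, Complex.mul_im, Complex.I_re, Complex.I_im, Complex.ofReal_im,
        Complex.ofReal_re]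
      linarith

theorem abs_le_abs_waveNumber {kx : ℝ} {m : ℤ} (h : |kx| ≤ |(m : ℝ)|) :
    |(m : ℝ)| ≤ |waveNumber kx m| := by
  have h1 : |2 * Real.pi * (m : ℝ)| = 2 * Real.pi * |(m : ℝ)| := by
    rw [abs_mul, abs_of_pos Real.two_pi_pos]
  have h2 : 2 * Real.pi * (m : ℝ) = waveNumber kx m - kx := by unfold waveNumber; ring
  have h3 := abs_sub (waveNumber kx m) kx
  rw [← h2, h1] at h3
  nlinarith [Real.pi_gt_three, abs_nonneg (m : ℝ)]

theorem waveNumber_sq_ofReal (kx : ℝ) (m : ℤ) :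
    (waveNumber kx m : ℂ) ^ 2 = ((waveNumber kx m ^ 2 : ℝ) : ℂ) := by push_cast; rfl

theorem sub_waveNumber_re (kx : ℝ) (m : ℤ) (E : ℂ) :
    (E - (waveNumber kx m : ℂ) ^ 2).re = E.re - waveNumber kx m ^ 2 := by
  rw [waveNumber_sq_ofReal, Complex.sub_re, Complex.ofReal_re]

theorem sub_waveNumber_im (kx : ℝ) (m : ℤ) (E : ℂ) :
    (E - (waveNumber kx m : ℂ) ^ 2).im = E.im := by
  rw [waveNumber_sq_ofReal, Complex.sub_im, Complex.ofReal_im, sub_zero]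

/-- From some order on, all wave numbers dominate both the index and a given energy bound. -/
theorem exists_large_waveNumber (kx R : ℝ) :
    ∃ M : ℕ, 0 < M ∧ ∀ m : ℤ, (M : ℤ) ≤ |m| →
      |(m : ℝ)| ≤ |waveNumber kx m| ∧ 2 * R < waveNumber kx m ^ 2 ∧ 1 ≤ |(m : ℝ)| := by
  obtain ⟨M, hM⟩ := exists_nat_gt (|kx| + 2 * |R| + 1)
  refine ⟨M, ?_, fun m hm => ?_⟩
  · have : (0 : ℝ) < M := by linarith [abs_nonneg kx, abs_nonneg R]
    exact_mod_cast this
  have h1 : (M : ℝ) ≤ |(m : ℝ)| := by exact_mod_cast hm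
  have hkx := abs_nonneg kx
  have hR := abs_nonneg R
  have h2 := abs_le_abs_waveNumber (kx := kx) (m := m) (by linarith)
  refine ⟨h2, ?_, by linarith⟩
  rw [← sq_abs]
  nlinarith [le_abs_self R]

/-- Only the finitely many orders below `M` need separate neighbourhoods; the large orders are
handled together by one estimate. -/
theorem eventually_all_of_large {α : Type*} {l : Filter α} (M : ℕ) {p : α → ℤ → Prop}
    (hsmall : ∀ m, ∀ᶠ a in l, p a m) (hlarge : ∀ᶠ a in l, ∀ m : ℤ, (M : ℤ) ≤ |m| → p a m) :
    ∀ᶠ a in l, ∀ m, p a m := by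
  have h := (eventually_all_finset (l := l) (Finset.Ioo (-(M : ℤ)) M)
    (p := fun m a => p a m)).2 fun m _ => hsmall m
  filter_upwards [h, hlarge] with a h1 h2 m
  by_cases hm : (M : ℤ) ≤ |m|
  · exact h2 m hm
  · rw [not_le, abs_lt] at hm
    exact h1 m (Finset.mem_Ioo.2 hm)

theorem isOpen_cutPlane (kx : ℝ) : IsOpen (cutPlane kx) := by
  rw [isOpen_iff_eventually]
  intro E hE
  obtain ⟨M, -, hM⟩ := exists_large_waveNumber kx (|E.re| + 1)
  rw [mem_cutPlane_iff] at hE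
  simp only [mem_cutPlane_iff]
  refine eventually_all_of_large M (fun m => ?_) ?_
  · have hc : ContinuousAt (fun E : ℂ => E - (waveNumber kx m : ℂ) ^ 2) E := by fun_prop
    exact hc (isOpen_slitDown.mem_nhds (hE m))
  -- Cuts of large order start far to the right: on a half plane containing `E` the differences have
  -- negative real part, so the family of cuts is locally finite.
  · have h1 : ∀ᶠ E' : ℂ in 𝓝 E, E'.re < |E.re| + 1 :=
      Complex.continuous_re.continuousAt.eventually_lt_const (by linarith [le_abs_self E.re])
    filter_upwards [h1] with E' h' m hm
    refine mem_slitDown_of_re_ne ?_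
    rw [sub_waveNumber_re]
    nlinarith [(hM m hm).2.1, abs_nonneg E.re]

theorem mem_cutPlane_of_im_pos (kx : ℝ) {E : ℂ} (h : 0 < E.im) : E ∈ cutPlane kx :=
  mem_cutPlane_iff.2 fun m => mem_slitDown_of_im_pos (by rwa [sub_waveNumber_im])

theorem mem_cutPlane_of_re_neg (kx : ℝ) {E : ℂ} (h : E.re < 0) : E ∈ cutPlane kx :=
  mem_cutPlane_iff.2 fun m => mem_slitDown_of_re_ne (by
    rw [sub_waveNumber_re]; nlinarith [sq_nonneg (waveNumber kx m)])

theorem add_I_mul_mem_cutPlane {kx : ℝ} {E : ℂ} (hE : E ∈ cutPlane kx) {t : ℝ} (ht : 0 ≤ t) :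
    E + Complex.I * t ∈ cutPlane kx := by
  intro m s hs h
  refine hE m (s + t) (by linarith) ?_
  push_cast
  linear_combination h

theorem isPreconnected_cutPlane (kx : ℝ) : IsPreconnected (cutPlane kx) := by
  have hH : IsPreconnected {E : ℂ | 0 < E.im} :=
    (convex_halfSpace_im_gt 0).isPreconnected
  refine isPreconnected_of_forall (x := Complex.I) fun E hE => ?_
  -- Moving straight up never meets a downward cut, and `t` is large enough to reach the upper half
  -- plane, which meets no cut at all.
  set t : ℝ := |E.im| + 1 with ht
  have ht0 : 0 ≤ t := by positivity
  refine ⟨segment ℝ E (E + Complex.I * t) ∪ {E : ℂ | 0 < E.im}, ?_, Or.inr (by simp),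
    Or.inl (left_mem_segment ℝ _ _), ?_⟩
  · rintro w (hw | hw)
    · rw [segment_eq_image'] at hw
      obtain ⟨θ, hθ, rfl⟩ := hw
      have : E + θ • (E + Complex.I * t - E) = E + Complex.I * ((θ * t : ℝ) : ℂ) := by
        simp only [Complex.real_smul]; push_cast; ring
      show E + θ • (E + Complex.I * t - E) ∈ _
      rw [this]
      exact add_I_mul_mem_cutPlane hE (mul_nonneg hθ.1 ht0)
    · exact mem_cutPlane_of_im_pos kx hw
  · refine IsPreconnected.union (E + Complex.I * t) (right_mem_segment ℝ _ _) ?_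
      (convex_segment _ _).isPreconnected hH
    simp only [mem_ofPred_eq, Complex.add_im, Complex.mul_im, Complex.I_re, Complex.I_im,
      Complex.ofReal_im, Complex.ofReal_re]
    linarith [neg_abs_le E.im]

/-! ### The series for the kernel -/

theorem norm_seriesTerm (kx : ℝ) (E : ℂ) (x z : ℝ) (m : ℤ) :
    ‖seriesTerm kx E x z m‖ = Real.exp (-(|z| * (cutSqrt (E - (waveNumber kx m : ℂ) ^ 2)).im))
      / ‖cutSqrt (E - (waveNumber kx m : ℂ) ^ 2)‖ := by
  rw [seriesTerm, norm_div, Complex.norm_exp]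
  congr 2
  rw [← Complex.ofReal_mul]
  simp

/-- The exponent `1/4` serves two ends: `|m|^(-1/4)` makes `1/|m|` summable, and the price
`|z|^(-1/4)` is still square integrable. -/
theorem exp_neg_le_rpow {t : ℝ} (ht : 0 < t) : Real.exp (-t) ≤ t ^ (-(1 / 4) : ℝ) := by
  rw [Real.exp_neg, Real.rpow_neg ht.le]
  refine inv_anti₀ (by positivity) ?_
  have h1 : t ≤ Real.exp t := by linarith [Real.add_one_le_exp t]
  rcases le_total t 1 with h | h
  · exact (Real.rpow_le_one ht.le h (by norm_num)).trans (Real.one_le_exp ht.le)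
  · calc t ^ (1 / 4 : ℝ) ≤ t ^ (1 : ℝ) := Real.rpow_le_rpow_of_exponent_le h (by norm_num)
      _ ≤ _ := by rwa [Real.rpow_one]

/-- Here `Re w ≤ -m²/2`, and for `Re w ≤ 0` the imaginary part carries at least half of `|√w|²`, so
both `Im √w` and `|√w|` are at least `|m|/2`. The constant `4` is `2` from this denominator times a
crude bound `2` for `(1/2)^(-1/4)`. -/
theorem norm_seriesTerm_le_of_large {kx : ℝ} {E : ℂ} {m : ℤ} {x z : ℝ} (hz : 0 < |z|)
    (h1 : |(m : ℝ)| ≤ |waveNumber kx m|) (h2 : 2 * E.re ≤ waveNumber kx m ^ 2)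
    (h3 : 1 ≤ |(m : ℝ)|) :
    ‖seriesTerm kx E x z m‖ ≤ 4 * |(m : ℝ)| ^ (-(5 / 4) : ℝ) * |z| ^ (-(1 / 4) : ℝ) := by
  set w := E - (waveNumber kx m : ℂ) ^ 2 with hw
  have hre : w.re = E.re - waveNumber kx m ^ 2 := sub_waveNumber_re kx m E
  have hk : |(m : ℝ)| ^ 2 ≤ waveNumber kx m ^ 2 := by
    rw [← sq_abs (waveNumber kx m)]
    exact pow_le_pow_left₀ (abs_nonneg _) h1 2
  have hm0 : 0 < |(m : ℝ)| := by linarith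
  have hre' : w.re ≤ -(|(m : ℝ)| ^ 2 / 2) := by rw [hre]; linarith
  have hneg : w.re < 0 := by nlinarith
  have hsl : w ∈ slitDown := mem_slitDown_of_re_ne hneg.ne
  have h0 := ne_zero_of_mem_slitDown hsl
  have hnorm : |(m : ℝ)| ^ 2 / 2 ≤ ‖w‖ := by
    have := Complex.abs_re_le_norm w
    rw [abs_of_neg hneg] at this
    linarith
  have him : |(m : ℝ)| / 2 ≤ (cutSqrt w).im := by
    have ha := norm_le_two_mul_im_cutSqrt_sq h0 hneg.le
    have hb := im_cutSqrt_nonneg hsl (Or.inr hneg.le)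
    refine (sq_le_sq₀ (by positivity) hb).1 ?_
    nlinarith
  have hsq : |(m : ℝ)| / 2 ≤ ‖cutSqrt w‖ := him.trans ((le_abs_self _).trans (Complex.abs_im_le_norm _))
  rw [norm_seriesTerm]
  have hexp : Real.exp (-(|z| * (cutSqrt w).im)) ≤ (|z| * (|(m : ℝ)| / 2)) ^ (-(1 / 4) : ℝ) := by
    refine le_trans (Real.exp_le_exp.2 ?_) (exp_neg_le_rpow (by positivity))
    exact neg_le_neg (mul_le_mul_of_nonneg_left him hz.le)
  have hhalf : (1 / 2 : ℝ) ^ (-(1 / 4) : ℝ) ≤ 2 := by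
    rw [one_div, Real.inv_rpow (by norm_num), ← Real.rpow_neg (by norm_num), neg_neg]
    calc (2 : ℝ) ^ (1 / 4 : ℝ) ≤ 2 ^ (1 : ℝ) :=
          Real.rpow_le_rpow_of_exponent_le (by norm_num) (by norm_num)
      _ = 2 := by norm_num
  have hsplit : (|z| * (|(m : ℝ)| / 2)) ^ (-(1 / 4) : ℝ)
      ≤ 2 * |(m : ℝ)| ^ (-(1 / 4) : ℝ) * |z| ^ (-(1 / 4) : ℝ) := by
    rw [div_eq_mul_one_div, Real.mul_rpow hz.le (by positivity), Real.mul_rpow hm0.le (by norm_num)]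
    have ha : 0 ≤ |z| ^ (-(1 / 4) : ℝ) := by positivity
    have hb : 0 ≤ |(m : ℝ)| ^ (-(1 / 4) : ℝ) := by positivity
    nlinarith [mul_nonneg ha hb]
  have h54 : |(m : ℝ)| ^ (-(5 / 4) : ℝ) = |(m : ℝ)| ^ (-(1 / 4) : ℝ) / |(m : ℝ)| := by
    rw [show (-(5 / 4) : ℝ) = -(1 / 4) - 1 by norm_num, Real.rpow_sub_one hm0.ne']
  calc _ ≤ (2 * |(m : ℝ)| ^ (-(1 / 4) : ℝ) * |z| ^ (-(1 / 4) : ℝ)) / (|(m : ℝ)| / 2) := by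
        gcongr
        exact hexp.trans hsplit
    _ = _ := by rw [h54]; field_simp; ring

/-- Lets the finitely many nonsingular terms be bounded by the same singular weight as the others.
-/
theorem one_le_rpow_mul_rpow {L z : ℝ} (hz : 0 < |z|) (hL : |z| ≤ L) :
    1 ≤ L ^ (1 / 4 : ℝ) * |z| ^ (-(1 / 4) : ℝ) := by
  rw [Real.rpow_neg hz.le, ← div_eq_mul_inv, one_le_div (by positivity)]
  exact Real.rpow_le_rpow hz.le hL (by norm_num)

theorem summable_ite_large (c : ℝ) (M : ℕ) (v : ℤ → ℝ) :
    Summable fun m : ℤ => if (M : ℤ) ≤ |m| then c * |(m : ℝ)| ^ (-(5 / 4) : ℝ) else v m := by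
  have h : Summable fun m : ℤ => c * |(m : ℝ)| ^ (-(5 / 4) : ℝ) :=
    (Real.summable_abs_int_rpow (by norm_num)).mul_left c
  refine (summable_congr_cofinite ?_).1 h
  have hf : Set.Finite {m : ℤ | ¬ (M : ℤ) ≤ |m|} := by
    refine (Finset.Ioo (-(M : ℤ)) M).finite_toSet.subset fun m hm => ?_
    simp only [mem_ofPred_eq, not_le, abs_lt] at hm
    simpa using hm
  filter_upwards [hf.compl_mem_cofinite] with m hm
  simp only [mem_compl_iff, mem_ofPred_eq, not_not] at hm
  simp [hm]

/-- A Weierstrass majorant valid at once for all `x`, all `|z| ≤ L` and all `E` near `E₀`. It yields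
convergence and analyticity of the series and the domination of the kernel in `L²`. Finitely many
terms may grow with `|z|`, which costs only a constant because `|z| ≤ L`. -/
theorem exists_seriesTerm_bound {kx : ℝ} {E₀ : ℂ} (hE₀ : E₀ ∈ cutPlane kx) {L : ℝ} (_hL : 0 < L) :
    ∃ u : ℤ → ℝ, Summable u ∧ ∀ᶠ E in 𝓝 E₀, ∀ (m : ℤ) (x z : ℝ), 0 < |z| → |z| ≤ L →
      ‖seriesTerm kx E x z m‖ ≤ u m * |z| ^ (-(1 / 4) : ℝ) := by
  obtain ⟨M, -, hM⟩ := exists_large_waveNumber kx (|E₀.re| + 1)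
  have hsmall : ∀ m : ℤ, ∃ v : ℝ, ∀ᶠ E in 𝓝 E₀, ∀ x z : ℝ, 0 < |z| → |z| ≤ L →
      ‖seriesTerm kx E x z m‖ ≤ v * |z| ^ (-(1 / 4) : ℝ) := by
    intro m
    set s : ℂ → ℂ := fun E => cutSqrt (E - (waveNumber kx m : ℂ) ^ 2)
    have hs : ContinuousAt s E₀ := by
      have h1 := (differentiableAt_cutSqrt (mem_cutPlane_iff.1 hE₀ m)).continuousAt
      exact ContinuousAt.comp (f := fun E : ℂ => E - (waveNumber kx m : ℂ) ^ 2) h1 (by fun_prop)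
    have hs0 : 0 < ‖s E₀‖ := norm_pos_iff.2 (cutSqrt_ne_zero _)
    have h1 : ∀ᶠ E in 𝓝 E₀, ‖s E‖ < ‖s E₀‖ + 1 := hs.norm.eventually_lt_const (by linarith)
    have h2 : ∀ᶠ E in 𝓝 E₀, ‖s E₀‖ / 2 < ‖s E‖ := hs.norm.eventually_const_lt (by linarith)
    refine ⟨Real.exp (L * (‖s E₀‖ + 1)) / (‖s E₀‖ / 2) * L ^ (1 / 4 : ℝ), ?_⟩
    filter_upwards [h1, h2] with E h1 h2 x z hz hzL
    rw [norm_seriesTerm]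
    have hb : Real.exp (-(|z| * (s E).im)) ≤ Real.exp (L * (‖s E₀‖ + 1)) := by
      refine Real.exp_le_exp.2 ?_
      have h3 := (neg_le_abs _).trans (Complex.abs_im_le_norm (s E))
      calc -(|z| * (s E).im) = |z| * (-(s E).im) := by ring
        _ ≤ |z| * (‖s E₀‖ + 1) := by gcongr; linarith
        _ ≤ _ := by gcongr
    calc _ ≤ Real.exp (L * (‖s E₀‖ + 1)) / (‖s E₀‖ / 2) := by gcongr
      _ ≤ Real.exp (L * (‖s E₀‖ + 1)) / (‖s E₀‖ / 2) * (L ^ (1 / 4 : ℝ) * |z| ^ (-(1 / 4) : ℝ)) :=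
        le_mul_of_one_le_right (by positivity) (one_le_rpow_mul_rpow hz hzL)
      _ = _ := by ring
  choose v hv using hsmall
  refine ⟨_, summable_ite_large 4 M v, eventually_all_of_large M (fun m => ?_) ?_⟩
  · by_cases hm : (M : ℤ) ≤ |m|
    · simp only [hm, if_true]
      have h1 : ∀ᶠ E' : ℂ in 𝓝 E₀, E'.re < |E₀.re| + 1 :=
        Complex.continuous_re.continuousAt.eventually_lt_const (by linarith [le_abs_self E₀.re])
      filter_upwards [h1] with E h1 x z hz _
      exact norm_seriesTerm_le_of_large hz (hM m hm).1 (by linarith [(hM m hm).2.1]) (hM m hm).2.2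
    · simpa only [hm, if_false] using hv m
  · have h1 : ∀ᶠ E' : ℂ in 𝓝 E₀, E'.re < |E₀.re| + 1 :=
      Complex.continuous_re.continuousAt.eventually_lt_const (by linarith [le_abs_self E₀.re])
    filter_upwards [h1] with E h1 m hm x z hz _
    simp only [hm, if_true]
    exact norm_seriesTerm_le_of_large hz (hM m hm).1 (by linarith [(hM m hm).2.1]) (hM m hm).2.2

theorem summable_seriesTerm {kx : ℝ} {E : ℂ} (hE : E ∈ cutPlane kx) (x : ℝ) {z : ℝ} (hz : z ≠ 0) :
    Summable (seriesTerm kx E x z) := by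
  have hz' : 0 < |z| := abs_pos.2 hz
  obtain ⟨u, hu, h⟩ := exists_seriesTerm_bound hE hz'
  exact Summable.of_norm_bounded (hu.mul_right _) fun m => h.self_of_nhds m x z hz' le_rfl

theorem differentiableAt_seriesTerm {kx : ℝ} {E : ℂ} (hE : E ∈ cutPlane kx) (x z : ℝ) (m : ℤ) :
    DifferentiableAt ℂ (fun E => seriesTerm kx E x z m) E := by
  have hs : DifferentiableAt ℂ (fun E => cutSqrt (E - (waveNumber kx m : ℂ) ^ 2)) E := by
    have h1 := differentiableAt_cutSqrt (mem_cutPlane_iff.1 hE m)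
    exact DifferentiableAt.comp (f := fun E : ℂ => E - (waveNumber kx m : ℂ) ^ 2) E h1 (by fun_prop)
  unfold seriesTerm
  refine DifferentiableAt.div (DifferentiableAt.cexp ?_) hs (cutSqrt_ne_zero _)
  fun_prop

theorem differentiableOn_blochSeries (kx x : ℝ) {z : ℝ} (hz : z ≠ 0) :
    DifferentiableOn ℂ (fun E => blochSeries kx E x z) (cutPlane kx) := by
  intro E₀ hE₀
  have hz' : 0 < |z| := abs_pos.2 hz
  obtain ⟨u, hu, h⟩ := exists_seriesTerm_bound hE₀ hz'
  obtain ⟨U, hU, hUo, hmem⟩ := eventually_nhds_iff.1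
    (h.and ((isOpen_cutPlane kx).eventually_mem hE₀))
  have hd : DifferentiableOn ℂ (fun E => ∑' m : ℤ, seriesTerm kx E x z m) U :=
    Complex.differentiableOn_tsum_of_summable_norm (hu.mul_right (|z| ^ (-(1 / 4) : ℝ)))
      (fun m E hE => (differentiableAt_seriesTerm (hU E hE).2 x z m).differentiableWithinAt) hUo
      (fun m E hE => (hU E hE).1 m x z hz' le_rfl)
  have hd' := (hd E₀ hmem).differentiableAt (hUo.mem_nhds hmem)
  unfold blochSeries
  exact (DifferentiableAt.mul (by fun_prop) hd').differentiableWithinAt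

theorem analyticOnNhd_blochSeries (kx x : ℝ) {z : ℝ} (hz : z ≠ 0) :
    AnalyticOnNhd ℂ (fun E => blochSeries kx E x z) (cutPlane kx) :=
  (differentiableOn_blochSeries kx x hz).analyticOnNhd (isOpen_cutPlane kx)

theorem norm_blochSeries_le_of_bound {kx : ℝ} {E : ℂ} {x z : ℝ} {u : ℤ → ℝ} (hu : Summable u)
    (h : ∀ m, ‖seriesTerm kx E x z m‖ ≤ u m * |z| ^ (-(1 / 4) : ℝ)) :
    ‖blochSeries kx E x z‖ ≤ ‖E‖ / 2 * (∑' m, u m) * |z| ^ (-(1 / 4) : ℝ) := by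
  rw [blochSeries, norm_mul, mul_assoc, ← tsum_mul_right]
  refine mul_le_mul (le_of_eq ?_) (tsum_of_norm_bounded (hu.mul_right _).hasSum h) (norm_nonneg _)
    (by positivity)
  simp

theorem exists_blochSeries_bound {kx : ℝ} {E₀ : ℂ} (hE₀ : E₀ ∈ cutPlane kx) {L : ℝ} (hL : 0 < L) :
    ∃ C : ℝ, ∀ᶠ E in 𝓝 E₀, ∀ x z : ℝ, 0 < |z| → |z| ≤ L →
      ‖blochSeries kx E x z‖ ≤ C * |z| ^ (-(1 / 4) : ℝ) := by
  obtain ⟨u, hu, h⟩ := exists_seriesTerm_bound hE₀ hL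
  have h1 : ∀ᶠ E : ℂ in 𝓝 E₀, ‖E‖ < ‖E₀‖ + 1 :=
    (continuous_norm (E := ℂ)).continuousAt.eventually_lt_const (by linarith)
  refine ⟨(‖E₀‖ + 1) / 2 * |∑' m, u m|, ?_⟩
  filter_upwards [h, h1] with E h h1 x z hz hzL
  refine (norm_blochSeries_le_of_bound hu fun m => h m x z hz hzL).trans ?_
  have h2 : ‖E‖ / 2 ≤ (‖E₀‖ + 1) / 2 := by linarith
  exact mul_le_mul_of_nonneg_right
    ((mul_le_mul_of_nonneg_left (le_abs_self _) (by positivity)).trans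
      (mul_le_mul_of_nonneg_right h2 (abs_nonneg _))) (by positivity)

/-- The kernel tends to zero with `E`, along the imaginary axis. -/
theorem exists_blochSeries_small (kx : ℝ) {L η : ℝ} (hL : 0 < L) (hη : 0 < η) :
    ∃ E ∈ cutPlane kx, ∀ x z : ℝ, 0 < |z| → |z| ≤ L →
      ‖blochSeries kx E x z‖ ≤ η * |z| ^ (-(1 / 4) : ℝ) := by
  obtain ⟨M, -, hM⟩ := exists_large_waveNumber kx 1
  set v : ℤ → ℝ := fun m => if (M : ℤ) ≤ |m| then 4 * |(m : ℝ)| ^ (-(5 / 4) : ℝ) else L ^ (1 / 4 : ℝ)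
    with hv
  have hvs : Summable v := summable_ite_large 4 M _
  have hv0 : ∀ m, 0 ≤ v m := fun m => by
    simp only [hv]; split_ifs <;> positivity
  set S := ∑' m, v m with hS
  have hS0 : 0 ≤ S := tsum_nonneg hv0
  obtain ⟨τ, hτ0, hτ1, hτ⟩ : ∃ τ : ℝ, 0 < τ ∧ τ ≤ 1 ∧ τ * S ≤ η := by
    refine ⟨min 1 (η / (S + 1)), by positivity, min_le_left _ _, ?_⟩
    calc _ ≤ η / (S + 1) * (S + 1) :=
          mul_le_mul (min_le_right _ _) (by linarith) hS0 (by positivity)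
      _ = η := by field_simp
  -- Every `E - k_{x,m}²` has imaginary part `τ²`, so all roots have modulus at least `τ`. The sum
  -- is therefore at most of order `1/τ`, while the prefactor is of order `τ²`.
  set E : ℂ := Complex.I * ((τ ^ 2 : ℝ) : ℂ) with hE
  have hEim : E.im = τ ^ 2 := by
    rw [hE, mul_comm, Complex.im_ofReal_mul, Complex.I_im, mul_one]
  have hEre : E.re = 0 := by rw [hE, mul_comm, Complex.re_ofReal_mul, Complex.I_re, mul_zero]
  have hEn : ‖E‖ = τ ^ 2 := by
    rw [hE, norm_mul, Complex.norm_I, one_mul, Complex.norm_real, Real.norm_of_nonneg (by positivity)]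
  refine ⟨E, mem_cutPlane_of_im_pos kx (by rw [hEim]; positivity), fun x z hz hzL => ?_⟩
  have hterm : ∀ m, ‖seriesTerm kx E x z m‖ ≤ (v m / τ) * |z| ^ (-(1 / 4) : ℝ) := by
    intro m
    by_cases hm : (M : ℤ) ≤ |m|
    · have h1 := norm_seriesTerm_le_of_large (x := x) hz (hM m hm).1
        (E := E) (by rw [hEre]; nlinarith [(hM m hm).2.1]) (hM m hm).2.2
      refine h1.trans ?_
      simp only [hv, hm, if_true]
      gcongr
      exact le_div_self (by positivity) hτ0 hτ1
    · simp only [hv, hm, if_false]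
      set w := E - (waveNumber kx m : ℂ) ^ 2 with hw
      have hwim : w.im = τ ^ 2 := by rw [hw, sub_waveNumber_im, hEim]
      have hsl : w ∈ slitDown := mem_slitDown_of_im_pos (by rw [hwim]; positivity)
      have h0 := ne_zero_of_mem_slitDown hsl
      have hi := im_cutSqrt_nonneg hsl (Or.inl (by rw [hwim]; positivity))
      have hn : τ ≤ ‖cutSqrt w‖ := by
        refine (sq_le_sq₀ hτ0.le (norm_nonneg _)).1 ?_
        rw [norm_cutSqrt_sq h0, ← hwim]
        exact (le_abs_self _).trans (Complex.abs_im_le_norm w)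
      rw [norm_seriesTerm]
      calc _ ≤ 1 / τ := by
            gcongr
            exact Real.exp_le_one_iff.2 (neg_nonpos.2 (by positivity))
        _ ≤ 1 / τ * (L ^ (1 / 4 : ℝ) * |z| ^ (-(1 / 4) : ℝ)) :=
          le_mul_of_one_le_right (by positivity) (one_le_rpow_mul_rpow hz hzL)
        _ = _ := by ring
  refine (norm_blochSeries_le_of_bound (hvs.div_const τ) hterm).trans ?_
  rw [tsum_div_const, hEn]
  gcongr
  calc τ ^ 2 / 2 * (S / τ) = τ * S / 2 := by field_simp
    _ ≤ η := by nlinarith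

end

end SiegertStates

namespace SiegertStates

noncomputable section

/-! ### Integral operators with square integrable kernels -/

open scoped ENNReal

section KernelOp

variable {X : Type*} [MeasurableSpace X] {μ : Measure X}

theorem eLpNorm_two_sq {Y F : Type*} [MeasurableSpace Y] [NormedAddCommGroup F] {ν : Measure Y}
    (f : Y → F) : eLpNorm f 2 ν ^ 2 = ∫⁻ y, ‖f y‖ₑ ^ 2 ∂ν := by
  simpa using eLpNorm_nnreal_pow_eq_lintegral (f := f) (μ := ν) (p := 2) two_ne_zero

theorem lintegral_enorm_mul_le {f g : X → ℂ} (hf : AEStronglyMeasurable f μ)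
    (hg : AEStronglyMeasurable g μ) :
    ∫⁻ y, ‖f y * g y‖ₑ ∂μ ≤ eLpNorm f 2 μ * eLpNorm g 2 μ := by
  have h := eLpNorm_smul_le_mul_eLpNorm (p := 2) (q := 2) (r := 1) hg hf
  rwa [eLpNorm_one_eq_lintegral_enorm] at h

/-- The value at `x` of the integral operator with kernel `K` on `f`. -/
def kernelFun (μ : Measure X) (K : X × X → ℂ) (f : X → ℂ) (x : X) : ℂ := ∫ y, K (x, y) * f y ∂μ

theorem integrable_slice_mul {k f : X → ℂ} (hk : MemLp k 2 μ) (hf : MemLp f 2 μ) :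
    Integrable (fun y => k y * f y) μ :=
  hk.integrable_mul hf

theorem enorm_kernelFun_le {K : X × X → ℂ} {f : X → ℂ} {x : X}
    (hK : AEStronglyMeasurable (fun y => K (x, y)) μ) (hf : AEStronglyMeasurable f μ) :
    ‖kernelFun μ K f x‖ₑ ≤ eLpNorm (fun y => K (x, y)) 2 μ * eLpNorm f 2 μ :=
  (enorm_integral_le_lintegral_enorm _).trans (lintegral_enorm_mul_le hK hf)

theorem kernelFun_smul_left (c : ℂ) (K : X × X → ℂ) (f : X → ℂ) :
    kernelFun μ (c • K) f = c • kernelFun μ K f := by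
  ext x
  simp only [kernelFun, Pi.smul_apply, smul_eq_mul, mul_assoc, integral_const_mul]

theorem kernelFun_smul_right (c : ℂ) (K : X × X → ℂ) (f : X → ℂ) :
    kernelFun μ K (c • f) = c • kernelFun μ K f := by
  ext x
  simp only [kernelFun, Pi.smul_apply, smul_eq_mul, mul_left_comm _ c, integral_const_mul]

/-- The value of the operator at `x` is the inner product with the conjugate of the slice `K (x,
·)`, so this is Bessel's inequality for that conjugate. -/
theorem sum_enorm_sq_kernelFun_le {ι : Type*} {b : ι → Lp ℂ 2 μ} (hb : Orthonormal ℂ b)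
    (s : Finset ι) {K : X × X → ℂ} {x : X} (hK : MemLp (fun y => K (x, y)) 2 μ) :
    ∑ i ∈ s, ‖kernelFun μ K (b i) x‖ₑ ^ 2 ≤ eLpNorm (fun y => K (x, y)) 2 μ ^ 2 := by
  have hKs : MemLp (star fun y => K (x, y)) 2 μ := hK.star
  set k : Lp ℂ 2 μ := hKs.toLp _ with hk
  have hinner : ∀ i, inner ℂ k (b i) = kernelFun μ K (b i) x := by
    intro i
    rw [L2.inner_def]
    refine integral_congr_ae ?_
    filter_upwards [hKs.coeFn_toLp] with y hy
    rw [hk, hy]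
    simp [RCLike.inner_apply, mul_comm]
  have hnorm : ‖k‖ₑ = eLpNorm (fun y => K (x, y)) 2 μ := by
    rw [hk, Lp.enorm_toLp]
    exact eLpNorm_congr_norm_ae (by simp)
  have hbes := hb.sum_inner_products_le k (s := s)
  rw [← hnorm]
  have hcast : ∀ z : ℂ, ‖z‖ₑ ^ 2 = ENNReal.ofReal (‖z‖ ^ 2) := fun z => by
    rw [← ofReal_norm, ENNReal.ofReal_pow (norm_nonneg _)]
  have hcast' : ‖k‖ₑ ^ 2 = ENNReal.ofReal (‖k‖ ^ 2) := by
    rw [← ofReal_norm, ENNReal.ofReal_pow (norm_nonneg _)]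
  rw [hcast']
  simp_rw [hcast]
  rw [← ENNReal.ofReal_sum_of_nonneg (fun _ _ => by positivity)]
  refine ENNReal.ofReal_le_ofReal (le_trans (le_of_eq ?_) hbes)
  refine Finset.sum_congr rfl fun i _ => ?_
  rw [← hinner, norm_inner_symm]

variable [SFinite μ]

theorem lintegral_eLpNorm_slice_sq {K : X × X → ℂ} (hK : AEStronglyMeasurable K (μ.prod μ)) :
    ∫⁻ x, eLpNorm (fun y => K (x, y)) 2 μ ^ 2 ∂μ = eLpNorm K 2 (μ.prod μ) ^ 2 := by
  rw [eLpNorm_two_sq, lintegral_prod _ (hK.enorm.pow_const 2)]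
  exact lintegral_congr fun x => eLpNorm_two_sq _

theorem ae_memLp_slice {K : X × X → ℂ} (hK : MemLp K 2 (μ.prod μ)) :
    ∀ᵐ x ∂μ, MemLp (fun y => K (x, y)) 2 μ := by
  have h1 : ∫⁻ x, eLpNorm (fun y => K (x, y)) 2 μ ^ 2 ∂μ ≠ ∞ := by
    rw [lintegral_eLpNorm_slice_sq hK.1]
    exact ENNReal.pow_ne_top hK.2.ne
  have h2 : AEMeasurable (fun x => eLpNorm (fun y => K (x, y)) 2 μ ^ 2) μ := by
    simp_rw [eLpNorm_two_sq]
    exact (hK.1.enorm.pow_const 2).lintegral_prod_right'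
  filter_upwards [ae_lt_top' h2 h1, hK.1.prodMk_left] with x hx hx'
  refine ⟨hx', ?_⟩
  by_contra! h
  rw [top_le_iff.1 h] at hx
  simp at hx

theorem kernelFun_congr {K K' : X × X → ℂ} {f f' : X → ℂ} (hK : K =ᵐ[μ.prod μ] K')
    (hf : f =ᵐ[μ] f') : kernelFun μ K f =ᵐ[μ] kernelFun μ K' f' := by
  filter_upwards [Measure.ae_ae_of_ae_prod hK] with x hx
  refine integral_congr_ae ?_
  filter_upwards [hx, hf] with y h1 h2
  rw [h1, h2]

theorem aestronglyMeasurable_kernelFun {K : X × X → ℂ} {f : X → ℂ}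
    (hK : AEStronglyMeasurable K (μ.prod μ)) (hf : AEStronglyMeasurable f μ) :
    AEStronglyMeasurable (kernelFun μ K f) μ :=
  (hK.mul hf.comp_snd).integral_prod_right'

/-- Cauchy–Schwarz on each slice, then Tonelli. The resulting joint bound makes the operator norm
continuous in the kernel. -/
theorem eLpNorm_kernelFun_le {K : X × X → ℂ} {f : X → ℂ} (hK : AEStronglyMeasurable K (μ.prod μ))
    (hf : AEStronglyMeasurable f μ) :
    eLpNorm (kernelFun μ K f) 2 μ ≤ eLpNorm K 2 (μ.prod μ) * eLpNorm f 2 μ := by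
  have h2 : AEMeasurable (fun x => eLpNorm (fun y => K (x, y)) 2 μ ^ 2) μ := by
    simp_rw [eLpNorm_two_sq]
    exact (hK.enorm.pow_const 2).lintegral_prod_right'
  rw [← ENNReal.pow_le_pow_left_iff two_ne_zero, mul_pow, eLpNorm_two_sq,
    ← lintegral_eLpNorm_slice_sq hK, ← lintegral_mul_const'' _ h2]
  refine lintegral_mono_ae ?_
  filter_upwards [hK.prodMk_left] with x hx
  rw [← mul_pow]
  gcongr
  exact enorm_kernelFun_le hx hf

theorem memLp_kernelFun {K : X × X → ℂ} {f : X → ℂ} (hK : MemLp K 2 (μ.prod μ))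
    (hf : MemLp f 2 μ) : MemLp (kernelFun μ K f) 2 μ :=
  ⟨aestronglyMeasurable_kernelFun hK.1 hf.1,
    (eLpNorm_kernelFun_le hK.1 hf.1).trans_lt (ENNReal.mul_lt_top hK.2 hf.2)⟩

theorem kernelFun_add_left {K K' : X × X → ℂ} {f : X → ℂ} (hK : MemLp K 2 (μ.prod μ))
    (hK' : MemLp K' 2 (μ.prod μ)) (hf : MemLp f 2 μ) :
    kernelFun μ (K + K') f =ᵐ[μ] kernelFun μ K f + kernelFun μ K' f := by
  filter_upwards [ae_memLp_slice hK, ae_memLp_slice hK'] with x h1 h2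
  simp only [kernelFun, Pi.add_apply, add_mul]
  exact integral_add (integrable_slice_mul h1 hf) (integrable_slice_mul h2 hf)

theorem kernelFun_add_right {K : X × X → ℂ} {f f' : X → ℂ} (hK : MemLp K 2 (μ.prod μ))
    (hf : MemLp f 2 μ) (hf' : MemLp f' 2 μ) :
    kernelFun μ K (f + f') =ᵐ[μ] kernelFun μ K f + kernelFun μ K f' := by
  filter_upwards [ae_memLp_slice hK] with x h1
  simp only [kernelFun, Pi.add_apply, mul_add]
  exact integral_add (integrable_slice_mul h1 hf) (integrable_slice_mul h1 hf')

/-- The integral operator, as a function on `L²` classes. -/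
def kernelLp (K : Lp ℂ 2 (μ.prod μ)) (f : Lp ℂ 2 μ) : Lp ℂ 2 μ :=
  (memLp_kernelFun (Lp.memLp K) (Lp.memLp f)).toLp _

theorem kernelLp_coeFn (K : Lp ℂ 2 (μ.prod μ)) (f : Lp ℂ 2 μ) :
    kernelLp K f =ᵐ[μ] kernelFun μ K f := MemLp.coeFn_toLp _

theorem norm_kernelLp_le (K : Lp ℂ 2 (μ.prod μ)) (f : Lp ℂ 2 μ) :
    ‖kernelLp K f‖ ≤ ‖K‖ * ‖f‖ := by
  rw [kernelLp, Lp.norm_toLp, Lp.norm_def, Lp.norm_def, ← ENNReal.toReal_mul]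
  exact ENNReal.toReal_mono (ENNReal.mul_ne_top (Lp.eLpNorm_ne_top K) (Lp.eLpNorm_ne_top f))
    (eLpNorm_kernelFun_le (Lp.memLp K).1 (Lp.memLp f).1)

variable (μ) in
/-- The integral operator with a square integrable kernel, depending linearly on the kernel. -/
def kernelOp : Lp ℂ 2 (μ.prod μ) →L[ℂ] Lp ℂ 2 μ →L[ℂ] Lp ℂ 2 μ :=
  LinearMap.mkContinuous₂
    (LinearMap.mk₂ ℂ kernelLp
      (fun K K' f => by
        apply Lp.ext
        filter_upwards [kernelLp_coeFn (K + K') f, Lp.coeFn_add (kernelLp K f) (kernelLp K' f),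
          kernelLp_coeFn K f, kernelLp_coeFn K' f,
          kernelFun_add_left (Lp.memLp K) (Lp.memLp K') (Lp.memLp f),
          kernelFun_congr (Lp.coeFn_add K K') (Filter.EventuallyEq.refl _ f)] with x h1 h2 h3 h4 h5 h6
        rw [h1, h2, h6, h5, Pi.add_apply, Pi.add_apply, h3, h4])
      (fun c K f => by
        apply Lp.ext
        filter_upwards [kernelLp_coeFn (c • K) f, Lp.coeFn_smul c (kernelLp K f),
          kernelLp_coeFn K f,
          kernelFun_congr (Lp.coeFn_smul c K) (Filter.EventuallyEq.refl _ f)] with x h1 h2 h3 h6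
        rw [h1, h2, h6, kernelFun_smul_left, Pi.smul_apply, Pi.smul_apply, h3])
      (fun K f f' => by
        apply Lp.ext
        filter_upwards [kernelLp_coeFn K (f + f'), Lp.coeFn_add (kernelLp K f) (kernelLp K f'),
          kernelLp_coeFn K f, kernelLp_coeFn K f',
          kernelFun_add_right (Lp.memLp K) (Lp.memLp f) (Lp.memLp f'),
          kernelFun_congr (Filter.EventuallyEq.refl _ K) (Lp.coeFn_add f f')] with x h1 h2 h3 h4 h5 h6
        rw [h1, h2, h6, h5, Pi.add_apply, Pi.add_apply, h3, h4])
      (fun c K f => by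
        apply Lp.ext
        filter_upwards [kernelLp_coeFn K (c • f), Lp.coeFn_smul c (kernelLp K f),
          kernelLp_coeFn K f,
          kernelFun_congr (Filter.EventuallyEq.refl _ K) (Lp.coeFn_smul c f)] with x h1 h2 h3 h6
        rw [h1, h2, h6, kernelFun_smul_right, Pi.smul_apply, Pi.smul_apply, h3]))
    1 fun K f => by simpa using norm_kernelLp_le K f

theorem kernelOp_apply (K : Lp ℂ 2 (μ.prod μ)) (f : Lp ℂ 2 μ) :
    kernelOp μ K f = kernelLp K f := rfl

theorem norm_kernelOp_le (K : Lp ℂ 2 (μ.prod μ)) : ‖kernelOp μ K‖ ≤ ‖K‖ :=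
  ContinuousLinearMap.opNorm_le_bound _ (norm_nonneg _) fun f => norm_kernelLp_le K f

theorem enorm_Lp_two_sq {Y : Type*} [MeasurableSpace Y] {ν : Measure Y} (f : Lp ℂ 2 ν) :
    ‖f‖ₑ ^ 2 = ∫⁻ y, ‖f y‖ₑ ^ 2 ∂ν := by
  rw [Lp.enorm_def, eLpNorm_two_sq]

/-- Integrate the slicewise Bessel inequality over `x`. -/
theorem sum_norm_sq_kernelOp_le {ι : Type*} {b : ι → Lp ℂ 2 μ} (hb : Orthonormal ℂ b)
    (s : Finset ι) (K : Lp ℂ 2 (μ.prod μ)) : ∑ i ∈ s, ‖kernelOp μ K (b i)‖ ^ 2 ≤ ‖K‖ ^ 2 := by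
  have h : ∑ i ∈ s, ‖kernelOp μ K (b i)‖ₑ ^ 2 ≤ ‖K‖ₑ ^ 2 := by
    calc ∑ i ∈ s, ‖kernelOp μ K (b i)‖ₑ ^ 2
        = ∑ i ∈ s, ∫⁻ x, ‖kernelFun μ K (b i) x‖ₑ ^ 2 ∂μ := by
          refine Finset.sum_congr rfl fun i _ => ?_
          rw [enorm_Lp_two_sq, kernelOp_apply]
          refine lintegral_congr_ae ?_
          filter_upwards [kernelLp_coeFn K (b i)] with x hx
          rw [hx]
      _ = ∫⁻ x, ∑ i ∈ s, ‖kernelFun μ K (b i) x‖ₑ ^ 2 ∂μ := by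
          rw [lintegral_finsetSum' _ fun i _ => ?_]
          exact (aestronglyMeasurable_kernelFun (Lp.memLp K).1 (Lp.memLp (b i)).1).enorm.pow_const 2
      _ ≤ ∫⁻ x, eLpNorm (fun y => K (x, y)) 2 μ ^ 2 ∂μ := by
          refine lintegral_mono_ae ?_
          filter_upwards [ae_memLp_slice (Lp.memLp K)] with x hx
          exact sum_enorm_sq_kernelFun_le hb s hx
      _ = ‖K‖ₑ ^ 2 := by rw [lintegral_eLpNorm_slice_sq (Lp.memLp K).1, Lp.enorm_def]
  have h2 := ENNReal.toReal_mono (ENNReal.pow_ne_top enorm_ne_top) h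
  rw [ENNReal.toReal_sum fun _ _ => ENNReal.pow_ne_top enorm_ne_top] at h2
  simpa using h2

theorem isHilbertSchmidt_kernelOp (K : Lp ℂ 2 (μ.prod μ)) : IsHilbertSchmidt (kernelOp μ K) :=
  fun _ b => summable_of_sum_le (fun _ => by positivity)
    fun s => sum_norm_sq_kernelOp_le b.orthonormal s K

end KernelOp

end

end SiegertStates

namespace SiegertStates

noncomputable section

/-! ### The analytic Fredholm theorem -/

section Fredholm

variable {V : Type*} [NormedAddCommGroup V] [NormedSpace ℂ V]

/-- The finite-rank operator `x ↦ ∑ φ_i(x) v_i`. -/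
def finRankOp {ι : Type*} [Fintype ι] (φ : ι → V →L[ℂ] ℂ) (v : ι → V) : V →L[ℂ] V :=
  ∑ i, (φ i).smulRight (v i)

theorem finRankOp_apply {ι : Type*} [Fintype ι] (φ : ι → V →L[ℂ] ℂ) (v : ι → V) (x : V) :
    finRankOp φ v x = ∑ i, φ i x • v i := by
  simp [finRankOp]

/-- Operators at distance less than one from the operators of finite rank. -/
def NearFinRank (T : V →L[ℂ] V) : Prop :=
  ∃ (n : ℕ) (φ : Fin n → V →L[ℂ] ℂ) (v : Fin n → V), ‖T - finRankOp φ v‖ < 1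

/-- The matrix `δ_ij - φ_i (B v_j)` whose determinant decides the invertibility of
`B⁻¹ - ∑ φ_i v_i`. -/
def reducedMatrix {ι : Type*} [DecidableEq ι] (φ : ι → V →L[ℂ] ℂ) (v : ι → V)
    (B : V →L[ℂ] V) : Matrix ι ι ℂ :=
  Matrix.of fun i j => (1 : Matrix ι ι ℂ) i j - φ i (B (v j))

/-- The operator `∑ adj(M)_ij φ_j(·) v_i` built from the adjugate of the reduced matrix. -/
def adjugateOp {ι : Type*} [Fintype ι] [DecidableEq ι] (φ : ι → V →L[ℂ] ℂ) (v : ι → V)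
    (B : V →L[ℂ] V) : V →L[ℂ] V :=
  ∑ i, ∑ j, (reducedMatrix φ v B).adjugate i j • (φ j).smulRight (v i)

theorem apply_eq_sub_reducedMatrix {ι : Type*} [DecidableEq ι] (φ : ι → V →L[ℂ] ℂ) (v : ι → V)
    (B : V →L[ℂ] V) (i j : ι) :
    φ i (B (v j)) = (1 : Matrix ι ι ℂ) i j - reducedMatrix φ v B i j := by
  simp [reducedMatrix]

theorem analyticAt_reducedMatrix_entry {ι : Type*} [DecidableEq ι]
    (φ : ι → V →L[ℂ] ℂ) (v : ι → V) {B : ℂ → V →L[ℂ] V} {E₀ : ℂ} (hB : AnalyticAt ℂ B E₀)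
    (i j : ι) : AnalyticAt ℂ (fun E => reducedMatrix φ v (B E) i j) E₀ := by
  have h := (((φ i).comp (ContinuousLinearMap.apply ℂ V (v j))).analyticAt (B E₀)).comp hB
  exact analyticAt_const.sub h

section algebra

variable {ι : Type*} [Fintype ι] [DecidableEq ι] (φ : ι → V →L[ℂ] ℂ) (v : ι → V)
  (B : V →L[ℂ] V)

theorem adjugateOp_apply (x : V) : adjugateOp φ v B x
    = ∑ i, (∑ j, (reducedMatrix φ v B).adjugate i j * φ j x) • v i := by
  simp [adjugateOp, Finset.sum_smul, mul_smul]

/-- With `F = ∑ φ_i v_i` and `M` the reduced matrix, `F * B` acts on coefficients with respect to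
the `v_i` as `1 - M`, and `M * adj M = det M`. The identity and its mirror image below avoid `M⁻¹`,
so they also hold where the determinant vanishes. -/
theorem finRankOp_mul_adjugateOp :
    finRankOp φ v * B * adjugateOp φ v B
      = adjugateOp φ v B - (reducedMatrix φ v B).det • finRankOp φ v := by
  ext x
  set M := reducedMatrix φ v B with hM
  set c : ι → ℂ := fun i => ∑ j, M.adjugate i j * φ j x with hc
  have hcv : c = M.adjugate.mulVec (fun j => φ j x) := rfl
  have hMc : M.mulVec c = M.det • fun j => φ j x := by
    rw [hcv, Matrix.mulVec_mulVec, Matrix.mul_adjugate, Matrix.smul_mulVec, Matrix.one_mulVec]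
  simp only [mul_apply_eq_comp, sub_apply,
    smul_apply]
  rw [adjugateOp_apply, finRankOp_apply, finRankOp_apply, Finset.smul_sum, ← Finset.sum_sub_distrib]
  refine Finset.sum_congr rfl fun i _ => ?_
  rw [smul_smul, ← sub_smul]
  congr 1
  have h1 : φ i (B (∑ k, c k • v k)) = ∑ k, φ i (B (v k)) * c k := by
    simp [map_sum, mul_comm]
  rw [h1]
  have h2 := congrFun hMc i
  simp only [Matrix.mulVec, dotProduct, Pi.smul_apply, smul_eq_mul] at h2
  rw [← h2]
  simp only [apply_eq_sub_reducedMatrix, sub_mul, Finset.sum_sub_distrib]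
  congr 1
  simp [Matrix.one_apply, hc, ← hM]

theorem adjugateOp_mul_finRankOp :
    adjugateOp φ v B * B * finRankOp φ v
      = adjugateOp φ v B - (reducedMatrix φ v B).det • finRankOp φ v := by
  ext x
  set M := reducedMatrix φ v B with hM
  set a : ι → ℂ := fun j => φ j x with ha
  have hMa : M.adjugate.mulVec (M.mulVec a) = M.det • a := by
    rw [Matrix.mulVec_mulVec, Matrix.adjugate_mul, Matrix.smul_mulVec, Matrix.one_mulVec]
  simp only [mul_apply_eq_comp, sub_apply,
    smul_apply]
  rw [adjugateOp_apply, adjugateOp_apply, finRankOp_apply, Finset.smul_sum,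
    ← Finset.sum_sub_distrib]
  refine Finset.sum_congr rfl fun i _ => ?_
  rw [smul_smul, ← sub_smul]
  congr 1
  have h1 : ∀ j, φ j (B (∑ k, φ k x • v k)) = a j - M.mulVec a j := by
    intro j
    simp only [map_sum, map_smul, smul_eq_mul, apply_eq_sub_reducedMatrix, Matrix.mulVec,
      dotProduct, mul_sub, Finset.sum_sub_distrib]
    congr 1
    · simp [Matrix.one_apply, ha]
    · exact Finset.sum_congr rfl fun k _ => mul_comm _ _
  simp only [h1, mul_sub, Finset.sum_sub_distrib]
  congr 1
  exact congrFun hMa i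

end algebra

variable [CompleteSpace V]

theorem analyticAt_det {ι : Type*} [Fintype ι] [DecidableEq ι] {M : ℂ → Matrix ι ι ℂ} {E₀ : ℂ}
    (hM : ∀ i j, AnalyticAt ℂ (fun E => M E i j) E₀) : AnalyticAt ℂ (fun E => (M E).det) E₀ := by
  simp only [Matrix.det_apply]
  refine Finset.analyticAt_fun_sum _ fun σ _ => ?_
  simp only [Units.smul_def, zsmul_eq_mul]
  exact analyticAt_const.mul (Finset.analyticAt_fun_prod _ fun i _ => hM _ _)

theorem analyticAt_adjugate {ι : Type*} [Fintype ι] [DecidableEq ι] {M : ℂ → Matrix ι ι ℂ} {E₀ : ℂ}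
    (hM : ∀ i j, AnalyticAt ℂ (fun E => M E i j) E₀) (i j : ι) :
    AnalyticAt ℂ (fun E => (M E).adjugate i j) E₀ := by
  simp only [Matrix.adjugate_apply]
  refine analyticAt_det fun k l => ?_
  simp only [Matrix.updateRow_apply]
  split_ifs
  · exact analyticAt_const
  · exact hM k l

/-- Near each point the resolvent is the quotient of an analytic operator function by an analytic
scalar function, whose zeros are the points where it does not exist. -/
theorem exists_local_resolvent {T : ℂ → V →L[ℂ] V} {E₀ : ℂ} (hT : AnalyticAt ℂ T E₀)
    (hfin : NearFinRank (T E₀)) :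
    ∃ (d : ℂ → ℂ) (N : ℂ → V →L[ℂ] V), AnalyticAt ℂ d E₀ ∧ AnalyticAt ℂ N E₀ ∧
      ∀ᶠ E in 𝓝 E₀, (d E ≠ 0 → IsUnit (1 - T E) ∧ genResolvent T E = (d E)⁻¹ • N E) ∧
        (d E = 0 → ¬ IsUnit (1 - T E)) := by
  obtain ⟨n, φ, v, hF⟩ := hfin
  set F := finRankOp φ v with hFdef
  -- Split `1 - T = A - F` with `F` fixed and `A = 1 - (T - F)`. At `E₀`, hence nearby, `A` is
  -- invertible by a Neumann series.
  have hA : AnalyticAt ℂ (fun E => 1 - (T E - F)) E₀ :=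
    analyticAt_const.sub (hT.sub analyticAt_const)
  have hunit : IsUnit (1 - (T E₀ - F)) := isUnit_one_sub_of_norm_lt_one hF
  set B : ℂ → V →L[ℂ] V := fun E => Ring.inverse (1 - (T E - F)) with hB
  have hBan : AnalyticAt ℂ B E₀ := by
    obtain ⟨u, hu⟩ := hunit
    have h := analyticAt_inverse (𝕜 := ℂ) u
    rw [hu] at h
    exact h.comp (f := fun E => 1 - (T E - F)) hA
  have hev : ∀ᶠ E in 𝓝 E₀, IsUnit (1 - (T E - F)) :=
    hA.continuousAt.eventually (Units.isOpen.mem_nhds hunit)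
  set M : ℂ → Matrix (Fin n) (Fin n) ℂ := fun E => reducedMatrix φ v (B E) with hM
  have hMan : ∀ i j, AnalyticAt ℂ (fun E => M E i j) E₀ :=
    analyticAt_reducedMatrix_entry φ v hBan
  have hKan : AnalyticAt ℂ (fun E => adjugateOp φ v (B E)) E₀ := by
    unfold adjugateOp
    refine Finset.analyticAt_fun_sum _ fun i _ => Finset.analyticAt_fun_sum _ fun j _ => ?_
    exact (analyticAt_adjugate hMan i j).smul analyticAt_const
  have hdan : AnalyticAt ℂ (fun E => (M E).det) E₀ := analyticAt_det hMan
  -- The inverse of `A - F` is `B + B (∑ (M⁻¹)_ij φ_j v_i) B` with `B = A⁻¹`. Multiplying by `det M`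
  -- replaces `M⁻¹` by the adjugate and keeps the numerator analytic at the zeros of the
  -- determinant.
  refine ⟨fun E => (M E).det, fun E => (M E).det • B E + B E * adjugateOp φ v (B E) * B E,
    hdan, (hdan.smul hBan).add ((hBan.mul hKan).mul hBan), ?_⟩
  filter_upwards [hev] with E hE
  set K := adjugateOp φ v (B E) with hK
  set d := (M E).det with hd
  set A := 1 - (T E - F) with hAdef
  have hTA : 1 - T E = A - F := by rw [hAdef]; abel
  have hAB : A * B E = 1 := Ring.mul_inverse_cancel _ hE
  have hBA : B E * A = 1 := Ring.inverse_mul_cancel _ hE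
  have h1 : F * B E * K = K - d • F := finRankOp_mul_adjugateOp φ v (B E)
  have h2 : K * B E * F = K - d • F := adjugateOp_mul_finRankOp φ v (B E)
  refine ⟨fun hd0 => ?_, fun hd0 hu => ?_⟩
  · set N := d • B E + B E * K * B E with hN
    have hr : (1 - T E) * N = d • 1 := by
      rw [hTA, hN, sub_mul, mul_add, mul_add, mul_smul_comm, mul_smul_comm, hAB,
        ← mul_assoc, ← mul_assoc, ← mul_assoc, ← mul_assoc, hAB, one_mul, h1, sub_mul, smul_mul_assoc]
      abel
    have hl : N * (1 - T E) = d • 1 := by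
      rw [hTA, hN, mul_sub, add_mul, add_mul, smul_mul_assoc, smul_mul_assoc, hBA,
        mul_assoc, hBA, mul_one, mul_assoc (B E), mul_assoc (B E), h2, mul_sub, mul_smul_comm]
      abel
    have hr' : (1 - T E) * (d⁻¹ • N) = 1 := by
      rw [mul_smul_comm, hr, smul_smul, inv_mul_cancel₀ hd0, one_smul]
    have hl' : (d⁻¹ • N) * (1 - T E) = 1 := by
      rw [smul_mul_assoc, hl, smul_smul, inv_mul_cancel₀ hd0, one_smul]
    set U : (V →L[ℂ] V)ˣ := ⟨1 - T E, d⁻¹ • N, hr', hl'⟩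
    exact ⟨U.isUnit, Ring.inverse_unit U⟩
  -- A null vector `c` of `M` gives `y = ∑ c_j v_j` with `A (B y) = y = F (B y)`, so `B y` is killed
  -- by `1 - T`. Were `1 - T` invertible, `B y` and with it every `c_i = φ_i (B y)` would vanish.
  · obtain ⟨c, hc0, hc⟩ := Matrix.exists_mulVec_eq_zero_iff.2 hd0
    set y := ∑ j, c j • v j with hy
    have hφ : ∀ i, φ i (B E y) = c i := by
      intro i
      have h := congrFun hc i
      simp only [Matrix.mulVec, dotProduct, Pi.zero_apply] at h
      have h3 : φ i (B E y) = ∑ k, φ i (B E (v k)) * c k := by simp [hy, map_sum, mul_comm]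
      rw [h3]
      simp only [apply_eq_sub_reducedMatrix, sub_mul, Finset.sum_sub_distrib]
      rw [show ∑ k, reducedMatrix φ v (B E) i k * c k = 0 from h]
      simp [Matrix.one_apply]
    have hker : (1 - T E) (B E y) = 0 := by
      rw [hTA, sub_apply, finRankOp_apply]
      have h4 : A (B E y) = y := by
        rw [← mul_apply_eq_comp, hAB, one_apply_eq_self]
      simp only [h4, hφ, ← hy, sub_self]
    have hBy : B E y = 0 := by
      have h5 : (Ring.inverse (1 - T E) * (1 - T E)) (B E y) = 0 := by
        rw [mul_apply_eq_comp, hker, map_zero]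
      rwa [Ring.inverse_mul_cancel _ hu, one_apply_eq_self] at h5
    refine hc0 (funext fun i => ?_)
    rw [← hφ i, hBy, map_zero, Pi.zero_apply]

theorem eventually_eventually_nhdsNE {p : ℂ → Prop} {E₀ : ℂ} (h : ∀ᶠ E in 𝓝[≠] E₀, p E) :
    ∀ᶠ E in 𝓝 E₀, ∀ᶠ E' in 𝓝[≠] E, p E' := by
  rw [eventually_nhdsWithin_iff] at h
  filter_upwards [h.eventually_nhds] with E hE
  rcases eq_or_ne E E₀ with rfl | hne
  · exact eventually_nhdsWithin_iff.2 hE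
  · refine eventually_nhdsWithin_iff.2 ?_
    filter_upwards [hE, isOpen_ne.mem_nhds hne] with y hy hy' _
    exact hy hy'

/-- The analytic Fredholm theorem: off a discrete set of points `1 - T` is invertible. -/
theorem eventually_isUnit_one_sub {T : ℂ → V →L[ℂ] V} {Ω : Set ℂ} (hΩ : IsPreconnected Ω)
    (hT : AnalyticOnNhd ℂ T Ω) (hfin : ∀ E ∈ Ω, NearFinRank (T E))
    (hex : ∃ E ∈ Ω, IsUnit (1 - T E)) {E₀ : ℂ} (hE₀ : E₀ ∈ Ω) :
    ∀ᶠ E in 𝓝[≠] E₀, IsUnit (1 - T E) := by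
  -- By the dichotomy for zeros of the local determinant, `1 - T` is near each point either
  -- invertible off that point or nowhere invertible. Both alternatives are open and they exclude
  -- each other, so connectedness and one invertible point leave only the first.
  set u : Set ℂ := {E | ∀ᶠ E' in 𝓝[≠] E, IsUnit (1 - T E')} with hu
  set v : Set ℂ := {E | ∀ᶠ E' in 𝓝 E, ¬ IsUnit (1 - T E')} with hv
  have huo : IsOpen u := isOpen_iff_eventually.2 fun E hE => eventually_eventually_nhdsNE hE
  have hvo : IsOpen v := isOpen_iff_eventually.2 fun E hE => hE.eventually_nhds
  have hdisj : ∀ E, E ∈ u → E ∉ v := fun E h1 h2 => by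
    have h3 : ∀ᶠ E' in 𝓝[≠] E, False := by
      filter_upwards [h1, h2.filter_mono nhdsWithin_le_nhds] with y ha hb using hb ha
    exact h3.exists.choose_spec
  have hcov : Ω ⊆ u ∪ v := fun E hE => by
    obtain ⟨d, N, hd, -, h⟩ := exists_local_resolvent (hT E hE) (hfin E hE)
    rcases hd.eventually_eq_zero_or_eventually_ne_zero with h0 | h0
    · right
      filter_upwards [h, h0] with y h1 h2 using h1.2 h2
    · left
      filter_upwards [h.filter_mono nhdsWithin_le_nhds, h0] with y h1 h2 using (h1.1 h2).1
  obtain ⟨E₁, hE₁, hunit⟩ := hex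
  have hE₁u : E₁ ∈ u := by
    have hc : ContinuousAt (fun E => 1 - T E) E₁ := continuousAt_const.sub (hT E₁ hE₁).continuousAt
    exact (hc.eventually (Units.isOpen.mem_nhds hunit)).filter_mono nhdsWithin_le_nhds
  by_contra hcon
  have hE₀v : E₀ ∈ v := (hcov hE₀).resolve_left hcon
  obtain ⟨E, -, h1, h2⟩ := hΩ u v huo hvo hcov ⟨E₁, hE₁, hE₁u⟩ ⟨E₀, hE₀, hE₀v⟩
  exact hdisj E h1 h2

/-- Only a punctured neighbourhood matters, so the default value of `Ring.inverse` at a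
noninvertible point does no harm. -/
theorem meromorphicAt_genResolvent {T : ℂ → V →L[ℂ] V} {E₀ : ℂ} (hT : AnalyticAt ℂ T E₀)
    (hfin : NearFinRank (T E₀)) (hev : ∀ᶠ E in 𝓝[≠] E₀, IsUnit (1 - T E)) :
    MeromorphicAt (genResolvent T) E₀ := by
  obtain ⟨d, N, hd, hN, h⟩ := exists_local_resolvent hT hfin
  have hm : MeromorphicAt (fun E => (d E)⁻¹ • N E) E₀ := hd.meromorphicAt.inv.smul hN.meromorphicAt
  refine hm.congr ?_
  filter_upwards [h.filter_mono nhdsWithin_le_nhds, hev] with E h1 h2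
  exact (h1.1 fun h0 => h1.2 h0 h2).2.symm

theorem isPole_genResolvent_iff {T : ℂ → V →L[ℂ] V} {E₀ : ℂ} (hT : AnalyticAt ℂ T E₀)
    (hfin : NearFinRank (T E₀)) (hev : ∀ᶠ E in 𝓝[≠] E₀, IsUnit (1 - T E)) :
    IsPole (genResolvent T) E₀ ↔ ¬ IsUnit (1 - T E₀) := by
  have hmer := meromorphicAt_genResolvent hT hfin hev
  have hA : AnalyticAt ℂ (fun E => 1 - T E) E₀ := analyticAt_const.sub hT
  constructor
  · rintro ⟨-, hneg⟩ hunit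
    have han : AnalyticAt ℂ (genResolvent T) E₀ := by
      obtain ⟨u, hu⟩ := hunit
      have h := analyticAt_inverse (𝕜 := ℂ) u
      rw [hu] at h
      exact h.comp (f := fun E => 1 - T E) hA
    exact hneg.not_ge han.meromorphicOrderAt_nonneg
  · intro hnot
    refine ⟨hmer, ?_⟩
    by_contra! hge
    -- Without a pole the inverses converge as `E → E₀`. Passing to the limit in both products shows
    -- that their limit inverts `1 - T E₀`.
    obtain ⟨S, hS⟩ := tendsto_nhds_of_meromorphicOrderAt_nonneg hmer hge
    have hA' : Tendsto (fun E => 1 - T E) (𝓝[≠] E₀) (𝓝 (1 - T E₀)) :=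
      hA.continuousAt.tendsto.mono_left nhdsWithin_le_nhds
    have h1 : (1 - T E₀) * S = 1 := by
      refine tendsto_nhds_unique (hA'.mul hS) (tendsto_const_nhds.congr' ?_)
      filter_upwards [hev] with E hE using (Ring.mul_inverse_cancel _ hE).symm
    have h2 : S * (1 - T E₀) = 1 := by
      refine tendsto_nhds_unique (hS.mul hA') (tendsto_const_nhds.congr' ?_)
      filter_upwards [hev] with E hE using (Ring.inverse_mul_cancel _ hE).symm
    exact hnot (⟨⟨_, S, h1, h2⟩, rfl⟩ : IsUnit (1 - T E₀))

end Fredholm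

/-! ### Hilbert–Schmidt operators are limits of operators of finite rank -/

section HilbertSchmidt

variable {V : Type*} [NormedAddCommGroup V] [InnerProductSpace ℂ V]

/-- Truncate the expansion of `x` in the basis. Cauchy–Schwarz bounds the remainder by the tail of
`∑ ‖A b_i‖²` and, through Bessel, by `‖x‖`. -/
theorem norm_sub_sum_le_of_hilbertBasis {w : Set V} (b : HilbertBasis w ℂ V) (A : V →L[ℂ] V)
    {η : ℝ} (hη : 0 ≤ η) {s : Finset w}
    (hs : ∀ t : Finset w, Disjoint t s → ∑ i ∈ t, ‖A (b i)‖ ^ 2 ≤ η ^ 2) :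
    ‖A - ∑ i ∈ s, (innerSL ℂ (b i)).smulRight (A (b i))‖ ≤ η := by
  classical
  refine ContinuousLinearMap.opNorm_le_bound _ hη fun x => ?_
  have hsum : HasSum (fun i => inner ℂ (b i) x • A (b i)) (A x) := by
    have h := (b.hasSum_repr x).mapL A
    simpa [HilbertBasis.repr_apply_apply] using h
  have hval : (A - ∑ i ∈ s, (innerSL ℂ (b i)).smulRight (A (b i))) x
      = A x - ∑ i ∈ s, inner ℂ (b i) x • A (b i) := by
    simp
  rw [hval]
  have hlim : Tendsto (fun t : Finset w => ‖∑ i ∈ t, inner ℂ (b i) x • A (b i)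
      - ∑ i ∈ s, inner ℂ (b i) x • A (b i)‖) atTop
      (𝓝 ‖A x - ∑ i ∈ s, inner ℂ (b i) x • A (b i)‖) :=
    (Tendsto.sub_const hsum _).norm
  refine le_of_tendsto hlim ?_
  filter_upwards [eventually_ge_atTop s] with t ht
  rw [← Finset.sum_sdiff ht, add_sub_cancel_right]
  have hbes : ∑ i ∈ t \ s, ‖inner ℂ (b i) x‖ ^ 2 ≤ ‖x‖ ^ 2 :=
    b.orthonormal.sum_inner_products_le x
  calc ‖∑ i ∈ t \ s, inner ℂ (b i) x • A (b i)‖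
      ≤ ∑ i ∈ t \ s, ‖inner ℂ (b i) x‖ * ‖A (b i)‖ := by
        refine (norm_sum_le _ _).trans (le_of_eq ?_)
        exact Finset.sum_congr rfl fun i _ => norm_smul _ _
    _ ≤ Real.sqrt (∑ i ∈ t \ s, ‖inner ℂ (b i) x‖ ^ 2) * Real.sqrt (∑ i ∈ t \ s, ‖A (b i)‖ ^ 2) :=
        Real.sum_mul_le_sqrt_mul_sqrt _ _ _
    _ ≤ ‖x‖ * η := by
        refine mul_le_mul (Real.sqrt_le_iff.2 ⟨norm_nonneg _, hbes⟩)
          (Real.sqrt_le_iff.2 ⟨hη, hs _ Finset.sdiff_disjoint⟩) (Real.sqrt_nonneg _) (norm_nonneg _)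
    _ = η * ‖x‖ := mul_comm _ _

theorem isCompactOperator_finRankOp {n : ℕ} (φ : Fin n → V →L[ℂ] ℂ) (v : Fin n → V) :
    IsCompactOperator (finRankOp φ v) := by
  have h : ∀ i, IsCompactOperator ((φ i).smulRight (v i)) := fun i => by
    have h1 : IsCompactOperator (ContinuousLinearMap.toSpanSingleton ℂ (v i)) :=
      isCompactOperator_of_locallyCompactSpace_rng _
    exact h1.comp_clm (φ i)
  exact Submodule.sum_mem (compactOperator (RingHom.id ℂ) V V) (t := Finset.univ)
    (f := fun i => ((φ i).smulRight (v i) : V →L[ℂ] V)) fun i _ => h i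

variable [CompleteSpace V]

theorem IsHilbertSchmidt.exists_norm_sub_le {A : V →L[ℂ] V} (hA : IsHilbertSchmidt A) {η : ℝ}
    (hη : 0 < η) :
    ∃ (n : ℕ) (φ : Fin n → V →L[ℂ] ℂ) (v : Fin n → V), ‖A - finRankOp φ v‖ ≤ η := by
  obtain ⟨w, b, -⟩ := exists_hilbertBasis ℂ V
  obtain ⟨s, hs⟩ := summable_iff_vanishing_norm.1 (hA w b) (η ^ 2) (by positivity)
  refine ⟨s.card, fun j => innerSL ℂ (b (s.equivFin.symm j)), fun j => A (b (s.equivFin.symm j)), ?_⟩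
  have h := norm_sub_sum_le_of_hilbertBasis b A hη.le fun t ht => (le_abs_self _).trans (hs t ht).le
  rwa [← Finset.sum_coe_sort, ← Equiv.sum_comp s.equivFin.symm] at h

theorem IsHilbertSchmidt.isCompactOperator {A : V →L[ℂ] V} (hA : IsHilbertSchmidt A) :
    IsCompactOperator A := by
  choose n φ v h using fun k : ℕ => hA.exists_norm_sub_le (η := 1 / ((k : ℝ) + 1)) (by positivity)
  refine isCompactOperator_of_tendsto (l := atTop) (F := fun k => finRankOp (φ k) (v k)) ?_
    (Eventually.of_forall fun k => isCompactOperator_finRankOp _ _)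
  rw [tendsto_iff_norm_sub_tendsto_zero]
  refine squeeze_zero (fun _ => norm_nonneg _) (fun k => ?_) tendsto_one_div_add_atTop_nhds_zero_nat
  rw [norm_sub_rev]
  exact h k

theorem IsHilbertSchmidt.nearFinRank {A : V →L[ℂ] V} (hA : IsHilbertSchmidt A) :
    NearFinRank A := by
  obtain ⟨n, φ, v, h⟩ := hA.exists_norm_sub_le (η := 1 / 2) (by norm_num)
  exact ⟨n, φ, v, h.trans_lt (by norm_num)⟩

end HilbertSchmidt

/-- The Fredholm alternative: a nonzero spectral value of a compact operator is an eigenvalue. -/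
theorem exists_fixed_of_not_isUnit {V : Type*} [NormedAddCommGroup V] [NormedSpace ℂ V]
    [CompleteSpace V] {A : V →L[ℂ] V} (hA : IsCompactOperator A) (h : ¬ IsUnit (1 - A)) :
    ∃ f : V, f ≠ 0 ∧ A f = f := by
  have hs : (1 : ℂ) ∈ spectrum ℂ A := by
    rw [spectrum.mem_iff]
    simpa using h
  have h2 := (hA.hasEigenvalue_iff_mem_spectrum one_ne_zero).2 hs
  obtain ⟨f, hf⟩ := h2.exists_hasEigenvector
  refine ⟨f, hf.2, ?_⟩
  simpa using hf.apply_eq_smul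

end

end SiegertStates

namespace SiegertStates

noncomputable section

open scoped ENNReal

/-! ### Analytic families in `L²` -/

/-- Cauchy estimates on nested balls bound `h'` by `C/r` and `h''` by `C/r²`; two uses of the mean
value inequality then control the Taylor remainder. The function enters only through `C`, so the
estimate can be applied pointwise with `C = g y` and taken in `L²`. -/
theorem norm_sub_sub_deriv_le {h : ℂ → ℂ} {E₀ : ℂ} {r C : ℝ} (hr : 0 < r)
    (hd : DifferentiableOn ℂ h (Metric.ball E₀ (4 * r)))
    (hC : ∀ E ∈ Metric.ball E₀ (4 * r), ‖h E‖ ≤ C) :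
    ‖deriv h E₀‖ ≤ C / r ∧ ∀ E ∈ Metric.ball E₀ r,
      ‖h E - h E₀ - (E - E₀) * deriv h E₀‖ ≤ C / r ^ 2 * ‖E - E₀‖ ^ 2 := by
  have hsub' : ∀ {a a' : ℝ}, a ≤ a' → Metric.ball E₀ (a * r) ⊆ Metric.ball E₀ (a' * r) :=
    fun h => Metric.ball_subset_ball (mul_le_mul_of_nonneg_right h hr.le)
  have hcb : ∀ {E : ℂ} {a : ℝ}, E ∈ Metric.ball E₀ (a * r) →
      Metric.closedBall E r ⊆ Metric.ball E₀ ((a + 1) * r) := by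
    intro E a hE x hx
    rw [Metric.mem_ball] at hE ⊢
    rw [Metric.mem_closedBall] at hx
    linarith [dist_triangle x E E₀]
  have hd1 : DifferentiableOn ℂ (deriv h) (Metric.ball E₀ (4 * r)) := hd.deriv Metric.isOpen_ball
  have h1 : ∀ E ∈ Metric.ball E₀ (3 * r), ‖deriv h E‖ ≤ C / r := by
    intro E hE
    have hs := (hcb hE).trans (hsub' (by norm_num : (3 : ℝ) + 1 ≤ 4))
    exact Complex.norm_deriv_le_of_forall_mem_sphere_norm_le hr
      (hd.diffContOnCl_ball hs) fun z hz => hC z (hs (Metric.sphere_subset_closedBall hz))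
  have h2 : ∀ E ∈ Metric.ball E₀ (2 * r), ‖deriv (deriv h) E‖ ≤ C / r / r := by
    intro E hE
    have hs := (hcb hE).trans (hsub' (by norm_num : (2 : ℝ) + 1 ≤ 3))
    exact Complex.norm_deriv_le_of_forall_mem_sphere_norm_le hr
      (hd1.diffContOnCl_ball (hs.trans (hsub' (by norm_num))))
      fun z hz => h1 z (hs (Metric.sphere_subset_closedBall hz))
  have hat : ∀ {f : ℂ → ℂ}, DifferentiableOn ℂ f (Metric.ball E₀ (4 * r)) →
      ∀ E ∈ Metric.ball E₀ r, DifferentiableAt ℂ f E := fun hf E hE =>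
    hf.differentiableAt (Metric.isOpen_ball.mem_nhds (Metric.ball_subset_ball (by linarith) hE))
  have hmem0 : E₀ ∈ Metric.ball E₀ r := Metric.mem_ball_self hr
  refine ⟨h1 E₀ (Metric.mem_ball_self (by positivity)), fun E hE => ?_⟩
  have hball : ∀ x ∈ Metric.closedBall E₀ ‖E - E₀‖, x ∈ Metric.ball E₀ r := fun x hx => by
    rw [Metric.mem_ball, dist_eq_norm] at hE
    rw [Metric.mem_closedBall] at hx
    exact hx.trans_lt hE
  have h3 : ∀ x ∈ Metric.closedBall E₀ ‖E - E₀‖, ‖deriv h x - deriv h E₀‖ ≤ C / r ^ 2 * ‖E - E₀‖ := by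
    intro x hx
    have h4 := Convex.norm_image_sub_le_of_norm_deriv_le (C := C / r / r) (hat hd1)
      (fun y hy => h2 y (Metric.ball_subset_ball (by linarith) hy)) (convex_ball E₀ r) hmem0
      (hball x hx)
    have hC0 : 0 ≤ C := (norm_nonneg _).trans (hC E₀ (Metric.mem_ball_self (by positivity)))
    rw [Metric.mem_closedBall, dist_eq_norm] at hx
    refine h4.trans ?_
    rw [div_div, ← pow_two]
    gcongr
  have h5 := Convex.norm_image_sub_le_of_norm_hasDerivWithin_le
    (f := fun x => h x - x * deriv h E₀) (f' := fun x => deriv h x - deriv h E₀)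
    (C := C / r ^ 2 * ‖E - E₀‖) (x := E₀) (y := E)
    (fun x hx => (((hat hd x (hball x hx)).hasDerivAt.sub
      (hasDerivAt_mul_const (deriv h E₀))).hasDerivWithinAt))
    h3 (convex_closedBall _ _) (Metric.mem_closedBall_self (norm_nonneg _))
    (by rw [Metric.mem_closedBall, dist_eq_norm])
  calc _ = ‖h E - E * deriv h E₀ - (h E₀ - E₀ * deriv h E₀)‖ := by congr 1; ring
    _ ≤ _ := h5
    _ = _ := by ring

/-- A family of functions that is pointwise analytic and dominated by an `L²` function is analytic
as a family in `L²`. -/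
theorem differentiableAt_Lp_of_dominated {Y : Type*} [MeasurableSpace Y] {ν : Measure Y}
    {F : ℂ → Y → ℂ} {Φ : ℂ → Lp ℂ 2 ν} {E₀ : ℂ} {g : Y → ℝ} (hg : MemLp g 2 ν)
    (hΦ : ∀ᶠ E in 𝓝 E₀, Φ E =ᵐ[ν] F E)
    (hF : ∃ U ∈ 𝓝 E₀, ∀ᵐ y ∂ν, ∀ E ∈ U, DifferentiableAt ℂ (fun E => F E y) E ∧ ‖F E y‖ ≤ g y) :
    DifferentiableAt ℂ Φ E₀ := by
  obtain ⟨U, hU, hF'⟩ := hF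
  obtain ⟨R, hR, hRU⟩ := Metric.mem_nhds_iff.1 (inter_mem hU hΦ)
  set r := R / 4 with hr
  have hr0 : 0 < r := by positivity
  have hR4 : 4 * r = R := by rw [hr]; ring
  have hmain : ∀ᵐ y ∂ν, ‖deriv (fun E => F E y) E₀‖ ≤ g y / r ∧ ∀ E ∈ Metric.ball E₀ r,
      ‖F E y - F E₀ y - (E - E₀) * deriv (fun E => F E y) E₀‖ ≤ g y / r ^ 2 * ‖E - E₀‖ ^ 2 := by
    filter_upwards [hF'] with y hy
    refine norm_sub_sub_deriv_le hr0 (fun E hE => ?_) fun E hE => ?_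
    · exact (hy E (hRU (hR4 ▸ hE)).1).1.differentiableWithinAt
    · exact (hy E (hRU (hR4 ▸ hE)).1).2
  have hΦ' : ∀ E ∈ Metric.ball E₀ r, Φ E =ᵐ[ν] F E := fun E hE =>
    (hRU (Metric.ball_subset_ball (by linarith) hE)).2
  have hmem0 : E₀ ∈ Metric.ball E₀ r := Metric.mem_ball_self hr0
  have hmeasF : ∀ E ∈ Metric.ball E₀ r, AEStronglyMeasurable (F E) ν := fun E hE =>
    (Lp.memLp (Φ E)).1.congr (hΦ' E hE)
  set D : Y → ℂ := fun y => deriv (fun E => F E y) E₀ with hD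
  -- The pointwise derivative is measurable as an almost everywhere limit of difference quotients
  -- along the null sequence `e n`.
  have hDmeas : AEStronglyMeasurable D ν := by
    set e : ℕ → ℂ := fun n => ((r / 2 / (n + 1) : ℝ) : ℂ) with he
    have he0 : ∀ n, e n ≠ 0 := fun n => by
      rw [he]; exact Complex.ofReal_ne_zero.2 (by positivity)
    have hen : ∀ n, ‖e n‖ < r := fun n => by
      rw [he, Complex.norm_real, Real.norm_of_nonneg (by positivity)]
      calc r / 2 / (n + 1) ≤ r / 2 := div_le_self (by positivity) (by linarith [n.cast_nonneg (α := ℝ)])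
        _ < r := by linarith
    have helim : Tendsto (fun n => ‖e n‖) atTop (𝓝 0) := by
      have h := (tendsto_one_div_add_atTop_nhds_zero_nat (𝕜 := ℝ)).const_mul (r / 2)
      rw [mul_zero] at h
      refine h.congr fun n => ?_
      rw [he, Complex.norm_real, Real.norm_of_nonneg (by positivity)]
      ring
    refine aestronglyMeasurable_of_tendsto_ae atTop
      (f := fun n y => (e n)⁻¹ * (F (E₀ + e n) y - F E₀ y)) (fun n => ?_) ?_
    · refine ((hmeasF _ ?_).sub (hmeasF _ hmem0)).const_mul _
      rw [Metric.mem_ball, dist_eq_norm, add_sub_cancel_left]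
      exact hen n
    · filter_upwards [hmain] with y hy
      rw [tendsto_iff_norm_sub_tendsto_zero]
      have hb : Tendsto (fun n => g y / r ^ 2 * ‖e n‖) atTop (𝓝 0) := by
        simpa using helim.const_mul (g y / r ^ 2)
      refine squeeze_zero (fun _ => norm_nonneg _) (fun n => ?_) hb
      have h1 := hy.2 (E₀ + e n) (by
        rw [Metric.mem_ball, dist_eq_norm, add_sub_cancel_left]; exact hen n)
      rw [add_sub_cancel_left] at h1
      have h2 : (e n)⁻¹ * (F (E₀ + e n) y - F E₀ y) - D y
          = (e n)⁻¹ * (F (E₀ + e n) y - F E₀ y - e n * D y) := by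
        rw [mul_sub (e n)⁻¹ _ (e n * D y), inv_mul_cancel_left₀ (he0 n)]
      rw [h2, norm_mul, norm_inv]
      have hpos : 0 < ‖e n‖ := norm_pos_iff.2 (he0 n)
      calc _ ≤ ‖e n‖⁻¹ * (g y / r ^ 2 * ‖e n‖ ^ 2) := by gcongr
        _ = _ := by field_simp
  have hDL : MemLp D 2 ν := by
    refine (hg.const_mul (1 / r)).mono' hDmeas ?_
    filter_upwards [hmain] with y hy
    exact hy.1.trans (le_of_eq (by ring))
  refine HasDerivAt.differentiableAt (f' := hDL.toLp D) ?_
  rw [hasDerivAt_iff_isLittleO]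
  refine Asymptotics.IsBigO.trans_isLittleO ?_
    (Asymptotics.isLittleO_pow_sub_sub E₀ (m := 2) one_lt_two)
  refine Asymptotics.IsBigO.of_bound (1 / r ^ 2 * ‖hg.toLp g‖) ?_
  filter_upwards [Metric.ball_mem_nhds E₀ hr0] with E hE
  rw [Real.norm_of_nonneg (by positivity)]
  have hle := Lp.norm_le_mul_norm_of_ae_le_mul (c := 1 / r ^ 2 * ‖E - E₀‖ ^ 2)
    (f := Φ E - Φ E₀ - (E - E₀) • hDL.toLp D) (g := hg.toLp g) ?_
  · refine hle.trans (le_of_eq (by ring))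
  · filter_upwards [Lp.coeFn_sub (Φ E - Φ E₀) ((E - E₀) • hDL.toLp D), Lp.coeFn_sub (Φ E) (Φ E₀),
      Lp.coeFn_smul (E - E₀) (hDL.toLp D), hDL.coeFn_toLp, hg.coeFn_toLp, hΦ' E hE, hΦ' E₀ hmem0,
      hmain] with y h1 h2 h3 h4 h5 h6 h7 h8
    rw [h1, Pi.sub_apply, h2, Pi.sub_apply, h3, Pi.smul_apply, h4, h5, h6, h7, smul_eq_mul]
    have hgy : 0 ≤ g y := by
      have := (norm_nonneg _).trans h8.1
      rw [le_div_iff₀ hr0, zero_mul] at this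
      exact this
    rw [Real.norm_of_nonneg hgy]
    exact (h8.2 E hE).trans (le_of_eq (by ring))

/-! ### Integrability of the singular weights -/

theorem lintegral_abs_rpow_lt_top (A : ℝ) :
    ∫⁻ t in Icc (-A) A, ENNReal.ofReal (|t| ^ (-(1 / 2) : ℝ)) < ∞ := by
  have hpos : ∀ A : ℝ, 0 ≤ A → IntervalIntegrable (fun t : ℝ => |t| ^ (-(1 / 2) : ℝ)) volume 0 A := by
    intro A hA
    refine (intervalIntegral.intervalIntegrable_rpow' (a := 0) (b := A) (r := -(1 / 2))
      (by norm_num)).congr ?_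
    intro t ht
    rw [uIoc_of_le hA] at ht
    simp only [abs_of_pos ht.1]
  rcases lt_or_ge A 0 with hA | hA
  · rw [Icc_eq_empty (by linarith)]; simp
  have h1 := hpos A hA
  have h2 : IntervalIntegrable (fun t : ℝ => |t| ^ (-(1 / 2) : ℝ)) volume (-A) 0 := by
    have := (IntervalIntegrable.iff_comp_neg (by simp)).1 h1
    simp only [abs_neg, neg_zero] at this
    exact this.symm
  have h3 := h2.trans h1
  rw [intervalIntegrable_iff_integrableOn_Icc_of_le (by linarith)] at h3
  exact (hasFiniteIntegral_iff_ofReal (Eventually.of_forall fun _ => by positivity)).1 h3.2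

theorem lintegral_sub_le_of_mem (h : ℝ → ℝ≥0∞) {a b c A : ℝ}
    (hA : ∀ z ∈ Icc b c, a - z ∈ Icc (-A) A) :
    ∫⁻ z in Icc b c, h (a - z) ≤ ∫⁻ t in Icc (-A) A, h t := by
  rw [← lintegral_indicator measurableSet_Icc, ← lintegral_indicator measurableSet_Icc,
    ← lintegral_sub_left_eq_self (fun t => (Icc (-A) A).indicator h t) a]
  refine lintegral_mono fun z => ?_
  by_cases hz : z ∈ Icc b c
  · rw [indicator_of_mem hz, indicator_of_mem (hA z hz)]
  · rw [indicator_of_notMem hz]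
    exact zero_le

theorem volume_restrict_rect (zm zp : ℝ) : (volume : Measure (ℝ × ℝ)).restrict (rect zm zp)
    = (volume.restrict (Icc (0 : ℝ) 1)).prod (volume.restrict (Icc zm zp)) := by
  rw [Measure.prod_restrict, rect, Measure.volume_eq_prod]

theorem measurableSet_rect (zm zp : ℝ) : MeasurableSet (rect zm zp) :=
  measurableSet_Icc.prod measurableSet_Icc

instance isFiniteMeasure_rect (zm zp : ℝ) :
    IsFiniteMeasure ((volume : Measure (ℝ × ℝ)).restrict (rect zm zp)) := by
  rw [volume_restrict_rect]
  infer_instance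

theorem ofReal_rpow_quarter_sq (t : ℝ) :
    ‖|t| ^ (-(1 / 4) : ℝ)‖ₑ ^ 2 = ENNReal.ofReal (|t| ^ (-(1 / 2) : ℝ)) := by
  rw [Real.enorm_eq_ofReal (by positivity), ← ENNReal.ofReal_pow (by positivity),
    ← Real.rpow_mul_natCast (abs_nonneg t)]
  norm_num

theorem memLp_of_lintegral_sq_lt_top {Y F : Type*} [MeasurableSpace Y] [NormedAddCommGroup F]
    {ν : Measure Y} {f : Y → F} (hf : AEStronglyMeasurable f ν) (h : ∫⁻ y, ‖f y‖ₑ ^ 2 ∂ν < ∞) :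
    MemLp f 2 ν := by
  refine ⟨hf, ?_⟩
  by_contra! h'
  rw [← eLpNorm_two_sq, top_le_iff.1 h'] at h
  simp at h

/-- The dominating function for a single Hankel term, whose singularity is at a point; squaring and
separating the variables leaves two integrals of `|t|^(-1/2)`. -/
theorem memLp_weight (zm zp a b : ℝ) :
    MemLp (fun r : ℝ × ℝ => |a - r.1| ^ (-(1 / 4) : ℝ) * |b - r.2| ^ (-(1 / 4) : ℝ)) 2
      (volume.restrict (rect zm zp)) := by
  refine memLp_of_lintegral_sq_lt_top (by fun_prop) ?_
  simp only [enorm_mul, mul_pow, ofReal_rpow_quarter_sq]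
  rw [volume_restrict_rect, lintegral_prod_mul (f := fun x => ENNReal.ofReal (|a - x| ^ (-(1 / 2) : ℝ)))
    (g := fun z => ENNReal.ofReal (|b - z| ^ (-(1 / 2) : ℝ))) (by fun_prop) (by fun_prop)]
  refine ENNReal.mul_lt_top ?_ ?_
  · refine (lintegral_sub_le_of_mem (fun t => ENNReal.ofReal (|t| ^ (-(1 / 2) : ℝ)))
      (A := |a| + 1) fun z hz => ?_).trans_lt (lintegral_abs_rpow_lt_top _)
    constructor <;> linarith [hz.1, hz.2, le_abs_self a, neg_abs_le a]
  · refine (lintegral_sub_le_of_mem (fun t => ENNReal.ofReal (|t| ^ (-(1 / 2) : ℝ)))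
      (A := |b| + |zm| + |zp|) fun z hz => ?_).trans_lt (lintegral_abs_rpow_lt_top _)
    constructor <;> linarith [hz.1, hz.2, le_abs_self b, neg_abs_le b, le_abs_self zm,
      neg_abs_le zm, le_abs_self zp, neg_abs_le zp]

/-- The dominating function for the periodized kernel on `D × D`. For `r` in `D` the inner integral
is at most that of `|t|^(-1/2)` over `|t| ≤ zp - zm`, whatever `r` is. -/
theorem memLp_weight_prod (zm zp : ℝ) :
    MemLp (fun p : (ℝ × ℝ) × (ℝ × ℝ) => |p.1.2 - p.2.2| ^ (-(1 / 4) : ℝ)) 2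
      ((volume.restrict (rect zm zp)).prod (volume.restrict (rect zm zp))) := by
  refine memLp_of_lintegral_sq_lt_top
    (by fun_prop : Measurable fun p : (ℝ × ℝ) × (ℝ × ℝ) => |p.1.2 - p.2.2| ^ (-(1 / 4) : ℝ)).aestronglyMeasurable ?_
  simp only [ofReal_rpow_quarter_sq]
  rw [lintegral_prod _ (by fun_prop)]
  set B := ∫⁻ t in Icc (-(zp - zm)) (zp - zm), ENNReal.ofReal (|t| ^ (-(1 / 2) : ℝ)) with hB
  have hbound : ∀ᵐ r ∂(volume.restrict (rect zm zp)),
      ∫⁻ r₀ in rect zm zp, ENNReal.ofReal (|r.2 - r₀.2| ^ (-(1 / 2) : ℝ)) ≤ B := by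
    filter_upwards [ae_restrict_mem (measurableSet_rect zm zp)] with r hr
    have h := lintegral_prod_mul (μ := volume.restrict (Icc (0 : ℝ) 1))
      (ν := volume.restrict (Icc zm zp)) (f := fun _ => 1)
      (g := fun z => ENNReal.ofReal (|r.2 - z| ^ (-(1 / 2) : ℝ))) (by fun_prop) (by fun_prop)
    simp only [one_mul] at h
    rw [volume_restrict_rect, h]
    simp only [lintegral_const, Measure.restrict_apply_univ, Real.volume_Icc, sub_zero,
      ENNReal.ofReal_one, mul_one, one_mul]
    refine lintegral_sub_le_of_mem (fun t => ENNReal.ofReal (|t| ^ (-(1 / 2) : ℝ))) fun z hz => ?_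
    have h2 := hr.2
    constructor <;> linarith [hz.1, hz.2, h2.1, h2.2]
  refine (lintegral_mono_ae hbound).trans_lt ?_
  rw [lintegral_const]
  exact ENNReal.mul_lt_top (lintegral_abs_rpow_lt_top _) (measure_lt_top _ _)

theorem ae_snd_ne (c : ℝ) : ∀ᵐ r : ℝ × ℝ, r.2 ≠ c := by
  rw [Measure.volume_eq_prod]
  have h : ∀ᵐ z : ℝ, z ≠ c := by simp [ae_iff]
  exact Measure.quasiMeasurePreserving_snd.ae h

theorem ae_snd_sub_ne_zero (zm zp : ℝ) :
    ∀ᵐ p ∂((volume.restrict (rect zm zp)).prod (volume.restrict (rect zm zp))),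
      p.1 ∈ rect zm zp ∧ p.2 ∈ rect zm zp ∧ p.1.2 - p.2.2 ≠ 0 := by
  have h1 : ∀ᵐ r ∂(volume.restrict (rect zm zp)), r ∈ rect zm zp :=
    ae_restrict_mem (measurableSet_rect zm zp)
  have h2 := Measure.quasiMeasurePreserving_fst (μ := volume.restrict (rect zm zp))
    (ν := volume.restrict (rect zm zp)) |>.ae h1
  have h3 := Measure.quasiMeasurePreserving_snd (μ := volume.restrict (rect zm zp))
    (ν := volume.restrict (rect zm zp)) |>.ae h1
  have h4 : ∀ᵐ p ∂((volume.restrict (rect zm zp)).prod (volume.restrict (rect zm zp))),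
      p.1.2 - p.2.2 ≠ 0 := by
    rw [ae_iff, Measure.measure_prod_null]
    · refine Eventually.of_forall fun r => ?_
      have h5 := ae_restrict_of_ae (s := rect zm zp) (ae_snd_ne r.2)
      rw [ae_iff] at h5
      refine measure_mono_null (fun q hq => ?_) h5
      simp only [mem_preimage, mem_ofPred_eq, not_not, sub_eq_zero] at hq ⊢
      exact hq.symm
    · simpa only [ne_eq, not_not] using measurableSet_eq_fun
        (f := fun p : (ℝ × ℝ) × (ℝ × ℝ) => p.1.2 - p.2.2) (g := fun _ => 0) (by fun_prop)
        measurable_const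
  filter_upwards [h2, h3, h4] with p a b c using ⟨a, b, c⟩

end

end SiegertStates

namespace SiegertStates

noncomputable section

/-! ### The operator family -/

/-- The sum is the limit of its measurable partial sums wherever `z ≠ 0`. -/
theorem aestronglyMeasurable_blochSeries {kx : ℝ} {E : ℂ} (hE : E ∈ cutPlane kx) {Y : Type*}
    [MeasurableSpace Y] {ν : Measure Y} {φ ψ : Y → ℝ} (hφ : Measurable φ) (hψ : Measurable ψ)
    (h : ∀ᵐ y ∂ν, ψ y ≠ 0) :
    AEStronglyMeasurable (fun y => blochSeries kx E (φ y) (ψ y)) ν := by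
  unfold blochSeries
  refine AEStronglyMeasurable.const_mul ?_ _
  refine aestronglyMeasurable_of_tendsto_ae (atTop : Filter (Finset ℤ))
    (f := fun s y => ∑ m ∈ s, seriesTerm kx E (φ y) (ψ y) m) (fun s => ?_) ?_
  · refine Measurable.aestronglyMeasurable (Finset.measurable_fun_sum s fun m _ => ?_)
    unfold seriesTerm
    fun_prop
  · filter_upwards [h] with y hy
    exact (summable_seriesTerm hE (φ y) hy).hasSum

section Family

variable {ε : ℝ × ℝ → ℝ} {kx zm zp : ℝ}

theorem norm_sub_one_le {M : ℝ} (hone : ∀ r, 1 ≤ ε r) (hM : ∀ r, ε r ≤ M) (r : ℝ × ℝ) :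
    ‖((ε r - 1 : ℝ) : ℂ)‖ ≤ M := by
  rw [Complex.norm_real, Real.norm_of_nonneg (by linarith [hone r])]
  linarith [hM r]

theorem aestronglyMeasurable_lsKernel (hmeas : Measurable ε) {E : ℂ} (hE : E ∈ cutPlane kx) :
    AEStronglyMeasurable (fun p : (ℝ × ℝ) × (ℝ × ℝ) => lsKernel ε kx E p.1 p.2)
      ((volume.restrict (rect zm zp)).prod (volume.restrict (rect zm zp))) := by
  unfold lsKernel
  refine AEStronglyMeasurable.mul (Measurable.aestronglyMeasurable (by fun_prop)) ?_
  refine aestronglyMeasurable_blochSeries hE (by fun_prop) (by fun_prop) ?_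
  filter_upwards [ae_snd_sub_ne_zero zm zp] with p hp using hp.2.2

/-- The quantifier over `E` stands inside the almost everywhere statement: one null set serves all
energies, as domination of an analytic family requires. -/
theorem ae_norm_lsKernel_le {M C : ℝ} (hone : ∀ r, 1 ≤ ε r) (hM : ∀ r, ε r ≤ M) :
    ∀ᵐ p ∂((volume.restrict (rect zm zp)).prod (volume.restrict (rect zm zp))),
      ∀ E, (∀ x z : ℝ, 0 < |z| → |z| ≤ zp - zm →
        ‖blochSeries kx E x z‖ ≤ C * |z| ^ (-(1 / 4) : ℝ)) →
      ‖lsKernel ε kx E p.1 p.2‖ ≤ M * C * |p.1.2 - p.2.2| ^ (-(1 / 4) : ℝ) := by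
  filter_upwards [ae_snd_sub_ne_zero zm zp] with p ⟨h1, h2, h3⟩ E hE
  have h4 : |p.1.2 - p.2.2| ≤ zp - zm := by
    have ha := h1.2
    have hb := h2.2
    rw [abs_le]
    constructor <;> linarith [ha.1, ha.2, hb.1, hb.2]
  rw [lsKernel, norm_mul, mul_assoc]
  have hM0 : 0 ≤ M := by linarith [hone (0, 0), hM (0, 0)]
  exact mul_le_mul (norm_sub_one_le hone hM _) (hE _ _ (abs_pos.2 h3) h4) (norm_nonneg _) hM0

theorem memLp_lsKernel (hz : zm < zp) (hmeas : Measurable ε) (hone : ∀ r, 1 ≤ ε r)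
    (hbdd : ∃ M : ℝ, ∀ r, ε r ≤ M) {E : ℂ} (hE : E ∈ cutPlane kx) :
    MemLp (fun p : (ℝ × ℝ) × (ℝ × ℝ) => lsKernel ε kx E p.1 p.2) 2
      ((volume.restrict (rect zm zp)).prod (volume.restrict (rect zm zp))) := by
  obtain ⟨M, hM⟩ := hbdd
  obtain ⟨C, hC⟩ := exists_blochSeries_bound hE (L := zp - zm) (by linarith)
  refine ((memLp_weight_prod zm zp).const_mul (M * C)).mono' (aestronglyMeasurable_lsKernel hmeas hE) ?_
  filter_upwards [ae_norm_lsKernel_le (kx := kx) (C := C) hone hM] with p hp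
  exact hp E hC.self_of_nhds

open Classical in
/-- The `L²` class of the kernel; zero where the kernel is not square integrable. -/
def lsKernelLp (ε : ℝ × ℝ → ℝ) (kx zm zp : ℝ) (E : ℂ) :
    Lp ℂ 2 (((volume : Measure (ℝ × ℝ)).restrict (rect zm zp)).prod
      ((volume : Measure (ℝ × ℝ)).restrict (rect zm zp))) :=
  if h : MemLp (fun p : (ℝ × ℝ) × (ℝ × ℝ) => lsKernel ε kx E p.1 p.2) 2
      ((volume.restrict (rect zm zp)).prod (volume.restrict (rect zm zp)))
  then h.toLp _ else 0

theorem lsKernelLp_coeFn (hz : zm < zp) (hmeas : Measurable ε) (hone : ∀ r, 1 ≤ ε r)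
    (hbdd : ∃ M : ℝ, ∀ r, ε r ≤ M) {E : ℂ} (hE : E ∈ cutPlane kx) :
    lsKernelLp ε kx zm zp E
      =ᵐ[(volume.restrict (rect zm zp)).prod (volume.restrict (rect zm zp))]
        fun p => lsKernel ε kx E p.1 p.2 := by
  have h := memLp_lsKernel hz hmeas hone hbdd hE
  rw [lsKernelLp, dif_pos h]
  exact h.coeFn_toLp

/-- The operator with the periodized kernel. -/
def lsOp (ε : ℝ × ℝ → ℝ) (kx zm zp : ℝ) (E : ℂ) : L2D zm zp →L[ℂ] L2D zm zp :=
  kernelOp _ (lsKernelLp ε kx zm zp E)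

theorem lsOp_ae (hz : zm < zp) (hmeas : Measurable ε) (hone : ∀ r, 1 ≤ ε r)
    (hbdd : ∃ M : ℝ, ∀ r, ε r ≤ M) {E : ℂ} (hE : E ∈ cutPlane kx) (f : L2D zm zp) :
    ∀ᵐ r ∂(volume.restrict (rect zm zp)),
      IntegrableOn (fun r₀ => lsKernel ε kx E r r₀ * f r₀) (rect zm zp) ∧
      lsOp ε kx zm zp E f r = ∫ r₀ in rect zm zp, lsKernel ε kx E r r₀ * f r₀ := by
  filter_upwards [ae_memLp_slice (memLp_lsKernel hz hmeas hone hbdd hE),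
    kernelLp_coeFn (lsKernelLp ε kx zm zp E) f,
    kernelFun_congr (lsKernelLp_coeFn hz hmeas hone hbdd hE) (EventuallyEq.refl _ f)] with r h1 h2 h3
  refine ⟨integrable_slice_mul h1 (Lp.memLp f), ?_⟩
  rw [lsOp, kernelOp_apply, h2, h3, kernelFun]

theorem analyticOnNhd_lsOp (hz : zm < zp) (hmeas : Measurable ε) (hone : ∀ r, 1 ≤ ε r)
    (hbdd : ∃ M : ℝ, ∀ r, ε r ≤ M) : AnalyticOnNhd ℂ (lsOp ε kx zm zp) (cutPlane kx) := by
  refine DifferentiableOn.analyticOnNhd (fun E₀ hE₀ => ?_) (isOpen_cutPlane kx)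
  refine DifferentiableAt.differentiableWithinAt ?_
  refine (kernelOp _).differentiableAt.comp E₀ ?_
  have hmem := (isOpen_cutPlane kx).eventually_mem hE₀
  obtain ⟨C, hC⟩ := exists_blochSeries_bound hE₀ (L := zp - zm) (by linarith)
  have hbdd' := hbdd
  obtain ⟨M, hM⟩ := hbdd'
  refine differentiableAt_Lp_of_dominated (F := fun E p => lsKernel ε kx E p.1 p.2)
    ((memLp_weight_prod zm zp).const_mul (M * C)) ?_ ⟨_, hmem.and hC, ?_⟩
  · filter_upwards [hmem] with E hE using lsKernelLp_coeFn hz hmeas hone hbdd hE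
  · filter_upwards [ae_norm_lsKernel_le (kx := kx) (C := C) hone hM,
      ae_snd_sub_ne_zero zm zp] with p hp hne E hE
    refine ⟨?_, hp E hE.2⟩
    exact (((analyticOnNhd_blochSeries kx (p.1.1 - p.2.1) hne.2.2) E hE.1).differentiableAt).const_mul _

/-- The starting point of the analytic Fredholm theorem. The value of `η` is chosen to make the
operator norm at most `1/2`. -/
theorem exists_isUnit_one_sub_lsOp (hz : zm < zp) (hmeas : Measurable ε) (hone : ∀ r, 1 ≤ ε r)
    (hbdd : ∃ M : ℝ, ∀ r, ε r ≤ M) :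
    ∃ E ∈ cutPlane kx, IsUnit (1 - lsOp ε kx zm zp E) := by
  have hbdd' := hbdd
  obtain ⟨M, hM⟩ := hbdd'
  have hM1 : 1 ≤ M := (hone (0, 0)).trans (hM (0, 0))
  set W := ‖(memLp_weight_prod zm zp).toLp _‖ with hW
  have hW0 : 0 ≤ W := norm_nonneg _
  obtain ⟨E, hE, hsmall⟩ := exists_blochSeries_small kx (L := zp - zm) (η := 1 / (2 * M * (W + 1)))
    (by linarith) (by positivity)
  refine ⟨E, hE, isUnit_one_sub_of_norm_lt_one ?_⟩
  refine (norm_kernelOp_le _).trans_lt ?_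
  have h := Lp.norm_le_mul_norm_of_ae_le_mul (c := M * (1 / (2 * M * (W + 1))))
    (f := lsKernelLp ε kx zm zp E) (g := (memLp_weight_prod zm zp).toLp _) ?_
  · refine h.trans_lt ?_
    rw [← hW]
    calc M * (1 / (2 * M * (W + 1))) * W = (W / (W + 1)) / 2 := by field_simp
      _ ≤ 1 / 2 := by
        gcongr
        rw [div_le_one (by linarith)]; linarith
      _ < 1 := by norm_num
  · filter_upwards [lsKernelLp_coeFn hz hmeas hone hbdd hE, (memLp_weight_prod zm zp).coeFn_toLp,
      ae_norm_lsKernel_le (kx := kx) (C := 1 / (2 * M * (W + 1))) hone hM] with p h1 h2 h3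
    rw [h1, h2, Real.norm_of_nonneg (by positivity)]
    exact h3 E hsmall

end Family

end

end SiegertStates

namespace SiegertStates

noncomputable section

/-! ### The Hankel function at complex arguments -/

/-- The half plane `Re ζ + Im ζ > 0`. -/
def hankelDomain : Set ℂ := {ζ | 0 < ζ.re + ζ.im}

theorem isOpen_hankelDomain : IsOpen hankelDomain :=
  isOpen_lt continuous_const (Complex.continuous_re.add Complex.continuous_im)

theorem mem_slitPlane_of_mem_hankelDomain {ζ : ℂ} (h : ζ ∈ hankelDomain) : ζ ∈ Complex.slitPlane := by
  rw [Complex.mem_slitPlane_iff]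
  by_contra! h'
  have : 0 < ζ.re + ζ.im := h
  linarith [h'.1, h'.2]

theorem ne_zero_of_mem_hankelDomain {ζ : ℂ} (h : ζ ∈ hankelDomain) : ζ ≠ 0 :=
  Complex.slitPlane_ne_zero (mem_slitPlane_of_mem_hankelDomain h)

theorem ofReal_mem_hankelDomain {x : ℝ} (hx : 0 < x) : (x : ℂ) ∈ hankelDomain := by
  show 0 < (x : ℂ).re + (x : ℂ).im
  simpa using hx

theorem mul_ofReal_mem_hankelDomain {ζ : ℂ} (h : ζ ∈ hankelDomain) {t : ℝ} (ht : 0 < t) :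
    ζ * t ∈ hankelDomain := by
  show 0 < (ζ * t).re + (ζ * t).im
  rw [Complex.re_mul_ofReal, Complex.im_mul_ofReal, ← add_mul]
  exact mul_pos h ht

/-- With `c = u / (2|ζ|²)` the point is `1 + c (Im ζ + i Re ζ)`, whose real and imaginary parts add
up to at least `1`. That half plane misses the negative axis and keeps distance `1/√2` from the
origin. -/
theorem one_add_div_mem {ζ : ℂ} (h : ζ ∈ hankelDomain) {u : ℝ} (hu : 0 ≤ u) :
    1 + Complex.I * u / (2 * ζ) ∈ Complex.slitPlane ∧ 1 / 2 ≤ ‖1 + Complex.I * u / (2 * ζ)‖ := by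
  have h0 := ne_zero_of_mem_hankelDomain h
  have hs : 0 < Complex.normSq ζ := Complex.normSq_pos.2 h0
  set c := u / (2 * Complex.normSq ζ) with hc
  have hc0 : 0 ≤ c := by positivity
  have hw : 1 + Complex.I * u / (2 * ζ) = ⟨1 + c * ζ.im, c * ζ.re⟩ := by
    have h1 : Complex.I * u / (2 * ζ) = (c : ℂ) * ⟨ζ.im, ζ.re⟩ := by
      have h2 : (⟨ζ.im, ζ.re⟩ : ℂ) = Complex.I * (starRingEnd ℂ) ζ := by
        apply Complex.ext <;> simp
      have h3 : (c : ℂ) * (2 * Complex.normSq ζ) = u := by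
        rw [hc]; push_cast; rw [div_mul_cancel₀]
        exact mul_ne_zero two_ne_zero (Complex.ofReal_ne_zero.2 hs.ne')
      rw [Complex.normSq_eq_conj_mul_self] at h3
      rw [h2, div_eq_iff (mul_ne_zero two_ne_zero h0), ← h3]
      ring
    rw [h1]
    apply Complex.ext <;> simp
  have hsum : 0 ≤ c * ζ.im + c * ζ.re := by
    rw [← mul_add, add_comm]; exact mul_nonneg hc0 (le_of_lt h)
  rw [hw]
  constructor
  · rw [Complex.mem_slitPlane_iff]
    by_contra! h'
    simp only at h'
    rw [h'.2, add_zero] at hsum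
    linarith [h'.1]
  · refine (sq_le_sq₀ (by norm_num) (norm_nonneg _)).1 ?_
    rw [← Complex.normSq_eq_norm_sq, Complex.normSq_mk]
    rcases le_total 0 (c * ζ.im) with h1 | h1 <;> nlinarith [sq_nonneg (1 + 2 * (c * ζ.im)), sq_nonneg (c * ζ.re)]

theorem norm_cpow_le_of_half_le {v : ℂ} (hv : 1 / 2 ≤ ‖v‖) {s : ℝ} (hs : -2 ≤ s) (hs0 : s ≤ 0) :
    ‖v ^ (s : ℂ)‖ ≤ 4 := by
  rw [Complex.norm_cpow_real]
  calc ‖v‖ ^ s ≤ (1 / 2 : ℝ) ^ s := Real.rpow_le_rpow_of_nonpos (by norm_num) hv hs0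
    _ ≤ (1 / 2 : ℝ) ^ (-2 : ℝ) := Real.rpow_le_rpow_of_exponent_ge (by norm_num) (by norm_num) hs
    _ = 4 := by
      rw [Real.rpow_neg (by norm_num)]; norm_num

theorem norm_cpow_neg_half_le {v : ℂ} (hv : 1 / 2 ≤ ‖v‖) : ‖v ^ (-(1 / 2) : ℂ)‖ ≤ 4 := by
  have h := norm_cpow_le_of_half_le hv (s := -(1 / 2)) (by norm_num) (by norm_num)
  push_cast at h
  exact h

theorem norm_cpow_neg_half_sub_one_le {v : ℂ} (hv : 1 / 2 ≤ ‖v‖) :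
    ‖v ^ (-(1 / 2) - 1 : ℂ)‖ ≤ 4 := by
  have h := norm_cpow_le_of_half_le hv (s := -(1 / 2) - 1) (by norm_num) (by norm_num)
  push_cast at h
  exact h

/-- The integral in Hankel's formula. -/
def hankelInt (ζ : ℂ) : ℂ :=
  ∫ u in Ioi (0 : ℝ), ((Real.exp (-u) * u ^ (-(1 / 2) : ℝ) : ℝ) : ℂ)
        * (1 + Complex.I * u / (2 * ζ)) ^ (-(1 / 2) : ℂ)

theorem integrableOn_exp_mul_rpow_neg_half :
    IntegrableOn (fun u : ℝ => Real.exp (-u) * u ^ (-(1 / 2) : ℝ)) (Ioi 0) := by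
  have h := Real.GammaIntegral_convergent (s := 1 / 2) (by norm_num)
  norm_num at h ⊢
  exact h

theorem integral_exp_mul_rpow_neg_half :
    ∫ u in Ioi (0 : ℝ), Real.exp (-u) * u ^ (-(1 / 2) : ℝ) = Real.sqrt Real.pi := by
  rw [← Real.Gamma_one_half_eq, Real.Gamma_eq_integral (by norm_num)]
  norm_num

theorem norm_hankelInt_integrand_le {ζ : ℂ} (h : ζ ∈ hankelDomain) {u : ℝ} (hu : 0 < u) :
    ‖((Real.exp (-u) * u ^ (-(1 / 2) : ℝ) : ℝ) : ℂ)
        * (1 + Complex.I * u / (2 * ζ)) ^ (-(1 / 2) : ℂ)‖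
      ≤ Real.exp (-u) * u ^ (-(1 / 2) : ℝ) * 4 := by
  rw [norm_mul, Complex.norm_real, Real.norm_of_nonneg (by positivity)]
  gcongr
  exact norm_cpow_neg_half_le (one_add_div_mem h hu.le).2

theorem norm_hankelInt_le {ζ : ℂ} (h : ζ ∈ hankelDomain) : ‖hankelInt ζ‖ ≤ 8 := by
  have h1 : ‖hankelInt ζ‖ ≤ ∫ u in Ioi (0 : ℝ), Real.exp (-u) * u ^ (-(1 / 2) : ℝ) * 4 := by
    refine norm_integral_le_of_norm_le (integrableOn_exp_mul_rpow_neg_half.mul_const 4) ?_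
    filter_upwards [ae_restrict_mem measurableSet_Ioi] with u hu
    exact norm_hankelInt_integrand_le h hu
  rw [integral_mul_const, integral_exp_mul_rpow_neg_half] at h1
  have h2 : Real.sqrt Real.pi ≤ 2 := by
    rw [Real.sqrt_le_left (by norm_num)]
    linarith [Real.pi_le_four]
  linarith

theorem aestronglyMeasurable_hankelInt_integrand (ζ s : ℂ) :
    AEStronglyMeasurable (fun u : ℝ => ((Real.exp (-u) * u ^ (-(1 / 2) : ℝ) : ℝ) : ℂ)
        * (1 + Complex.I * u / (2 * ζ)) ^ s) (volume.restrict (Ioi 0)) := by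
  refine Measurable.aestronglyMeasurable ?_
  fun_prop

theorem differentiableAt_hankelInt {ζ₀ : ℂ} (h₀ : ζ₀ ∈ hankelDomain) :
    DifferentiableAt ℂ hankelInt ζ₀ := by
  have hne := ne_zero_of_mem_hankelDomain h₀
  have hpos : 0 < ‖ζ₀‖ := norm_pos_iff.2 hne
  -- Staying away from `0` bounds the factor `ζ^(-2)` of the differentiated integrand. The
  -- derivative also brings a factor `u`, which turns `u^(-1/2)` into `u^(1/2)`.
  set s : Set ℂ := hankelDomain ∩ {ζ | ‖ζ₀‖ / 2 < ‖ζ‖} with hs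
  have hsn : s ∈ 𝓝 ζ₀ := by
    refine inter_mem (isOpen_hankelDomain.mem_nhds h₀)
      ((isOpen_lt continuous_const continuous_norm).mem_nhds ?_)
    show ‖ζ₀‖ / 2 < ‖ζ₀‖
    linarith
  have hint : IntegrableOn (fun u : ℝ => Real.exp (-u) * u ^ (1 / 2 : ℝ)) (Ioi 0) := by
    have h := Real.GammaIntegral_convergent (s := 3 / 2) (by norm_num)
    norm_num at h ⊢
    exact h
  have key := hasDerivAt_integral_of_dominated_loc_of_deriv_le (μ := volume.restrict (Ioi (0 : ℝ)))
    (F := fun ζ u => ((Real.exp (-u) * u ^ (-(1 / 2) : ℝ) : ℝ) : ℂ)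
        * (1 + Complex.I * u / (2 * ζ)) ^ (-(1 / 2) : ℂ))
    (F' := fun ζ u => ((Real.exp (-u) * u ^ (-(1 / 2) : ℝ) : ℝ) : ℂ)
        * ((-(1 / 2) : ℂ) * (1 + Complex.I * u / (2 * ζ)) ^ (-(1 / 2) - 1 : ℂ)
          * (Complex.I * u / 2 * (-(ζ ^ 2)⁻¹))))
    (bound := fun u => 4 / ‖ζ₀‖ ^ 2 * (Real.exp (-u) * u ^ (1 / 2 : ℝ)))
    hsn ?_ ?_ ?_ ?_ (hint.const_mul _) ?_
  · exact key.2.differentiableAt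
  · exact Eventually.of_forall fun ζ => aestronglyMeasurable_hankelInt_integrand ζ _
  · refine Integrable.mono' (integrableOn_exp_mul_rpow_neg_half.mul_const 4)
      (aestronglyMeasurable_hankelInt_integrand ζ₀ _) ?_
    filter_upwards [ae_restrict_mem measurableSet_Ioi] with u hu
    exact norm_hankelInt_integrand_le h₀ hu
  · refine Measurable.aestronglyMeasurable ?_
    fun_prop
  · filter_upwards [ae_restrict_mem measurableSet_Ioi] with u hu ζ hζ
    have hu' : 0 < u := hu
    have h1 := norm_cpow_neg_half_sub_one_le (one_add_div_mem hζ.1 hu'.le).2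
    have h2 : ‖ζ₀‖ / 2 < ‖ζ‖ := hζ.2
    have h3 : ‖Complex.I * u / 2 * (-(ζ ^ 2)⁻¹)‖ ≤ u / 2 * (4 / ‖ζ₀‖ ^ 2) := by
      rw [norm_mul, norm_neg, norm_inv, norm_pow, norm_div, norm_mul, Complex.norm_I, one_mul,
        Complex.norm_real, Real.norm_of_nonneg hu'.le, Complex.norm_ofNat]
      gcongr
      rw [show 4 / ‖ζ₀‖ ^ 2 = ((‖ζ₀‖ / 2) ^ 2)⁻¹ by field_simp; norm_num]
      gcongr
    have h4 : ‖(-(1 / 2) : ℂ)‖ = 1 / 2 := by norm_num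
    rw [norm_mul, Complex.norm_real, Real.norm_of_nonneg (by positivity), norm_mul, norm_mul, h4]
    calc _ ≤ Real.exp (-u) * u ^ (-(1 / 2) : ℝ) * (1 / 2 * 4 * (u / 2 * (4 / ‖ζ₀‖ ^ 2))) := by
          gcongr
      _ = 4 / ‖ζ₀‖ ^ 2 * (Real.exp (-u) * (u ^ (-(1 / 2) : ℝ) * u)) := by ring
      _ = _ := by
        rw [← Real.rpow_add_one hu'.ne']; norm_num
  · filter_upwards [ae_restrict_mem measurableSet_Ioi] with u hu ζ hζ
    have hu' : 0 < u := hu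
    have hζ0 := ne_zero_of_mem_hankelDomain hζ.1
    have h1 : HasDerivAt (fun ζ : ℂ => 1 + Complex.I * u / (2 * ζ))
        (Complex.I * u / 2 * (-(ζ ^ 2)⁻¹)) ζ := by
      have h2 := ((hasDerivAt_inv hζ0).const_mul (Complex.I * u / 2)).const_add 1
      refine h2.congr_of_eventuallyEq (Eventually.of_forall fun y => ?_)
      show 1 + Complex.I * u / (2 * y) = 1 + Complex.I * u / 2 * y⁻¹
      rw [div_eq_mul_inv, mul_inv]; ring
    exact (h1.cpow_const (one_add_div_mem hζ.1 hu'.le).1).const_mul _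

/-- The amplitude of the Hankel function. -/
def hankelAmp (ζ : ℂ) : ℂ := ζ ^ (-(1 / 2) : ℂ) * hankelInt ζ

theorem differentiableAt_hankelAmp {ζ : ℂ} (h : ζ ∈ hankelDomain) :
    DifferentiableAt ℂ hankelAmp ζ := by
  have h1 : DifferentiableAt ℂ (fun ζ : ℂ => ζ ^ (-(1 / 2) : ℂ)) ζ :=
    ((hasDerivAt_id ζ).cpow_const (mem_slitPlane_of_mem_hankelDomain h)).differentiableAt
  exact h1.mul (differentiableAt_hankelInt h)

theorem norm_hankelAmp_le {ζ : ℂ} (h : ζ ∈ hankelDomain) :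
    ‖hankelAmp ζ‖ ≤ 8 * ‖ζ‖ ^ (-(1 / 2) : ℝ) := by
  have h1 : ‖ζ ^ (-(1 / 2) : ℂ)‖ = ‖ζ‖ ^ (-(1 / 2) : ℝ) := by
    rw [← Complex.norm_cpow_real]; push_cast; rfl
  rw [hankelAmp, norm_mul, h1, mul_comm]
  gcongr
  exact norm_hankelInt_le h

/-- Cauchy's estimate on the circle of radius `|ζ|/4`. In the closed first quadrant `Re ζ + Im ζ ≥
|ζ|`, and moving by `|ζ|/4` lowers this sum by at most `|ζ|/2`, so the disc stays in the domain. -/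
theorem norm_deriv_hankelAmp_le {ζ : ℂ} (h0 : ζ ≠ 0) (hre : 0 ≤ ζ.re) (him : 0 ≤ ζ.im) :
    ‖deriv hankelAmp ζ‖ ≤ 128 * ‖ζ‖ ^ (-(3 / 2) : ℝ) := by
  have hpos : 0 < ‖ζ‖ := norm_pos_iff.2 h0
  have hsum : ‖ζ‖ ≤ ζ.re + ζ.im := by
    have := Complex.norm_le_abs_re_add_abs_im ζ
    rwa [abs_of_nonneg hre, abs_of_nonneg him] at this
  have hsub : Metric.closedBall ζ (‖ζ‖ / 4) ⊆ hankelDomain := by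
    intro w hw
    rw [Metric.mem_closedBall, dist_eq_norm] at hw
    have h1 := (abs_le.1 (Complex.abs_re_le_norm (w - ζ))).1
    have h2 := (abs_le.1 (Complex.abs_im_le_norm (w - ζ))).1
    simp only [Complex.sub_re, Complex.sub_im] at h1 h2
    show 0 < w.re + w.im
    linarith
  have hb : ∀ w ∈ Metric.sphere ζ (‖ζ‖ / 4), ‖hankelAmp w‖ ≤ 32 * ‖ζ‖ ^ (-(1 / 2) : ℝ) := by
    intro w hw
    refine (norm_hankelAmp_le (hsub (Metric.sphere_subset_closedBall hw))).trans ?_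
    rw [mem_sphere_iff_norm] at hw
    have h1 : ‖ζ‖ * (1 / 2) ≤ ‖w‖ := by
      have := norm_sub_norm_le ζ w
      rw [norm_sub_rev, hw] at this
      linarith
    calc 8 * ‖w‖ ^ (-(1 / 2) : ℝ) ≤ 8 * (‖ζ‖ * (1 / 2)) ^ (-(1 / 2) : ℝ) := by
          gcongr 8 * ?_
          exact Real.rpow_le_rpow_of_nonpos (by positivity) h1 (by norm_num)
      _ ≤ 8 * (‖ζ‖ ^ (-(1 / 2) : ℝ) * 4) := by
          rw [Real.mul_rpow hpos.le (by norm_num)]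
          gcongr 8 * (_ * ?_)
          calc (1 / 2 : ℝ) ^ (-(1 / 2) : ℝ) ≤ (1 / 2 : ℝ) ^ (-2 : ℝ) :=
                Real.rpow_le_rpow_of_exponent_ge (by norm_num) (by norm_num) (by norm_num)
            _ = 4 := by rw [Real.rpow_neg (by norm_num)]; norm_num
      _ = _ := by ring
  have hd : DifferentiableOn ℂ hankelAmp hankelDomain := fun w hw =>
    (differentiableAt_hankelAmp hw).differentiableWithinAt
  have h := Complex.norm_deriv_le_of_forall_mem_sphere_norm_le (by positivity)
    (hd.diffContOnCl_ball hsub) hb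
  refine h.trans (le_of_eq ?_)
  rw [show (-(3 / 2) : ℝ) = -(1 / 2) - 1 by norm_num, Real.rpow_sub_one hpos.ne']
  field_simp
  norm_num

/-- The constant in front of Hankel's formula. -/
def hankelConst : ℂ := ((Real.sqrt 2 / Real.pi : ℝ) : ℂ) * Complex.exp (-(Complex.I * (Real.pi / 4)))

/-- The Hankel function on the half plane `Re ζ + Im ζ > 0`. -/
def hankelC (ζ : ℂ) : ℂ := hankelConst * Complex.exp (Complex.I * ζ) * hankelAmp ζ

theorem norm_hankelConst_le : ‖hankelConst‖ ≤ 1 := by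
  have h1 : ‖Complex.exp (-(Complex.I * (Real.pi / 4)))‖ = 1 := by
    have : -(Complex.I * ((Real.pi : ℂ) / 4)) = ((-(Real.pi / 4) : ℝ) : ℂ) * Complex.I := by
      push_cast; ring
    rw [this, Complex.norm_exp_ofReal_mul_I]
  rw [hankelConst, norm_mul, h1, mul_one, Complex.norm_real, Real.norm_of_nonneg (by positivity),
    div_le_one Real.pi_pos, Real.sqrt_le_left Real.pi_pos.le]
  nlinarith [Real.pi_gt_three]

theorem hankelH0_eq {x : ℝ} (hx : 0 < x) : hankelH0 x = hankelC x := by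
  have h1 : ((x : ℂ)) ^ (-(1 / 2) : ℂ) = ((x ^ (-(1 / 2) : ℝ) : ℝ) : ℂ) := by
    rw [Complex.ofReal_cpow hx.le]; push_cast; rfl
  have h2 : Real.sqrt (2 / (Real.pi * x)) * (Real.sqrt Real.pi)⁻¹
      = Real.sqrt 2 / Real.pi * x ^ (-(1 / 2) : ℝ) := by
    rw [Real.rpow_neg hx.le, ← Real.sqrt_eq_rpow, Real.sqrt_div (by norm_num),
      Real.sqrt_mul Real.pi_pos.le]
    nth_rewrite 3 [← Real.mul_self_sqrt Real.pi_pos.le]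
    have : 0 < Real.sqrt Real.pi := Real.sqrt_pos.2 Real.pi_pos
    have : 0 < Real.sqrt x := Real.sqrt_pos.2 hx
    field_simp
  have h3 : Complex.exp (Complex.I * (x - Real.pi / 4))
      = Complex.exp (-(Complex.I * (Real.pi / 4))) * Complex.exp (Complex.I * x) := by
    rw [← Complex.exp_add]; congr 1; ring
  have h4 : ((Real.sqrt (2 / (Real.pi * x)) : ℝ) : ℂ) * ((Real.sqrt Real.pi : ℝ) : ℂ)⁻¹
      = ((Real.sqrt 2 / Real.pi : ℝ) : ℂ) * ((x ^ (-(1 / 2) : ℝ) : ℝ) : ℂ) := by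
    rw [← Complex.ofReal_inv, ← Complex.ofReal_mul, h2, Complex.ofReal_mul]
  rw [hankelH0, hankelC, hankelAmp, hankelConst, h1, h3]
  unfold hankelInt
  linear_combination (Complex.exp (-(Complex.I * (Real.pi / 4))) * Complex.exp (Complex.I * x) *
    ∫ u in Ioi (0 : ℝ), ((Real.exp (-u) * u ^ (-(1 / 2) : ℝ) : ℝ) : ℂ)
        * (1 + Complex.I * u / (2 * x)) ^ (-(1 / 2) : ℂ)) * h4

theorem norm_hankelC_le {ζ : ℂ} (h : ζ ∈ hankelDomain) :
    ‖hankelC ζ‖ ≤ 8 * Real.exp (-ζ.im) * ‖ζ‖ ^ (-(1 / 2) : ℝ) := by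
  have h1 : ‖Complex.exp (Complex.I * ζ)‖ = Real.exp (-ζ.im) := by
    rw [Complex.norm_exp]; simp
  rw [hankelC, norm_mul, norm_mul, h1]
  calc _ ≤ 1 * Real.exp (-ζ.im) * (8 * ‖ζ‖ ^ (-(1 / 2) : ℝ)) := by
        gcongr
        · exact norm_hankelConst_le
        · exact norm_hankelAmp_le h
    _ = _ := by ring

theorem differentiableAt_hankelC {ζ : ℂ} (h : ζ ∈ hankelDomain) :
    DifferentiableAt ℂ hankelC ζ := by
  unfold hankelC
  refine DifferentiableAt.mul (by fun_prop) (differentiableAt_hankelAmp h)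

end

end SiegertStates

namespace SiegertStates

noncomputable section

/-! ### The Hankel function on the imaginary axis and its Fourier representation -/

theorem exp_neg_le_inv_pow {t : ℝ} (ht : 0 < t) (n : ℕ) : Real.exp (-t) ≤ n.factorial / t ^ n := by
  have h := Real.pow_div_factorial_le_exp t ht.le n
  rw [Real.exp_neg, ← inv_div]
  exact inv_anti₀ (by positivity) h

theorem one_add_sq_le_cosh_sq (s : ℝ) : 1 + s ^ 2 ≤ Real.cosh s ^ 2 := by
  rw [Real.cosh_sq]
  have h : |s| ≤ |Real.sinh s| := by
    rw [Real.abs_sinh]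
    exact Real.self_le_sinh_iff.2 (abs_nonneg s)
  have := sq_le_sq.2 h
  linarith

theorem integrable_cosh_mul_exp {a : ℝ} (ha : 0 < a) :
    Integrable fun s : ℝ => Real.cosh s * Real.exp (-(a * Real.cosh s)) := by
  refine (integrable_inv_one_add_sq.const_mul (6 / a ^ 3)).mono'
    (by fun_prop) (Eventually.of_forall fun s => ?_)
  have hc := Real.cosh_pos s
  rw [Real.norm_of_nonneg (by positivity)]
  -- The third power leaves `cosh⁻²` after the factor `cosh`, which `1/(1 + s²)` dominates.
  have h := exp_neg_le_inv_pow (mul_pos ha hc) 3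
  calc _ ≤ Real.cosh s * (((3 : ℕ).factorial : ℝ) / (a * Real.cosh s) ^ 3) := by gcongr
    _ = 6 / a ^ 3 * (Real.cosh s ^ 2)⁻¹ := by
        simp only [Nat.factorial]
        push_cast
        field_simp
    _ ≤ _ := by
        gcongr
        exact one_add_sq_le_cosh_sq s

theorem integrable_exp_neg_cosh {a : ℝ} (ha : 0 < a) :
    Integrable fun s : ℝ => Real.exp (-(a * Real.cosh s)) := by
  refine (integrable_cosh_mul_exp ha).mono' (by fun_prop) (Eventually.of_forall fun s => ?_)
  rw [Real.norm_of_nonneg (by positivity)]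
  exact le_mul_of_one_le_left (by positivity) (Real.one_le_cosh s)

/-- The integrand `exp (-y cosh (s - iα))` of the shifted contour integral. -/
def shiftedExp (y α s : ℝ) : ℂ :=
  Complex.exp (-(y * Real.cosh s * Real.cos α) + y * Real.sinh s * Real.sin α * Complex.I)

theorem norm_shiftedExp (y α s : ℝ) :
    ‖shiftedExp y α s‖ = Real.exp (-(y * Real.cos α * Real.cosh s)) := by
  have h : -((y : ℂ) * Real.cosh s * Real.cos α) + y * Real.sinh s * Real.sin α * Complex.I
      = ((-(y * Real.cos α * Real.cosh s) : ℝ) : ℂ)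
        + ((y * Real.sinh s * Real.sin α : ℝ) : ℂ) * Complex.I := by push_cast; ring
  rw [shiftedExp, h, Complex.norm_exp, Complex.add_re, Complex.re_ofReal_mul, Complex.I_re,
    Complex.ofReal_re, mul_zero, add_zero]

theorem continuous_shiftedExp (y α : ℝ) : Continuous (shiftedExp y α) := by
  unfold shiftedExp
  fun_prop

theorem hasDerivAt_shiftedExp_angle (y α s : ℝ) : HasDerivAt (fun α => shiftedExp y α s)
    (shiftedExp y α s * (y * Real.cosh s * Real.sin α + y * Real.sinh s * Real.cos α * Complex.I)) α := by
  have h1 := ((Real.hasDerivAt_cos α).ofReal_comp.const_mul ((y : ℂ) * Real.cosh s)).neg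
  have h2 := ((Real.hasDerivAt_sin α).ofReal_comp.const_mul ((y : ℂ) * Real.sinh s)).mul_const Complex.I
  refine ((h1.add h2).cexp).congr_deriv ?_
  simp only [shiftedExp, Pi.add_apply, Pi.neg_apply]
  push_cast
  ring

theorem hasDerivAt_shiftedExp (y α s : ℝ) : HasDerivAt (shiftedExp y α)
    (Complex.I * (shiftedExp y α s *
      (y * Real.cosh s * Real.sin α + y * Real.sinh s * Real.cos α * Complex.I))) s := by
  have h1 := (((Real.hasDerivAt_cosh s).ofReal_comp.const_mul (y : ℂ)).mul_const (Real.cos α : ℂ)).neg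
  have h2 := (((Real.hasDerivAt_sinh s).ofReal_comp.const_mul (y : ℂ)).mul_const (Real.sin α : ℂ)).mul_const Complex.I
  refine ((h1.add h2).cexp).congr_deriv ?_
  simp only [shiftedExp, Pi.add_apply, Pi.neg_apply]
  push_cast
  linear_combination (-(Complex.exp (-((y : ℂ) * Complex.cosh s * Complex.cos α)
    + y * Complex.sinh s * Complex.sin α * Complex.I)) * y * Complex.sinh s * Complex.cos α)
    * Complex.I_sq

theorem norm_deriv_shiftedExp_le {y c α s : ℝ} (hy : 0 < y) (hc : c ≤ Real.cos α) :
    ‖shiftedExp y α s * (y * Real.cosh s * Real.sin α + y * Real.sinh s * Real.cos α * Complex.I)‖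
      ≤ 2 * y * (Real.cosh s * Real.exp (-(y * c * Real.cosh s))) := by
  have hcosh := Real.cosh_pos s
  have hsinh : |Real.sinh s| ≤ Real.cosh s := by
    rw [abs_le]
    constructor
    · have := Real.sinh_lt_cosh (-s)
      rw [Real.sinh_neg, Real.cosh_neg] at this
      linarith
    · exact (Real.sinh_lt_cosh s).le
  have h1 : ‖(y : ℂ) * Real.cosh s * Real.sin α + y * Real.sinh s * Real.cos α * Complex.I‖
      ≤ 2 * y * Real.cosh s := by
    refine (norm_add_le _ _).trans ?_
    simp only [norm_mul, Complex.norm_real, Complex.norm_I, mul_one, Real.norm_eq_abs,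
      abs_of_pos hy, abs_of_pos hcosh]
    have hs1 := Real.abs_sin_le_one α
    have hc1 := Real.abs_cos_le_one α
    have := mul_le_mul_of_nonneg_left hs1 (mul_pos hy hcosh).le
    have h2 := mul_le_mul hsinh hc1 (abs_nonneg _) hcosh.le
    have h3 := mul_le_mul_of_nonneg_left h2 hy.le
    nlinarith
  rw [norm_mul, norm_shiftedExp]
  calc _ ≤ Real.exp (-(y * c * Real.cosh s)) * (2 * y * Real.cosh s) := by
        gcongr
    _ = _ := by ring

theorem integrable_shiftedExp {y α : ℝ} (hy : 0 < y) (hα : 0 < Real.cos α) :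
    Integrable (shiftedExp y α) := by
  refine (integrable_exp_neg_cosh (mul_pos hy hα)).mono'
    (continuous_shiftedExp y α).aestronglyMeasurable (Eventually.of_forall fun s => ?_)
  rw [norm_shiftedExp]

/-- This replaces a contour shift. The integrand is holomorphic in `s - iα`, so its `α`-derivative
is a constant times its `s`-derivative, and an integrable function has a derivative of integral
zero. -/
theorem hasDerivAt_integral_shiftedExp {y α₀ : ℝ} (hy : 0 < y) (hα : 0 < Real.cos α₀) :
    HasDerivAt (fun α => ∫ s, shiftedExp y α s) 0 α₀ := by
  set c := Real.cos α₀ / 2 with hc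
  have hc0 : 0 < c := by positivity
  have hs : {α | c < Real.cos α} ∈ 𝓝 α₀ :=
    (isOpen_lt continuous_const Real.continuous_cos).mem_nhds (by
      show c < Real.cos α₀; linarith)
  have hF'c : Continuous fun s : ℝ => shiftedExp y α₀ s *
      (y * Real.cosh s * Real.sin α₀ + y * Real.sinh s * Real.cos α₀ * Complex.I) := by
    have := continuous_shiftedExp y α₀
    fun_prop
  have key := hasDerivAt_integral_of_dominated_loc_of_deriv_le (μ := volume)
    (F := fun α s => shiftedExp y α s) (x₀ := α₀)
    (F' := fun α s => shiftedExp y α s *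
      (y * Real.cosh s * Real.sin α + y * Real.sinh s * Real.cos α * Complex.I))
    (bound := fun s => 2 * y * (Real.cosh s * Real.exp (-(y * c * Real.cosh s)))) hs
    (Eventually.of_forall fun α => (continuous_shiftedExp y α).aestronglyMeasurable)
    (integrable_shiftedExp hy hα) hF'c.aestronglyMeasurable
    (Eventually.of_forall fun s α hα => norm_deriv_shiftedExp_le hy (le_of_lt hα))
    ((integrable_cosh_mul_exp (mul_pos hy hc0)).const_mul _)
    (Eventually.of_forall fun s α _ => hasDerivAt_shiftedExp_angle y α s)
  have hzero := integral_eq_zero_of_hasDerivAt_of_integrable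
    (fun s => hasDerivAt_shiftedExp y α₀ s) (key.1.const_mul Complex.I) (integrable_shiftedExp hy hα)
  rw [integral_const_mul, mul_eq_zero, or_iff_right Complex.I_ne_zero] at hzero
  exact hzero ▸ key.2

theorem integral_shiftedExp {y α : ℝ} (hy : 0 < y) (hα : |α| < Real.pi / 2) :
    ∫ s, shiftedExp y α s = ∫ s, shiftedExp y 0 s := by
  have h := Convex.norm_image_sub_le_of_norm_hasDerivWithin_le (C := 0) (x := 0) (y := α)
    (f := fun α => ∫ s, shiftedExp y α s) (f' := fun _ => 0)
    (s := Ioo (-(Real.pi / 2)) (Real.pi / 2))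
    (fun x hx => (hasDerivAt_integral_shiftedExp hy (Real.cos_pos_of_mem_Ioo hx)).hasDerivWithinAt)
    (fun _ _ => by simp) (convex_Ioo _ _) (by constructor <;> linarith [Real.pi_pos]) (abs_lt.1 hα)
  rw [zero_mul, norm_le_zero_iff, sub_eq_zero] at h
  exact h

/-- The Macdonald function `K₀(y) = ∫₀^∞ exp (-y cosh s) ds`. -/
def macdonald (y : ℝ) : ℝ := ∫ s in Ioi (0 : ℝ), Real.exp (-(y * Real.cosh s))

theorem integral_shiftedExp_zero (y : ℝ) : ∫ s, shiftedExp y 0 s = ((2 * macdonald y : ℝ) : ℂ) := by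
  have h := integral_comp_abs (f := fun s => Real.exp (-(y * Real.cosh s)))
  simp only [Real.cosh_abs] at h
  rw [macdonald, ← h, ← integral_complex_ofReal]
  refine integral_congr_ae (Eventually.of_forall fun s => ?_)
  simp [shiftedExp]

theorem macdonald_nonneg (y : ℝ) : 0 ≤ macdonald y :=
  integral_nonneg fun _ => (Real.exp_pos _).le

theorem macdonald_le {y : ℝ} (hy : 0 < y) : macdonald y ≤ 2 * Real.pi / y ^ 2 := by
  have h1 : macdonald y ≤ ∫ s : ℝ, Real.exp (-(y * Real.cosh s)) :=
    setIntegral_le_integral (integrable_exp_neg_cosh hy)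
      (Eventually.of_forall fun _ => (Real.exp_pos _).le)
  have h2 : ∫ s : ℝ, Real.exp (-(y * Real.cosh s)) ≤ ∫ s : ℝ, 2 / y ^ 2 * (1 + s ^ 2)⁻¹ := by
    refine integral_mono (integrable_exp_neg_cosh hy) (integrable_inv_one_add_sq.const_mul _)
      fun s => ?_
    have hc := Real.cosh_pos s
    have h := exp_neg_le_inv_pow (mul_pos hy hc) 2
    calc _ ≤ (((2 : ℕ).factorial : ℝ) / (y * Real.cosh s) ^ 2) := h
      _ = 2 / y ^ 2 * (Real.cosh s ^ 2)⁻¹ := by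
          simp only [Nat.factorial]
          push_cast
          field_simp
      _ ≤ _ := by
          gcongr
          exact one_add_sq_le_cosh_sq s
  rw [integral_const_mul, integral_univ_inv_one_add_sq] at h2
  calc _ ≤ _ := h1.trans h2
    _ = _ := by ring

/-- Euclidean length. -/
def rho (x z : ℝ) : ℝ := Real.sqrt (x ^ 2 + z ^ 2)

theorem abs_fst_le_rho (x z : ℝ) : |x| ≤ rho x z := Real.abs_le_sqrt (by nlinarith [sq_nonneg z])

theorem abs_snd_le_rho (x z : ℝ) : |z| ≤ rho x z := Real.abs_le_sqrt (by nlinarith [sq_nonneg x])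

theorem rho_pos (x : ℝ) {z : ℝ} (hz : z ≠ 0) : 0 < rho x z :=
  (abs_pos.2 hz).trans_le (abs_snd_le_rho x z)

theorem exists_angle (x : ℝ) {z : ℝ} (hz : z ≠ 0) :
    ∃ α : ℝ, |α| < Real.pi / 2 ∧ rho x z * Real.cos α = |z| ∧ rho x z * Real.sin α = x := by
  set w : ℂ := ⟨|z|, x⟩ with hw
  have hn : ‖w‖ = rho x z := by
    rw [Complex.norm_eq_sqrt_sq_add_sq, rho]
    congr 1
    simp only [hw, sq_abs]
    ring
  refine ⟨Complex.arg w, ?_, ?_, ?_⟩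
  · rw [Complex.abs_arg_lt_pi_div_two_iff]
    left; exact abs_pos.2 hz
  · rw [← hn, Complex.norm_mul_cos_arg]
  · rw [← hn, Complex.norm_mul_sin_arg]

/-- The profile `exp (-|z| √(ξ² + κ²)) / √(ξ² + κ²)` of the kernel at the energy `-κ²`. -/
def evanescent (κ z ξ : ℝ) : ℝ :=
  Real.exp (-(|z| * Real.sqrt (ξ ^ 2 + κ ^ 2))) / Real.sqrt (ξ ^ 2 + κ ^ 2)

/-- The substitution `ξ = κ sinh s` turns the root into `κ cosh s`, which cancels against `dξ`. In
polar form `|z| + ix = ρ exp (iα)` the exponent becomes `-κρ cosh (s - iα)`, and the shift by `α`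
does not change the integral. -/
theorem integral_exp_mul_evanescent {κ : ℝ} (hκ : 0 < κ) (x : ℝ) {z : ℝ} (hz : z ≠ 0) :
    ∫ ξ : ℝ, Complex.exp ((ξ * x : ℝ) * Complex.I) * (evanescent κ z ξ : ℂ)
      = ((2 * macdonald (κ * rho x z) : ℝ) : ℂ) := by
  obtain ⟨α, hα, hcos, hsin⟩ := exists_angle x hz
  rw [← integral_shiftedExp_zero, ← integral_shiftedExp (mul_pos hκ (rho_pos x hz)) hα]
  have himage : (fun s => κ * Real.sinh s) '' univ = univ := by
    rw [image_univ, range_eq_univ]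
    intro t
    obtain ⟨s, hs⟩ := Real.sinh_surjective (t / κ)
    exact ⟨s, by simp only [hs]; field_simp⟩
  have hinj : InjOn (fun s => κ * Real.sinh s) univ := fun a _ b _ hab =>
    Real.sinh_injective (mul_left_cancel₀ hκ.ne' hab)
  have h := integral_image_eq_integral_abs_deriv_smul (s := univ) (f := fun s => κ * Real.sinh s)
    (f' := fun s => κ * Real.cosh s) MeasurableSet.univ
    (fun s _ => ((Real.hasDerivAt_sinh s).const_mul κ).hasDerivWithinAt) hinj
    (fun ξ : ℝ => Complex.exp ((ξ * x : ℝ) * Complex.I) * (evanescent κ z ξ : ℂ))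
  rw [himage, setIntegral_univ, setIntegral_univ] at h
  rw [h]
  refine integral_congr_ae (Eventually.of_forall fun s => ?_)
  have hcosh := Real.cosh_pos s
  have hsq : Real.sqrt ((κ * Real.sinh s) ^ 2 + κ ^ 2) = κ * Real.cosh s := by
    rw [Real.sqrt_eq_iff_mul_self_eq (by positivity) (by positivity)]
    nlinarith [Real.cosh_sq s]
  have hpos : 0 < κ * Real.cosh s := by positivity
  have h1 : -((κ * rho x z : ℝ) * (Real.cosh s : ℂ) * Real.cos α)
      + (κ * rho x z : ℝ) * Real.sinh s * Real.sin α * Complex.I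
      = ((κ * Real.sinh s * x : ℝ) : ℂ) * Complex.I + ((-(|z| * (κ * Real.cosh s)) : ℝ) : ℂ) := by
    have hcos' : (rho x z : ℂ) * (Real.cos α : ℂ) = (|z| : ℝ) := by exact_mod_cast hcos
    have hsin' : (rho x z : ℂ) * (Real.sin α : ℂ) = (x : ℝ) := by exact_mod_cast hsin
    simp only [Complex.ofReal_mul, Complex.ofReal_neg]
    linear_combination (-((κ : ℂ) * (Real.cosh s : ℂ))) * hcos'
      + (κ : ℂ) * (Real.sinh s : ℂ) * Complex.I * hsin'
  simp only [evanescent, hsq, abs_of_pos hpos, shiftedExp]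
  rw [h1, Complex.exp_add, Complex.real_smul, ← Complex.ofReal_exp]
  have hne : ((κ * Real.cosh s : ℝ) : ℂ) ≠ 0 := Complex.ofReal_ne_zero.2 hpos.ne'
  rw [Complex.ofReal_div]
  field_simp

/-- Substitute `u = y (cosh s - 1)`: then `u (1 + u/(2y)) = (y sinh s)² / (2y)`, and the root
cancels the Jacobian `y sinh s`. -/
theorem hankelInt_mul_I {y : ℝ} (hy : 0 < y) : hankelInt (Complex.I * y)
    = ((Real.sqrt (2 * y) * Real.exp y * macdonald y : ℝ) : ℂ) := by
  have h1 : hankelInt (Complex.I * y) = ((∫ u in Ioi (0 : ℝ), Real.exp (-u) * u ^ (-(1 / 2) : ℝ)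
      * (1 + u / (2 * y)) ^ (-(1 / 2) : ℝ) : ℝ) : ℂ) := by
    rw [← integral_complex_ofReal]
    refine setIntegral_congr_fun measurableSet_Ioi fun u hu => ?_
    have hu' : 0 < u := hu
    have h2 : 1 + Complex.I * u / (2 * (Complex.I * y)) = ((1 + u / (2 * y) : ℝ) : ℂ) := by
      have hI := Complex.I_ne_zero
      have hy' : (y : ℂ) ≠ 0 := Complex.ofReal_ne_zero.2 hy.ne'
      push_cast
      field_simp
    simp only [h2]
    rw [Complex.ofReal_mul _ ((1 + u / (2 * y)) ^ (-(1 / 2) : ℝ)),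
      Complex.ofReal_cpow (by positivity)]
    push_cast
    rfl
  rw [h1]
  congr 1
  have himage : (fun s => y * (Real.cosh s - 1)) '' Ioi 0 = Ioi 0 := by
    ext u
    constructor
    · rintro ⟨s, hs, rfl⟩
      exact mul_pos hy (sub_pos.2 (Real.one_lt_cosh.2 (ne_of_gt hs)))
    · intro hu
      have hu' : 0 < u / y := div_pos hu hy
      refine ⟨Real.arcosh (u / y + 1), ?_, ?_⟩
      · exact Real.arcosh_pos (by linarith)
      · simp only [Real.cosh_arcosh (show 1 ≤ u / y + 1 by linarith)]
        field_simp
        ring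
  have hinj : InjOn (fun s => y * (Real.cosh s - 1)) (Ioi 0) := fun a ha b hb hab =>
    Real.cosh_strictMonoOn.injOn (mem_Ici.2 (le_of_lt ha)) (mem_Ici.2 (le_of_lt hb))
      (by have := mul_left_cancel₀ hy.ne' hab; linarith)
  have h := integral_image_eq_integral_abs_deriv_smul (s := Ioi 0)
    (f := fun s => y * (Real.cosh s - 1)) (f' := fun s => y * Real.sinh s) measurableSet_Ioi
    (fun s _ => (((Real.hasDerivAt_cosh s).sub_const 1).const_mul y).hasDerivWithinAt) hinj
    (fun u => Real.exp (-u) * u ^ (-(1 / 2) : ℝ) * (1 + u / (2 * y)) ^ (-(1 / 2) : ℝ))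
  rw [himage] at h
  rw [h, macdonald, ← integral_const_mul]
  refine setIntegral_congr_fun measurableSet_Ioi fun s hs => ?_
  have hs' : 0 < s := hs
  have hsinh : 0 < Real.sinh s := Real.sinh_pos_iff.2 hs'
  have hc1 : 0 < Real.cosh s - 1 := sub_pos.2 (Real.one_lt_cosh.2 hs'.ne')
  have h2 : (y * (Real.cosh s - 1)) ^ (-(1 / 2) : ℝ)
      * (1 + y * (Real.cosh s - 1) / (2 * y)) ^ (-(1 / 2) : ℝ)
      = Real.sqrt (2 * y) / (y * Real.sinh s) := by
    rw [← Real.mul_rpow (by positivity) (by positivity)]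
    have h3 : y * (Real.cosh s - 1) * (1 + y * (Real.cosh s - 1) / (2 * y))
        = (y * Real.sinh s) ^ 2 / (2 * y) := by
      field_simp
      nlinarith [Real.cosh_sq s]
    rw [h3, Real.rpow_neg (by positivity), ← Real.sqrt_eq_rpow, Real.sqrt_div (by positivity),
      Real.sqrt_sq (by positivity), inv_div]
  have h4 : -(y * (Real.cosh s - 1)) = y + -(y * Real.cosh s) := by ring
  simp only [smul_eq_mul, abs_of_pos (mul_pos hy hsinh)]
  rw [mul_assoc (Real.exp _), h2, h4, Real.exp_add]
  field_simp

/-- The classical relation of `H₀⁽¹⁾(iy)` to `K₀(y)`. The phase `-i` is the product of two factors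
`exp (-iπ/4)`, one from the constant and one from `(iy)^(-1/2)`. -/
theorem hankelC_mul_I {y : ℝ} (hy : 0 < y) :
    hankelC (Complex.I * y) = -(2 * Complex.I / Real.pi) * macdonald y := by
  have h1 : (Complex.I * y) ^ (-(1 / 2) : ℂ)
      = Complex.exp (-(Complex.I * (Real.pi / 4))) * ((Real.sqrt y)⁻¹ : ℝ) := by
    have hlog : Complex.log (Complex.I * y) = Real.log y + Real.pi / 2 * Complex.I := by
      rw [mul_comm, Complex.log_ofReal_mul hy Complex.I_ne_zero, Complex.log_I]
    rw [Complex.cpow_def_of_ne_zero (mul_ne_zero Complex.I_ne_zero (Complex.ofReal_ne_zero.2 hy.ne')),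
      hlog, Real.sqrt_eq_rpow, ← Real.rpow_neg hy.le, Real.rpow_def_of_pos hy, Complex.ofReal_exp,
      ← Complex.exp_add]
    congr 1
    push_cast
    ring
  have h2 : Complex.exp (-(Complex.I * (Real.pi / 4))) * Complex.exp (-(Complex.I * (Real.pi / 4)))
      = -Complex.I := by
    rw [← Complex.exp_add]
    have : -(Complex.I * ((Real.pi : ℂ) / 4)) + -(Complex.I * (Real.pi / 4))
        = -((Real.pi : ℂ) / 2 * Complex.I) := by ring
    rw [this, Complex.exp_neg, Complex.exp_pi_div_two_mul_I, Complex.inv_I]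
  have h3 : Complex.exp (Complex.I * (Complex.I * y)) = ((Real.exp (-y) : ℝ) : ℂ) := by
    rw [← mul_assoc, Complex.I_mul_I, Complex.ofReal_exp]
    congr 1
    push_cast; ring
  have h4 : Real.sqrt 2 * Real.exp (-y) * (Real.sqrt y)⁻¹ * (Real.sqrt (2 * y) * Real.exp y) = 2 := by
    rw [Real.sqrt_mul (by norm_num), Real.exp_neg]
    have := Real.sqrt_pos.2 hy
    have h5 : Real.sqrt 2 ^ 2 = 2 := Real.sq_sqrt (by norm_num)
    field_simp
    exact h5
  have h4' := congrArg (fun t : ℝ => (t : ℂ)) h4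
  simp only [Complex.ofReal_mul] at h4'
  rw [hankelC, hankelAmp, hankelConst, h1, h3, hankelInt_mul_I hy]
  simp only [Complex.ofReal_mul, Complex.ofReal_div] at h4' ⊢
  calc _ = (Complex.exp (-(Complex.I * (Real.pi / 4))) * Complex.exp (-(Complex.I * (Real.pi / 4))))
        * (((Real.sqrt 2 : ℝ) : ℂ) * (Real.exp (-y) : ℝ) * ((Real.sqrt y)⁻¹ : ℝ)
          * ((Real.sqrt (2 * y) : ℝ) * (Real.exp y : ℝ))) / Real.pi * macdonald y := by ring
    _ = _ := by
      rw [h2, h4']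
      push_cast
      ring

end

end SiegertStates

namespace SiegertStates

noncomputable section

/-! ### Poisson summation on the imaginary axis -/

open scoped FourierTransform

theorem continuous_evanescent {κ : ℝ} (hκ : 0 < κ) (z : ℝ) : Continuous (evanescent κ z) := by
  unfold evanescent
  refine Continuous.div (by fun_prop) (by fun_prop) fun ξ => ?_
  exact (Real.sqrt_pos.2 (by positivity)).ne'

theorem evanescent_pos {κ : ℝ} (hκ : 0 < κ) (z ξ : ℝ) : 0 < evanescent κ z ξ :=
  div_pos (Real.exp_pos _) (Real.sqrt_pos.2 (by positivity))

theorem evanescent_le {κ z ξ : ℝ} (hz : z ≠ 0) (hξ : ξ ≠ 0) :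
    evanescent κ z ξ ≤ 1 / |z| * (ξ ^ 2)⁻¹ := by
  have hz' : 0 < |z| := abs_pos.2 hz
  have hpos : 0 < ξ ^ 2 + κ ^ 2 := by positivity
  have hr : 0 < Real.sqrt (ξ ^ 2 + κ ^ 2) := Real.sqrt_pos.2 hpos
  have h := exp_neg_le_inv_pow (mul_pos hz' hr) 1
  have hsq : Real.sqrt (ξ ^ 2 + κ ^ 2) ^ 2 = ξ ^ 2 + κ ^ 2 := Real.sq_sqrt hpos.le
  calc evanescent κ z ξ ≤ ((1 : ℕ).factorial : ℝ) / (|z| * Real.sqrt (ξ ^ 2 + κ ^ 2)) ^ 1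
        / Real.sqrt (ξ ^ 2 + κ ^ 2) := by unfold evanescent; gcongr
    _ = 1 / |z| * (Real.sqrt (ξ ^ 2 + κ ^ 2) ^ 2)⁻¹ := by
        simp only [Nat.factorial, pow_one]
        push_cast
        field_simp
    _ ≤ 1 / |z| * (ξ ^ 2)⁻¹ := by
        rw [hsq]
        have : 0 < ξ ^ 2 := by positivity
        gcongr
        nlinarith [sq_nonneg κ]

theorem abs_rpow_neg_two (y : ℝ) : |y| ^ (-2 : ℝ) = (y ^ 2)⁻¹ := by
  rw [Real.rpow_neg (abs_nonneg y), Real.rpow_two, sq_abs]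

/-- The function whose values at the integers are the terms of the kernel at the energy `-κ²`. -/
def poissonFun (kx κ x z y : ℝ) : ℂ :=
  Complex.exp (((kx + 2 * Real.pi * y) * x : ℝ) * Complex.I)
    * (evanescent κ z (kx + 2 * Real.pi * y) : ℂ)

/-- In the variable `ξ = k_x + 2πv` the Fourier character becomes `exp (i k_x w) exp (-iξw)`: it
translates `x` by `w` and produces the Bloch phase. -/
theorem fourier_poissonFun (kx : ℝ) {κ : ℝ} (hκ : 0 < κ) (x : ℝ) {z : ℝ} (hz : z ≠ 0) (w : ℝ) :
    𝓕 (poissonFun kx κ x z) w = (Real.pi : ℂ)⁻¹ *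
      (Complex.exp (Complex.I * kx * w) * macdonald (κ * rho (x - w) z)) := by
  set G : ℝ → ℂ := fun ξ => Complex.exp ((ξ * (x - w) : ℝ) * Complex.I) * (evanescent κ z ξ : ℂ)
    with hG
  have h1 : 𝓕 (poissonFun kx κ x z) w
      = ∫ v : ℝ, Complex.exp (Complex.I * kx * w) * G (kx + 2 * Real.pi * v) := by
    rw [Real.fourier_real_eq_integral_exp_smul]
    refine integral_congr_ae (Eventually.of_forall fun v => ?_)
    simp only [hG, poissonFun, smul_eq_mul, ← mul_assoc, ← Complex.exp_add]
    congr 2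
    push_cast
    ring
  have h2 := Measure.integral_comp_mul_left (fun y => G (kx + y)) (2 * Real.pi)
  have h3 : ∫ y, G (kx + y) = ∫ y, G y := integral_add_left_eq_self G kx
  rw [h1, integral_const_mul, h2, h3, hG, integral_exp_mul_evanescent hκ (x - w) hz,
    abs_of_pos (by positivity), Complex.real_smul]
  push_cast
  field_simp

/-- Poisson summation. Quadratic decay of the function and of its transform suffices; both in fact
decay exponentially. -/
theorem tsum_evanescent_eq (kx : ℝ) {κ : ℝ} (hκ : 0 < κ) (x : ℝ) {z : ℝ} (hz : z ≠ 0) :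
    ∑' m : ℤ, Complex.exp ((waveNumber kx m * x : ℝ) * Complex.I) * (evanescent κ z (waveNumber kx m) : ℂ)
      = (Real.pi : ℂ)⁻¹ *
        ∑' n : ℤ, Complex.exp (Complex.I * kx * n) * macdonald (κ * rho (x - n) z) := by
  have hz' : 0 < |z| := abs_pos.2 hz
  have hc : Continuous (poissonFun kx κ x z) := by
    have := continuous_evanescent hκ z
    unfold poissonFun
    fun_prop
  have hlarge : ∀ c : ℝ, ∀ᶠ y : ℝ in cocompact ℝ, c ≤ |y| := fun c =>
    (tendsto_norm_cocompact_atTop (E := ℝ)).eventually_ge_atTop c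
  have hf : poissonFun kx κ x z =O[cocompact ℝ] (fun y => |y| ^ (-2 : ℝ)) := by
    refine Asymptotics.IsBigO.of_bound (1 / |z|) ?_
    filter_upwards [hlarge (|kx| + 1)] with y hy
    have hy1 : |y| ≤ |kx + 2 * Real.pi * y| := by
      have h1 : |2 * Real.pi * y| = 2 * Real.pi * |y| := by rw [abs_mul, abs_of_pos Real.two_pi_pos]
      have h3 := abs_sub (kx + 2 * Real.pi * y) kx
      rw [add_sub_cancel_left, h1] at h3
      nlinarith [Real.pi_gt_three, abs_nonneg y]
    have hy0 : 0 < |y| := by linarith [abs_nonneg kx]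
    have hξ : kx + 2 * Real.pi * y ≠ 0 := abs_pos.1 (hy0.trans_le hy1)
    rw [abs_rpow_neg_two, Real.norm_of_nonneg (by positivity), poissonFun, norm_mul,
      Complex.norm_exp_ofReal_mul_I, one_mul, Complex.norm_real,
      Real.norm_of_nonneg (evanescent_pos hκ z _).le]
    refine (evanescent_le hz hξ).trans ?_
    have : 0 < y ^ 2 := by rw [← sq_abs]; positivity
    gcongr 1 / |z| * ?_
    exact inv_anti₀ this (sq_le_sq.2 hy1)
  have hFf : 𝓕 (poissonFun kx κ x z) =O[cocompact ℝ] (fun y => |y| ^ (-2 : ℝ)) := by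
    refine Asymptotics.IsBigO.of_bound (8 / κ ^ 2) ?_
    filter_upwards [hlarge (2 * |x| + 1)] with w hw
    have hw0 : 0 < |w| := by linarith [abs_nonneg x]
    have hρ : |w| / 2 ≤ rho (x - w) z := by
      have h1 := abs_fst_le_rho (x - w) z
      have h2 := abs_sub_abs_le_abs_sub w x
      rw [abs_sub_comm] at h2
      linarith
    have hexp : ‖Complex.exp (Complex.I * kx * w)‖ = 1 := by
      rw [show Complex.I * (kx : ℂ) * w = ((kx * w : ℝ) : ℂ) * Complex.I by push_cast; ring,
        Complex.norm_exp_ofReal_mul_I]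
    rw [abs_rpow_neg_two, Real.norm_of_nonneg (by positivity), fourier_poissonFun kx hκ x hz,
      norm_mul, norm_mul, hexp, one_mul, norm_inv, Complex.norm_real,
      Complex.norm_real, Real.norm_of_nonneg Real.pi_pos.le, Real.norm_of_nonneg (macdonald_nonneg _)]
    have hρ0 : 0 < rho (x - w) z := by linarith
    have hπ := Real.pi_pos
    calc _ ≤ Real.pi⁻¹ * (2 * Real.pi / (κ * rho (x - w) z) ^ 2) := by
          gcongr
          exact macdonald_le (mul_pos hκ hρ0)
      _ ≤ Real.pi⁻¹ * (2 * Real.pi / (κ * (|w| / 2)) ^ 2) := by gcongr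
      _ = 8 / κ ^ 2 * (|w| ^ 2)⁻¹ := by field_simp; norm_num
      _ = _ := by rw [sq_abs]
  have h := Real.tsum_eq_tsum_fourier_of_rpow_decay hc one_lt_two hf hFf 0
  simp only [zero_add, fourier_poissonFun kx hκ x hz] at h
  rw [← tsum_mul_left]
  calc _ = ∑' m : ℤ, poissonFun kx κ x z m := by
        refine tsum_congr fun m => ?_
        simp [poissonFun, waveNumber]
    _ = _ := by
        rw [h]
        refine tsum_congr fun n => ?_
        simp

theorem cutSqrt_neg_ofReal {t : ℝ} (ht : 0 < t) :
    cutSqrt (-(t : ℂ)) = Complex.I * Real.sqrt t := by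
  have hne : (-(t : ℂ)) ≠ 0 := neg_ne_zero.2 (Complex.ofReal_ne_zero.2 ht.ne')
  have hre : (-(t : ℂ)).re < 0 := by simpa using ht
  have him := im_cutSqrt_nonneg (mem_slitDown_of_re_ne hre.ne) (Or.inr hre.le)
  have hs := cutSqrt_sq hne
  set s := cutSqrt (-(t : ℂ))
  have hr : ((Real.sqrt t : ℝ) : ℂ) ^ 2 = t := by
    rw [← Complex.ofReal_pow, Real.sq_sqrt ht.le]
  have hfac : (s - Complex.I * Real.sqrt t) * (s + Complex.I * Real.sqrt t) = 0 := by
    linear_combination hs - (((Real.sqrt t : ℝ) : ℂ) ^ 2) * Complex.I_sq + hr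
  rcases mul_eq_zero.1 hfac with h | h
  · exact sub_eq_zero.1 h
  · exfalso
    have h1 : s = -(Complex.I * Real.sqrt t) := eq_neg_of_add_eq_zero_left h
    have h2 : s.im = -Real.sqrt t := by
      rw [h1, Complex.neg_im, mul_comm, Complex.im_ofReal_mul, Complex.I_im, mul_one]
    have := Real.sqrt_pos.2 ht
    linarith

theorem seriesTerm_imag (kx : ℝ) {κ : ℝ} (hκ : 0 < κ) (x z : ℝ) (m : ℤ) :
    seriesTerm kx ((Complex.I * κ) ^ 2) x z m = -Complex.I *
      (Complex.exp ((waveNumber kx m * x : ℝ) * Complex.I) * (evanescent κ z (waveNumber kx m) : ℂ)) := by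
  have hpos : 0 < waveNumber kx m ^ 2 + κ ^ 2 := by positivity
  have hw : (Complex.I * κ) ^ 2 - (waveNumber kx m : ℂ) ^ 2
      = -((waveNumber kx m ^ 2 + κ ^ 2 : ℝ) : ℂ) := by
    rw [mul_pow, Complex.I_sq]; push_cast; ring
  rw [seriesTerm, hw, cutSqrt_neg_ofReal hpos, evanescent]
  set r := Real.sqrt (waveNumber kx m ^ 2 + κ ^ 2) with hr
  have hr0 : (r : ℂ) ≠ 0 := Complex.ofReal_ne_zero.2 (Real.sqrt_pos.2 hpos).ne'
  have h1 : Complex.I * (x * waveNumber kx m + (|z| : ℝ) * (Complex.I * r))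
      = ((waveNumber kx m * x : ℝ) : ℂ) * Complex.I + ((-(|z| * r) : ℝ) : ℂ) := by
    push_cast
    linear_combination (((|z| : ℝ) : ℂ) * r) * Complex.I_sq
  rw [h1, Complex.exp_add, Complex.ofReal_div, Complex.ofReal_exp, ← Complex.inv_I]
  have := Complex.I_ne_zero
  field_simp

/-! ### The lattice sum of Hankel functions -/

/-- The terms of the quasi-periodic sum of Hankel functions. -/
def latticeTerm (kx : ℝ) (ζ : ℂ) (x z : ℝ) (n : ℤ) : ℂ :=
  Complex.exp (Complex.I * kx * n) * hankelC (ζ * rho (x - n) z)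

theorem blochSeries_imag (kx : ℝ) {κ : ℝ} (hκ : 0 < κ) (x : ℝ) {z : ℝ} (hz : z ≠ 0) :
    blochSeries kx ((Complex.I * κ) ^ 2) x z
      = Complex.I * (Complex.I * κ) ^ 2 / 4 * ∑' n : ℤ, latticeTerm kx (Complex.I * κ) x z n := by
  have h1 : ∀ n : ℤ, latticeTerm kx (Complex.I * κ) x z n = -(2 * Complex.I / Real.pi) *
      (Complex.exp (Complex.I * kx * n) * macdonald (κ * rho (x - n) z)) := by
    intro n
    have h2 : Complex.I * (κ : ℂ) * (rho (x - n) z : ℂ)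
        = Complex.I * ((κ * rho (x - n) z : ℝ) : ℂ) := by push_cast; ring
    rw [latticeTerm, h2, hankelC_mul_I (mul_pos hκ (rho_pos _ hz))]
    ring
  simp only [blochSeries, seriesTerm_imag kx hκ, h1, tsum_mul_left, tsum_evanescent_eq kx hκ x hz]
  ring

theorem norm_exp_I_mul_int (kx : ℝ) (n : ℤ) : ‖Complex.exp (Complex.I * kx * n)‖ = 1 := by
  rw [show Complex.I * (kx : ℂ) * n = ((kx * n : ℝ) : ℂ) * Complex.I by push_cast; ring,
    Complex.norm_exp_ofReal_mul_I]

/-- The part of the upper half plane where `Re ζ + Im ζ > 0`. -/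
def upperDomain : Set ℂ := {ζ | 0 < ζ.im} ∩ hankelDomain

theorem isOpen_upperDomain : IsOpen upperDomain :=
  (isOpen_lt continuous_const Complex.continuous_im).inter isOpen_hankelDomain

theorem isPreconnected_upperDomain : IsPreconnected upperDomain := by
  refine (Convex.inter (convex_halfSpace_im_gt 0) ?_).isPreconnected
  have h : IsLinearMap ℝ fun ζ : ℂ => ζ.re + ζ.im :=
    ⟨fun a b => by simp only [Complex.add_re, Complex.add_im]; ring,
      fun c a => by simp only [Complex.real_smul, Complex.re_ofReal_mul, Complex.im_ofReal_mul,
        smul_eq_mul]; ring⟩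
  exact convex_halfSpace_gt h 0

/-- For `Re ζ > 0` the square lies in the upper half plane; otherwise `|Re ζ| < Im ζ` and its real
part is negative. Thus `upperDomain` joins the imaginary axis to the upper side of the positive axis
without crossing a cut. -/
theorem sq_mem_cutPlane (kx : ℝ) {ζ : ℂ} (h : ζ ∈ upperDomain) : ζ ^ 2 ∈ cutPlane kx := by
  have h1 : 0 < ζ.im := h.1
  have h2 : 0 < ζ.re + ζ.im := h.2
  rcases lt_or_ge 0 ζ.re with h3 | h3
  · refine mem_cutPlane_of_im_pos kx ?_
    rw [pow_two, Complex.mul_im]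
    nlinarith
  · refine mem_cutPlane_of_re_neg kx ?_
    rw [pow_two, Complex.mul_re]
    nlinarith

theorem summable_exp_neg_abs {η : ℝ} (hη : 0 < η) : Summable fun n : ℤ => Real.exp (-(η * |(n : ℝ)|)) := by
  have h : Summable fun n : ℕ => Real.exp (-(η * (n : ℝ))) := by
    have := (Real.summable_exp_nat_mul_iff (a := -η)).2 (by linarith)
    refine this.congr fun n => ?_
    ring_nf
  refine Summable.of_nat_of_neg ?_ ?_ <;> simpa using h

/-- Off the real axis the Hankel function decays like `exp (-Im ζ · ρ)` with `ρ ≥ |n| - |x|`, while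
`ρ ≥ |z|` keeps the amplitude bounded. -/
theorem exists_latticeTerm_bound (kx : ℝ) {ζ₀ : ℂ} (h₀ : ζ₀ ∈ upperDomain) (x : ℝ) {z : ℝ}
    (hz : z ≠ 0) : ∃ u : ℤ → ℝ, Summable u ∧ ∀ᶠ ζ in 𝓝 ζ₀, ζ ∈ upperDomain ∧
      ∀ n, ‖latticeTerm kx ζ x z n‖ ≤ u n := by
  have him : 0 < ζ₀.im := h₀.1
  have hn : 0 < ‖ζ₀‖ := norm_pos_iff.2 (ne_zero_of_mem_hankelDomain h₀.2)
  have hz' : 0 < |z| := abs_pos.2 hz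
  set η := ζ₀.im / 2 with hη
  set q := ‖ζ₀‖ / 2 with hq
  have hη0 : 0 < η := by positivity
  have hq0 : 0 < q := by positivity
  refine ⟨fun n => 8 * (q * |z|) ^ (-(1 / 2) : ℝ) * Real.exp (η * |x|) * Real.exp (-(η * |(n : ℝ)|)),
    (summable_exp_neg_abs hη0).mul_left _, ?_⟩
  have e1 : ∀ᶠ ζ : ℂ in 𝓝 ζ₀, η < ζ.im :=
    Complex.continuous_im.continuousAt.eventually_const_lt (by linarith)
  have e2 : ∀ᶠ ζ : ℂ in 𝓝 ζ₀, q < ‖ζ‖ :=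
    (continuous_norm (E := ℂ)).continuousAt.eventually_const_lt (by linarith)
  filter_upwards [e1, e2, isOpen_upperDomain.mem_nhds h₀] with ζ h1 h2 h3
  refine ⟨h3, fun n => ?_⟩
  have hρ := rho_pos (x - n) hz
  rw [latticeTerm, norm_mul, norm_exp_I_mul_int, one_mul]
  refine (norm_hankelC_le (mul_ofReal_mem_hankelDomain h3.2 hρ)).trans ?_
  rw [Complex.im_mul_ofReal, norm_mul, Complex.norm_real, Real.norm_of_nonneg hρ.le]
  have h4 : |(n : ℝ)| - |x| ≤ rho (x - n) z := by
    have := abs_sub_abs_le_abs_sub (n : ℝ) x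
    rw [abs_sub_comm] at this
    exact this.trans (abs_fst_le_rho _ _)
  have h5 : Real.exp (-(ζ.im * rho (x - n) z)) ≤ Real.exp (η * |x|) * Real.exp (-(η * |(n : ℝ)|)) := by
    rw [← Real.exp_add]
    refine Real.exp_le_exp.2 ?_
    have ha := mul_le_mul_of_nonneg_right h1.le hρ.le
    have hb := mul_le_mul_of_nonneg_left h4 hη0.le
    linarith
  have h6 : (‖ζ‖ * rho (x - n) z) ^ (-(1 / 2) : ℝ) ≤ (q * |z|) ^ (-(1 / 2) : ℝ) := by
    refine Real.rpow_le_rpow_of_nonpos (by positivity) ?_ (by norm_num)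
    exact mul_le_mul h2.le (abs_snd_le_rho _ _) hz'.le (norm_nonneg _)
  calc _ ≤ 8 * (Real.exp (η * |x|) * Real.exp (-(η * |(n : ℝ)|))) * (q * |z|) ^ (-(1 / 2) : ℝ) := by
        gcongr
    _ = _ := by ring

theorem summable_latticeTerm (kx : ℝ) {ζ : ℂ} (h : ζ ∈ upperDomain) (x : ℝ) {z : ℝ} (hz : z ≠ 0) :
    Summable (latticeTerm kx ζ x z) := by
  obtain ⟨u, hu, hb⟩ := exists_latticeTerm_bound kx h x hz
  exact Summable.of_norm_bounded hu hb.self_of_nhds.2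

theorem differentiableAt_latticeTerm (kx : ℝ) {ζ : ℂ} (h : ζ ∈ hankelDomain) (x : ℝ) {z : ℝ}
    (hz : z ≠ 0) (n : ℤ) : DifferentiableAt ℂ (fun ζ => latticeTerm kx ζ x z n) ζ := by
  unfold latticeTerm
  refine DifferentiableAt.const_mul ?_ _
  have h1 := differentiableAt_hankelC (mul_ofReal_mem_hankelDomain h (rho_pos (x - n) hz))
  exact DifferentiableAt.comp (f := fun ζ : ℂ => ζ * rho (x - n) z) ζ h1 (by fun_prop)

theorem differentiableOn_tsum_latticeTerm (kx x : ℝ) {z : ℝ} (hz : z ≠ 0) :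
    DifferentiableOn ℂ (fun ζ => ∑' n : ℤ, latticeTerm kx ζ x z n) upperDomain := by
  intro ζ₀ h₀
  obtain ⟨u, hu, hb⟩ := exists_latticeTerm_bound kx h₀ x hz
  obtain ⟨U, hU, hUo, hmem⟩ := eventually_nhds_iff.1 hb
  have hd := Complex.differentiableOn_tsum_of_summable_norm hu
    (fun n ζ hζ => (differentiableAt_latticeTerm kx (hU ζ hζ).1.2 x hz n).differentiableWithinAt)
    hUo (fun n ζ hζ => (hU ζ hζ).2 n)
  exact ((hd ζ₀ hmem).differentiableAt (hUo.mem_nhds hmem)).differentiableWithinAt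

/-- The kernel is the quasi-periodic sum of Hankel functions, off the real axis. -/
theorem blochSeries_eq_tsum_latticeTerm (kx x : ℝ) {z : ℝ} (hz : z ≠ 0) {ζ : ℂ}
    (h : ζ ∈ upperDomain) :
    blochSeries kx (ζ ^ 2) x z = Complex.I * ζ ^ 2 / 4 * ∑' n : ℤ, latticeTerm kx ζ x z n := by
  have hL : AnalyticOnNhd ℂ (fun ζ => blochSeries kx (ζ ^ 2) x z) upperDomain := by
    refine DifferentiableOn.analyticOnNhd (fun ζ hζ => ?_) isOpen_upperDomain
    have h1 := ((analyticOnNhd_blochSeries kx x hz) _ (sq_mem_cutPlane kx hζ)).differentiableAt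
    exact (DifferentiableAt.comp (f := fun ζ : ℂ => ζ ^ 2) ζ h1
      (by fun_prop)).differentiableWithinAt
  have hR : AnalyticOnNhd ℂ (fun ζ => Complex.I * ζ ^ 2 / 4 * ∑' n : ℤ, latticeTerm kx ζ x z n)
      upperDomain :=
    DifferentiableOn.analyticOnNhd (DifferentiableOn.mul (by fun_prop)
      (differentiableOn_tsum_latticeTerm kx x hz)) isOpen_upperDomain
  have hI : Complex.I ∈ upperDomain := by
    refine ⟨?_, ?_⟩
    · show 0 < Complex.I.im; simp
    · show 0 < Complex.I.re + Complex.I.im; simp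
  refine hL.eqOn_of_preconnected_of_frequently_eq hR isPreconnected_upperDomain hI ?_ h
  -- Points of the imaginary axis, where Poisson summation applies, accumulating at `i`.
  have hlim : Tendsto (fun n : ℕ => Complex.I * ((1 + 1 / ((n : ℝ) + 1) : ℝ) : ℂ)) atTop
      (𝓝[≠] Complex.I) := by
    refine tendsto_nhdsWithin_iff.2 ⟨?_, Eventually.of_forall fun n => ?_⟩
    · have h1 := (tendsto_one_div_add_atTop_nhds_zero_nat (𝕜 := ℝ)).const_add 1
      have h2 := ((Complex.continuous_ofReal.tendsto _).comp h1).const_mul Complex.I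
      simpa using h2
    · intro heq
      have h1 := congrArg Complex.im (mem_singleton_iff.1 heq)
      rw [mul_comm, Complex.im_ofReal_mul, Complex.I_im, mul_one] at h1
      have : (0 : ℝ) < 1 / ((n : ℝ) + 1) := by positivity
      linarith
  refine hlim.frequently (Eventually.frequently (Eventually.of_forall fun n => ?_))
  exact blochSeries_imag kx (by positivity) x hz

end

end SiegertStates

namespace SiegertStates

noncomputable section

/-! ### Summation by parts, uniformly down to the real axis -/

theorem rho_neg (x z : ℝ) : rho (-x) z = rho x z := by rw [rho, rho, neg_sq]

theorem hasDerivAt_rho {x z t : ℝ} (h : 0 < rho (t - x) z) :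
    HasDerivAt (fun t => rho (t - x) z) ((t - x) / rho (t - x) z) t := by
  have h0 : (t - x) ^ 2 + z ^ 2 ≠ 0 := by
    intro h0
    rw [rho, h0, Real.sqrt_zero] at h
    exact lt_irrefl _ h
  have h1 : HasDerivAt (fun t : ℝ => (t - x) ^ 2 + z ^ 2) (2 * (t - x)) t := by
    have := (((hasDerivAt_id t).sub_const x).pow 2).add_const (z ^ 2)
    simpa using this
  refine (h1.sqrt h0).congr_deriv ?_
  rw [rho]
  field_simp

/-- The first bound comes from `1 - a/ρ = z² / (ρ (ρ + a))`, where both factors below are at least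
`a`. -/
theorem abs_div_rho_sub_one_le {a L z : ℝ} (ha : 0 < a) (hz : |z| ≤ L) :
    |a / rho a z - 1| ≤ L ^ 2 / a ^ 2 ∧ |a / rho a z| ≤ 1 := by
  have h1 := abs_fst_le_rho a z
  rw [abs_of_pos ha] at h1
  have hρ : 0 < rho a z := ha.trans_le h1
  have hsq : rho a z ^ 2 = a ^ 2 + z ^ 2 := Real.sq_sqrt (by positivity)
  have hz2 : z ^ 2 ≤ L ^ 2 := by
    rw [← sq_abs]; exact pow_le_pow_left₀ (abs_nonneg z) hz 2
  have hle : a / rho a z ≤ 1 := (div_le_one hρ).2 h1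
  have hnn : 0 ≤ a / rho a z := by positivity
  refine ⟨?_, by rwa [abs_of_nonneg hnn]⟩
  rw [abs_of_nonpos (by linarith), neg_sub, le_div_iff₀ (by positivity)]
  have h2 : (1 - a / rho a z) * a ^ 2 ≤ (1 - a / rho a z) * (rho a z * (rho a z + a)) := by
    refine mul_le_mul_of_nonneg_left ?_ (by linarith)
    nlinarith
  refine h2.trans (le_trans (le_of_eq ?_) hz2)
  field_simp
  linarith

/-- The slowly varying factor of the terms of the lattice sum. -/
def slowFactor (ζ : ℂ) (x z t : ℝ) : ℂ :=
  Complex.exp (Complex.I * ζ * ((rho (t - x) z - t : ℝ) : ℂ)) * hankelAmp (ζ * rho (t - x) z)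

/-- Since `ρ` differs from `n` by a bounded amount, all rapid oscillation sits in the power `q^n`
with `q = exp (i (θ + ζ))`. What remains has summable increments, as summation by parts needs. -/
theorem exp_mul_hankelC_eq (θ : ℝ) (ζ : ℂ) (x z : ℝ) (n : ℕ) :
    Complex.exp (Complex.I * θ * n) * hankelC (ζ * rho (n - x) z)
      = hankelConst * (Complex.exp (Complex.I * (θ + ζ)) ^ n * slowFactor ζ x z n) := by
  have h : Complex.exp (Complex.I * (θ + ζ)) ^ n
      * Complex.exp (Complex.I * ζ * ((rho (n - x) z - n : ℝ) : ℂ))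
      = Complex.exp (Complex.I * θ * n) * Complex.exp (Complex.I * (ζ * rho (n - x) z)) := by
    rw [← Complex.exp_nat_mul, ← Complex.exp_add, ← Complex.exp_add]
    congr 1
    push_cast
    ring
  rw [hankelC, slowFactor]
  linear_combination (-(hankelConst * hankelAmp (ζ * rho (n - x) z))) * h

section Bounds

variable {k δ L x z t : ℝ}

theorem add_I_mul_mem_hankelDomain (hk : 0 < k) (hδ : 0 ≤ δ) : (k + Complex.I * δ : ℂ) ∈ hankelDomain := by
  show 0 < (k + Complex.I * δ : ℂ).re + (k + Complex.I * δ : ℂ).im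
  simp; linarith

theorem re_add_I_mul (k δ : ℝ) : (k + Complex.I * δ : ℂ).re = k := by simp

theorem im_add_I_mul (k δ : ℝ) : (k + Complex.I * δ : ℂ).im = δ := by simp

theorem norm_add_I_mul_bounds (hk : 0 < k) (hδ : 0 ≤ δ) (hδk : δ ≤ k) :
    k ≤ ‖(k + Complex.I * δ : ℂ)‖ ∧ ‖(k + Complex.I * δ : ℂ)‖ ≤ 2 * k := by
  constructor
  · have := Complex.abs_re_le_norm (k + Complex.I * δ : ℂ)
    rwa [re_add_I_mul, abs_of_pos hk] at this
  · refine (norm_add_le _ _).trans ?_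
    rw [norm_mul, Complex.norm_I, one_mul, Complex.norm_real, Complex.norm_real,
      Real.norm_of_nonneg hk.le, Real.norm_of_nonneg hδ]
    linarith

theorem half_le_rho (hx : |x| ≤ 1) (ht : 2 ≤ t) : t / 2 ≤ rho (t - x) z ∧ t - 1 ≤ rho (t - x) z := by
  have h1 := abs_fst_le_rho (t - x) z
  have h2 := le_abs_self (t - x)
  have h3 := (abs_le.1 hx).2
  constructor <;> linarith

theorem norm_exp_slow_le (hδ : 0 ≤ δ) (hδ1 : δ ≤ 1) (hx : |x| ≤ 1) (ht : 2 ≤ t) :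
    ‖Complex.exp (Complex.I * (k + Complex.I * δ) * ((rho (t - x) z - t : ℝ) : ℂ))‖ ≤ 3 := by
  have h : (Complex.I * (k + Complex.I * δ) * ((rho (t - x) z - t : ℝ) : ℂ)).re
      = -(δ * (rho (t - x) z - t)) := by
    rw [Complex.re_mul_ofReal]
    simp
  rw [Complex.norm_exp, h]
  -- The exponent is `-δ (ρ - t)` with `ρ - t ≥ -1` and `δ ≤ 1`, so it is at most `1`.
  have h1 := (half_le_rho (z := z) hx ht).2
  calc Real.exp (-(δ * (rho (t - x) z - t))) ≤ Real.exp 1 := by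
        refine Real.exp_le_exp.2 ?_
        nlinarith
    _ ≤ 3 := by linarith [Real.exp_one_lt_d9]

theorem norm_mul_rho_ge (hk : 0 < k) (hδ : 0 ≤ δ) (hδk : δ ≤ k) (hx : |x| ≤ 1) (ht : 2 ≤ t) :
    k / 2 * t ≤ ‖(k + Complex.I * δ : ℂ) * rho (t - x) z‖ := by
  have h1 := (half_le_rho (z := z) hx ht).1
  have hρ : 0 < rho (t - x) z := by linarith
  rw [norm_mul, Complex.norm_real, Real.norm_of_nonneg hρ.le]
  have := mul_le_mul (norm_add_I_mul_bounds hk hδ hδk).1 h1 (by linarith) (norm_nonneg _)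
  linarith

theorem norm_hankelAmp_slow_le (hk : 0 < k) (hδ : 0 ≤ δ) (hδk : δ ≤ k) (hx : |x| ≤ 1) (ht : 2 ≤ t) :
    ‖hankelAmp ((k + Complex.I * δ) * rho (t - x) z)‖
      ≤ 8 * (k / 2) ^ (-(1 / 2) : ℝ) * t ^ (-(1 / 2) : ℝ) := by
  have hρ : 0 < rho (t - x) z := by linarith [(half_le_rho (z := z) hx ht).1]
  refine (norm_hankelAmp_le (mul_ofReal_mem_hankelDomain (add_I_mul_mem_hankelDomain hk hδ) hρ)).trans ?_
  rw [mul_assoc, ← Real.mul_rpow (by positivity) (by linarith)]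
  gcongr 8 * ?_
  exact Real.rpow_le_rpow_of_nonpos (by positivity) (norm_mul_rho_ge hk hδ hδk hx ht) (by norm_num)

theorem norm_slowFactor_le (hk : 0 < k) (hδ : 0 ≤ δ) (hδk : δ ≤ k) (hδ1 : δ ≤ 1) (hx : |x| ≤ 1)
    (ht : 2 ≤ t) : ‖slowFactor (k + Complex.I * δ) x z t‖
      ≤ 24 * (k / 2) ^ (-(1 / 2) : ℝ) * t ^ (-(1 / 2) : ℝ) := by
  rw [slowFactor, norm_mul]
  calc _ ≤ 3 * (8 * (k / 2) ^ (-(1 / 2) : ℝ) * t ^ (-(1 / 2) : ℝ)) := by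
        refine mul_le_mul (norm_exp_slow_le hδ hδ1 hx ht)
          (norm_hankelAmp_slow_le hk hδ hδk hx ht) (norm_nonneg _) (by norm_num)
    _ = _ := by ring

/-- A constant for the derivative of the slowly varying factor. -/
def slowConst (k L : ℝ) : ℝ :=
  3 * (2 * k * (4 * L ^ 2) * (8 * (k / 2) ^ (-(1 / 2) : ℝ)) + 128 * (k / 2) ^ (-(3 / 2) : ℝ) * (2 * k))

/-- Differentiating the phase costs `ρ' - 1 = O(t⁻²)` and differentiating the amplitude gains one
power of `t`, so both contributions are `O(t^(-3/2))`, uniformly in `δ`. -/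
theorem exists_hasDerivAt_slowFactor (hk : 0 < k) (hδ : 0 ≤ δ) (hδk : δ ≤ k) (hδ1 : δ ≤ 1)
    (hx : |x| ≤ 1) (hz : |z| ≤ L) (ht : 2 ≤ t) :
    ∃ d, HasDerivAt (slowFactor (k + Complex.I * δ) x z) d t ∧
      ‖d‖ ≤ slowConst k L * t ^ (-(3 / 2) : ℝ) := by
  set ζ : ℂ := k + Complex.I * δ with hζ
  have hx1 := (abs_le.1 hx).2
  have ha : 0 < t - x := by linarith
  have hhalf := (half_le_rho (z := z) hx ht).1
  have hρ : 0 < rho (t - x) z := by linarith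
  set ρ := rho (t - x) z with hρdef
  set ρ' := (t - x) / ρ with hρ'
  have hd := hasDerivAt_rho hρ
  have hdom := mul_ofReal_mem_hankelDomain (add_I_mul_mem_hankelDomain hk hδ) hρ
  have h1 : HasDerivAt (fun t : ℝ => Complex.exp (Complex.I * ζ * ((rho (t - x) z - t : ℝ) : ℂ)))
      (Complex.exp (Complex.I * ζ * ((ρ - t : ℝ) : ℂ)) * (Complex.I * ζ * ((ρ' - 1 : ℝ) : ℂ))) t :=
    (((hd.sub (hasDerivAt_id t)).ofReal_comp).const_mul (Complex.I * ζ)).cexp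
  have h2 : HasDerivAt (fun t : ℝ => hankelAmp (ζ * rho (t - x) z))
      ((ζ * (ρ' : ℂ)) • deriv hankelAmp (ζ * ρ)) t :=
    have hh : HasDerivAt hankelAmp (deriv hankelAmp (ζ * ρ)) (ζ * ρ) :=
      (differentiableAt_hankelAmp hdom).hasDerivAt
    HasDerivAt.scomp (g₁ := hankelAmp) (h := fun t : ℝ => ζ * (rho (t - x) z : ℂ)) t hh
      ((hd.ofReal_comp).const_mul ζ)
  refine ⟨_, h1.mul h2, ?_⟩
  obtain ⟨hr1, hr2⟩ := abs_div_rho_sub_one_le ha hz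
  have ht0 : 0 < t := by linarith
  have hr1' : |ρ' - 1| ≤ 4 * L ^ 2 / t ^ 2 := by
    refine hr1.trans ?_
    have : t / 2 ≤ t - x := by linarith
    calc L ^ 2 / (t - x) ^ 2 ≤ L ^ 2 / (t / 2) ^ 2 := by gcongr
      _ = _ := by field_simp; norm_num
  have hζn := (norm_add_I_mul_bounds hk hδ hδk).2
  have hexp := norm_exp_slow_le (k := k) (z := z) hδ hδ1 hx ht
  have hamp := norm_hankelAmp_slow_le (z := z) hk hδ hδk hx ht
  have hderiv : ‖deriv hankelAmp (ζ * ρ)‖ ≤ 128 * (k / 2) ^ (-(3 / 2) : ℝ) * t ^ (-(3 / 2) : ℝ) := by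
    refine (norm_deriv_hankelAmp_le (ne_zero_of_mem_hankelDomain hdom) ?_ ?_).trans ?_
    · rw [Complex.re_mul_ofReal, re_add_I_mul]; positivity
    · rw [Complex.im_mul_ofReal, im_add_I_mul]; positivity
    · rw [mul_assoc, ← Real.mul_rpow (by positivity) (by linarith)]
      gcongr 128 * ?_
      exact Real.rpow_le_rpow_of_nonpos (by positivity) (norm_mul_rho_ge hk hδ hδk hx ht) (by norm_num)
  have hA : ‖Complex.exp (Complex.I * ζ * ((ρ - t : ℝ) : ℂ)) * (Complex.I * ζ * ((ρ' - 1 : ℝ) : ℂ))‖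
      ≤ 3 * (2 * k * (4 * L ^ 2 / t ^ 2)) := by
    rw [norm_mul, norm_mul, norm_mul, Complex.norm_I, one_mul, Complex.norm_real, Real.norm_eq_abs]
    gcongr
  have hB : ‖(ζ * (ρ' : ℂ)) • deriv hankelAmp (ζ * ρ)‖
      ≤ 2 * k * 1 * (128 * (k / 2) ^ (-(3 / 2) : ℝ) * t ^ (-(3 / 2) : ℝ)) := by
    rw [norm_smul, norm_mul, Complex.norm_real, Real.norm_eq_abs]
    gcongr
  have ht52 : t ^ (-(1 / 2) : ℝ) / t ^ 2 ≤ t ^ (-(3 / 2) : ℝ) := by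
    rw [← Real.rpow_natCast, ← Real.rpow_sub ht0]
    exact Real.rpow_le_rpow_of_exponent_le (by linarith) (by norm_num)
  refine (norm_add_le _ _).trans ((add_le_add (norm_mul_le _ _) (norm_mul_le _ _)).trans ?_)
  calc _ ≤ 3 * (2 * k * (4 * L ^ 2 / t ^ 2)) * (8 * (k / 2) ^ (-(1 / 2) : ℝ) * t ^ (-(1 / 2) : ℝ))
        + 3 * (2 * k * 1 * (128 * (k / 2) ^ (-(3 / 2) : ℝ) * t ^ (-(3 / 2) : ℝ))) := by
        refine add_le_add (mul_le_mul hA hamp (norm_nonneg _) (by positivity))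
          (mul_le_mul hexp hB (norm_nonneg _) (by norm_num))
    _ = 3 * (2 * k * (4 * L ^ 2) * (8 * (k / 2) ^ (-(1 / 2) : ℝ))) * (t ^ (-(1 / 2) : ℝ) / t ^ 2)
        + 3 * (128 * (k / 2) ^ (-(3 / 2) : ℝ) * (2 * k)) * t ^ (-(3 / 2) : ℝ) := by ring
    _ ≤ 3 * (2 * k * (4 * L ^ 2) * (8 * (k / 2) ^ (-(1 / 2) : ℝ))) * t ^ (-(3 / 2) : ℝ)
        + 3 * (128 * (k / 2) ^ (-(3 / 2) : ℝ) * (2 * k)) * t ^ (-(3 / 2) : ℝ) := by gcongr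
    _ = _ := by rw [slowConst]; ring

theorem norm_slowFactor_sub_le (hk : 0 < k) (hδ : 0 ≤ δ) (hδk : δ ≤ k) (hδ1 : δ ≤ 1)
    (hx : |x| ≤ 1) (hz : |z| ≤ L) {n : ℕ} (hn : 2 ≤ n) :
    ‖slowFactor (k + Complex.I * δ) x z ((n + 1 : ℕ) : ℝ) - slowFactor (k + Complex.I * δ) x z n‖
      ≤ slowConst k L * (n : ℝ) ^ (-(3 / 2) : ℝ) := by
  have hn' : (2 : ℝ) ≤ n := by exact_mod_cast hn
  choose! d hd using fun t (ht : 2 ≤ t) =>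
    exists_hasDerivAt_slowFactor (k := k) (δ := δ) hk hδ hδk hδ1 hx hz ht
  have hS : 0 ≤ slowConst k L := by rw [slowConst]; positivity
  have h := Convex.norm_image_sub_le_of_norm_hasDerivWithin_le
    (f := slowFactor (k + Complex.I * δ) x z) (f' := d) (C := slowConst k L * (n : ℝ) ^ (-(3 / 2) : ℝ))
    (s := Ici (n : ℝ)) (x := n) (y := ((n + 1 : ℕ) : ℝ))
    (fun t ht => (hd t (hn'.trans ht)).1.hasDerivWithinAt)
    (fun t ht => (hd t (hn'.trans ht)).2.trans (by
      gcongr slowConst k L * ?_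
      exact Real.rpow_le_rpow_of_nonpos (by linarith) ht (by norm_num)))
    (convex_Ici _) (by simp) (by simp)
  refine h.trans (le_of_eq ?_)
  push_cast
  simp

end Bounds

theorem one_sub_mul_sum_Ico (q : ℂ) (b : ℕ → ℂ) {N M : ℕ} (h : N ≤ M) :
    (1 - q) * ∑ n ∈ Finset.Ico N M, q ^ n * b n
      = q ^ N * b N - q ^ M * b M + ∑ n ∈ Finset.Ico N M, q ^ (n + 1) * (b (n + 1) - b n) := by
  induction M, h using Nat.le_induction with
  | base => simp
  | succ M hM ih =>
    rw [Finset.sum_Ico_succ_top hM, Finset.sum_Ico_succ_top hM, mul_add, ih]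
    ring

/-- Abel summation: only the two boundary terms and the total variation of `b` count, at the price
of the factor `1/|1 - q|`. -/
theorem norm_sum_Ico_le {q : ℂ} (hq : ‖q‖ ≤ 1) (b : ℕ → ℂ) {N M : ℕ} (h : N ≤ M) {c B : ℝ}
    (hc : 0 < c) (hqc : c ≤ ‖1 - q‖) (hN : ‖b N‖ ≤ B) (hM : ‖b M‖ ≤ B) {v : ℕ → ℝ}
    (hv : ∀ n ∈ Finset.Ico N M, ‖b (n + 1) - b n‖ ≤ v n) :
    ‖∑ n ∈ Finset.Ico N M, q ^ n * b n‖ ≤ (2 * B + ∑ n ∈ Finset.Ico N M, v n) / c := by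
  have hB : 0 ≤ B := (norm_nonneg _).trans hN
  have hpow : ∀ n, ‖q ^ n‖ ≤ 1 := fun n => by
    rw [norm_pow]; exact pow_le_one₀ (norm_nonneg _) hq
  have h1 : ‖(1 - q) * ∑ n ∈ Finset.Ico N M, q ^ n * b n‖ ≤ 2 * B + ∑ n ∈ Finset.Ico N M, v n := by
    rw [one_sub_mul_sum_Ico q b h]
    refine (norm_add_le _ _).trans (add_le_add ((norm_sub_le _ _).trans ?_)
      ((norm_sum_le _ _).trans (Finset.sum_le_sum fun n hn => ?_)))
    · rw [norm_mul, norm_mul]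
      have ha := mul_le_mul (hpow N) hN (norm_nonneg _) zero_le_one
      have hb := mul_le_mul (hpow M) hM (norm_nonneg _) zero_le_one
      linarith
    · rw [norm_mul]
      have := mul_le_mul (hpow (n + 1)) (hv n hn) (norm_nonneg _) zero_le_one
      linarith
  rw [le_div_iff₀ hc, mul_comm]
  refine le_trans ?_ h1
  rw [norm_mul]
  exact mul_le_mul_of_nonneg_right hqc (norm_nonneg _)

theorem exists_tail_le {C D η : ℝ} (hη : 0 < η) :
    ∃ N₀ : ℕ, 2 ≤ N₀ ∧ ∀ N M : ℕ, N₀ ≤ N → N ≤ M →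
      C * (N : ℝ) ^ (-(1 / 2) : ℝ) + ∑ n ∈ Finset.Ico N M, D * (n : ℝ) ^ (-(3 / 2) : ℝ) ≤ η := by
  have h1 : Tendsto (fun N : ℕ => C * (N : ℝ) ^ (-(1 / 2) : ℝ)) atTop (𝓝 0) := by
    have := ((tendsto_rpow_neg_atTop (y := 1 / 2) (by norm_num)).comp
      tendsto_natCast_atTop_atTop).const_mul C
    simpa using this
  have hs : Summable fun n : ℕ => D * (n : ℝ) ^ (-(3 / 2) : ℝ) :=
    (Real.summable_nat_rpow.2 (by norm_num)).mul_left D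
  obtain ⟨s, hs'⟩ := summable_iff_vanishing_norm.1 hs (η / 2) (by positivity)
  have h2 : ∀ᶠ N : ℕ in atTop, C * (N : ℝ) ^ (-(1 / 2) : ℝ) ≤ η / 2 :=
    h1.eventually_le_const (by positivity)
  obtain ⟨N₁, hN₁⟩ := eventually_atTop.1 h2
  refine ⟨max (max N₁ (s.sup id + 1)) 2, le_max_right _ _, fun N M hN _ => ?_⟩
  have hNa : N₁ ≤ N := (le_max_left _ _).trans ((le_max_left _ _).trans hN)
  have hNb : s.sup id + 1 ≤ N := (le_max_right _ _).trans ((le_max_left _ _).trans hN)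
  have hdisj : Disjoint (Finset.Ico N M) s := by
    rw [Finset.disjoint_left]
    intro n hn hns
    have := Finset.le_sup (f := id) hns
    simp only [id, Finset.mem_Ico] at this hn
    omega
  have h3 := (le_abs_self _).trans (hs' _ hdisj).le
  linarith [hN₁ N hNa]

/-- The tails of the lattice sum are small, uniformly down to the real axis. -/
theorem exists_uniform_tail {k : ℝ} (hk : 0 < k) (θ : ℝ) (hres : Complex.exp (Complex.I * (θ + k)) ≠ 1)
    {L : ℝ} : ∃ δ₀ : ℝ, 0 < δ₀ ∧ ∀ η : ℝ, 0 < η → ∃ N₀ : ℕ, 2 ≤ N₀ ∧ ∀ N M : ℕ, N₀ ≤ N → N ≤ M →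
      ∀ δ x z : ℝ, 0 ≤ δ → δ ≤ δ₀ → |x| ≤ 1 → |z| ≤ L →
        ‖∑ n ∈ Finset.Ico N M, Complex.exp (Complex.I * θ * n)
          * hankelC ((k + Complex.I * δ) * rho (n - x) z)‖ ≤ η := by
  set q : ℝ → ℂ := fun δ => Complex.exp (Complex.I * (θ + (k + Complex.I * δ))) with hq
  have hqc : Continuous fun δ => ‖1 - q δ‖ := by fun_prop
  -- Nonresonance makes `c` positive, and by continuity `|1 - q δ|` stays above `c/2` for small `δ`.
  -- The further bounds `k` and `1` in `δ₀` are those under which the slow factor was estimated.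
  set c := ‖1 - q 0‖ with hc
  have hc0 : 0 < c := by
    refine norm_pos_iff.2 (sub_ne_zero.2 (Ne.symm ?_))
    simpa [hq] using hres
  have hev : ∀ᶠ δ in 𝓝 (0 : ℝ), c / 2 < ‖1 - q δ‖ :=
    hqc.continuousAt.eventually_const_lt (by linarith)
  obtain ⟨r, hr, hball⟩ := Metric.eventually_nhds_iff.1 hev
  refine ⟨min (r / 2) (min k 1), by positivity, fun η hη => ?_⟩
  obtain ⟨N₀, hN₀, htail⟩ := exists_tail_le (C := 2 * (24 * (k / 2) ^ (-(1 / 2) : ℝ)))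
    (D := slowConst k L) (η := η * (c / 2)) (by positivity)
  refine ⟨N₀, hN₀, fun N M hN hNM δ x z hδ hδ₀ hx hz => ?_⟩
  have hδr : δ < r := by linarith [hδ₀.trans (min_le_left _ _)]
  have hδk : δ ≤ k := hδ₀.trans ((min_le_right _ _).trans (min_le_left _ _))
  have hδ1 : δ ≤ 1 := hδ₀.trans ((min_le_right _ _).trans (min_le_right _ _))
  simp only [exp_mul_hankelC_eq, ← Finset.mul_sum]
  have hq1 : ‖q δ‖ ≤ 1 := by
    rw [hq, Complex.norm_exp, Real.exp_le_one_iff]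
    simp [hδ]
  have hN2 : 2 ≤ N := hN₀.trans hN
  have hB : ∀ n : ℕ, N ≤ n → ‖slowFactor (k + Complex.I * δ) x z n‖
      ≤ 24 * (k / 2) ^ (-(1 / 2) : ℝ) * (N : ℝ) ^ (-(1 / 2) : ℝ) := by
    intro n hn
    have hn2 : (2 : ℝ) ≤ n := by exact_mod_cast hN2.trans hn
    refine (norm_slowFactor_le hk hδ hδk hδ1 hx hn2).trans ?_
    gcongr _ * ?_
    exact Real.rpow_le_rpow_of_nonpos (by exact_mod_cast (by omega : 0 < N)) (by exact_mod_cast hn)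
      (by norm_num)
  have hsum := norm_sum_Ico_le hq1 (fun n : ℕ => slowFactor (k + Complex.I * δ) x z n) hNM
    (c := c / 2) (by positivity)
    (hball (by rw [Real.dist_eq, sub_zero, abs_of_nonneg hδ]; exact hδr)).le (hB N le_rfl) (hB M hNM)
    (v := fun n => slowConst k L * (n : ℝ) ^ (-(3 / 2) : ℝ))
    (fun n hn => norm_slowFactor_sub_le hk hδ hδk hδ1 hx hz (hN2.trans (Finset.mem_Ico.1 hn).1))
  rw [norm_mul]
  calc _ ≤ 1 * ((2 * (24 * (k / 2) ^ (-(1 / 2) : ℝ) * (N : ℝ) ^ (-(1 / 2) : ℝ))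
        + ∑ n ∈ Finset.Ico N M, slowConst k L * (n : ℝ) ^ (-(3 / 2) : ℝ)) / (c / 2)) :=
        mul_le_mul norm_hankelConst_le hsum (norm_nonneg _) zero_le_one
    _ ≤ η := by
        rw [one_mul, div_le_iff₀ (by positivity)]
        refine le_trans (le_of_eq ?_) (htail N M hN hNM)
        ring

end

end SiegertStates

namespace SiegertStates

noncomputable section

/-! ### The limit onto the real axis -/

/-- A resonance in the first case means `k = -k_{x,-n}`, in the second `k = k_{x,n}`. Either way
`k²` is a threshold, the endpoint `s = 0` of a cut. -/
theorem exp_I_mul_add_ne_one {kx k : ℝ} (h : ((k : ℂ) ^ 2) ∈ cutPlane kx) :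
    Complex.exp (Complex.I * (kx + k)) ≠ 1 ∧
      Complex.exp (Complex.I * ((-kx : ℝ) + k)) ≠ 1 := by
  constructor <;> intro he <;> obtain ⟨n, hn⟩ := Complex.exp_eq_one_iff.1 he
  · refine h (-n) 0 le_rfl ?_
    have h2 : (kx + k : ℂ) = n * (2 * Real.pi) :=
      mul_left_cancel₀ Complex.I_ne_zero (by rw [hn]; ring)
    rw [waveNumber]
    push_cast
    linear_combination (k - kx + 2 * Real.pi * n) * h2
  · refine h n 0 le_rfl ?_
    have h2 : ((-kx : ℝ) + k : ℂ) = n * (2 * Real.pi) :=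
      mul_left_cancel₀ Complex.I_ne_zero (by rw [hn]; ring)
    push_cast at h2
    rw [waveNumber]
    push_cast
    linear_combination (k + kx + 2 * Real.pi * n) * h2

theorem sum_Ico_natCast (g : ℤ → ℂ) (N M : ℕ) :
    ∑ n ∈ Finset.Ico (N : ℤ) M, g n = ∑ j ∈ Finset.Ico N M, g j := by
  refine Finset.sum_nbij' (fun n => n.toNat) (fun j => (j : ℤ)) ?_ ?_ ?_ ?_ ?_
  · intro n hn; simp only [Finset.mem_Ico] at hn ⊢; omega
  · intro n hn; simp only [Finset.mem_Ico] at hn ⊢; omega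
  · intro n hn; simp only [Finset.mem_Ico] at hn ⊢; omega
  · intro n hn; simp
  · intro n hn; simp only [Finset.mem_Ico] at hn ⊢; congr 1; omega

theorem sum_Ico_neg_natCast (g : ℤ → ℂ) (N M : ℕ) :
    ∑ n ∈ Finset.Ico (-(M : ℤ)) (-(N : ℤ)), g n
      = ∑ j ∈ Finset.Ico (N + 1) (M + 1), g (-(j : ℤ)) := by
  refine Finset.sum_nbij' (fun n => (-n).toNat) (fun j => -(j : ℤ)) ?_ ?_ ?_ ?_ ?_
  · intro n hn; simp only [Finset.mem_Ico] at hn ⊢; omega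
  · intro n hn; simp only [Finset.mem_Ico] at hn ⊢; omega
  · intro n hn; simp only [Finset.mem_Ico] at hn ⊢; omega
  · intro n hn; simp
  · intro n hn; simp only [Finset.mem_Ico] at hn ⊢; congr 1; omega

theorem sum_Ico_split (g : ℤ → ℂ) {A B M : ℕ} (hA : A ≤ M) (hB : B ≤ M) :
    ∑ n ∈ Finset.Ico (-(M : ℤ)) M, g n = ∑ n ∈ Finset.Ico (-(A : ℤ)) B, g n
      + (∑ j ∈ Finset.Ico (A + 1) (M + 1), g (-(j : ℤ)) + ∑ j ∈ Finset.Ico B M, g j) := by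
  rw [← sum_Ico_natCast, ← sum_Ico_neg_natCast,
    ← Finset.Ico_union_Ico_eq_Ico (a := -(M : ℤ)) (b := -(A : ℤ)) (c := M) (by omega) (by omega),
    Finset.sum_union (Finset.Ico_disjoint_Ico_consecutive _ _ _),
    ← Finset.Ico_union_Ico_eq_Ico (a := -(A : ℤ)) (b := (B : ℤ)) (c := M) (by omega) (by omega),
    Finset.sum_union (Finset.Ico_disjoint_Ico_consecutive _ _ _)]
  ring

theorem latticeTerm_natCast (kx : ℝ) (ζ : ℂ) (x z : ℝ) (n : ℕ) :
    latticeTerm kx ζ x z n = Complex.exp (Complex.I * kx * n) * hankelC (ζ * rho (n - x) z) := by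
  rw [latticeTerm, ← rho_neg]
  push_cast
  rw [neg_sub]

/-- The left half of the lattice is a right half with `k_x` and `x` reflected, so one tail estimate
serves both directions. -/
theorem latticeTerm_neg_natCast (kx : ℝ) (ζ : ℂ) (x z : ℝ) (n : ℕ) :
    latticeTerm kx ζ x z (-(n : ℤ))
      = Complex.exp (Complex.I * (-kx : ℝ) * n) * hankelC (ζ * rho (n - (-x)) z) := by
  rw [latticeTerm]
  push_cast
  congr 2
  · ring
  · rw [sub_neg_eq_add, sub_neg_eq_add, add_comm]

/-- At a wave number that is not a threshold, the partial sums of the lattice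
sum converge to the series for the kernel, uniformly. -/
theorem exists_norm_sum_latticeTerm_sub_le {kx k : ℝ} (hk : 0 < k) (hE : ((k : ℂ) ^ 2) ∈ cutPlane kx)
    (L : ℝ) {η : ℝ} (hη : 0 < η) : ∃ N₀ : ℕ, ∀ A B : ℕ, N₀ ≤ A → N₀ ≤ B → ∀ x z : ℝ,
      |x| ≤ 1 → z ≠ 0 → |z| ≤ L →
      ‖Complex.I * (k : ℂ) ^ 2 / 4 * ∑ n ∈ Finset.Ico (-(A : ℤ)) B, latticeTerm kx k x z n
        - blochSeries kx ((k : ℂ) ^ 2) x z‖ ≤ η := by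
  obtain ⟨hr1, hr2⟩ := exp_I_mul_add_ne_one hE
  obtain ⟨δ₁, hδ₁, h1⟩ := exists_uniform_tail hk kx hr1 (L := L)
  obtain ⟨δ₂, hδ₂, h2⟩ := exists_uniform_tail hk (-kx) hr2 (L := L)
  -- There are two tails of size `τ`, and `|ζ²/4| ≤ k²` because `|ζ| ≤ 2k`.
  set τ := η / (2 * k ^ 2) with hτ
  have hτ0 : 0 < τ := by positivity
  obtain ⟨N₁, -, h1⟩ := h1 τ hτ0
  obtain ⟨N₂, -, h2⟩ := h2 τ hτ0
  refine ⟨max N₁ N₂, fun A B hA hB x z hx hz hzL => ?_⟩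
  -- Above the axis the lattice sum converges absolutely and equals the series. The estimate is
  -- uniform in `δ`, and for fixed `A`, `B` only a finite sum and the analytic series remain, so it
  -- survives `δ → 0`.
  have key : ∀ δ : ℝ, 0 < δ → δ ≤ min δ₁ (min δ₂ k) →
      ‖Complex.I * (k + Complex.I * δ : ℂ) ^ 2 / 4
          * ∑ n ∈ Finset.Ico (-(A : ℤ)) B, latticeTerm kx (k + Complex.I * δ) x z n
        - blochSeries kx ((k + Complex.I * δ : ℂ) ^ 2) x z‖ ≤ η := by
    intro δ hδ hδ'
    have hd1 : δ ≤ δ₁ := hδ'.trans (min_le_left _ _)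
    have hd2 : δ ≤ δ₂ := hδ'.trans ((min_le_right _ _).trans (min_le_left _ _))
    have hdk : δ ≤ k := hδ'.trans ((min_le_right _ _).trans (min_le_right _ _))
    have hup : (k + Complex.I * δ : ℂ) ∈ upperDomain :=
      ⟨by show 0 < (k + Complex.I * δ : ℂ).im; rwa [im_add_I_mul],
        add_I_mul_mem_hankelDomain hk hδ.le⟩
    set ζ : ℂ := k + Complex.I * δ with hζ
    have hsum := (summable_latticeTerm kx hup x hz).hasSum
    have hIco : Tendsto (fun M : ℕ => Finset.Ico (-(M : ℤ)) M) atTop atTop := by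
      refine tendsto_atTop_finset_of_monotone ?_ ?_
      · intro a b hab
        exact Finset.Ico_subset_Ico (by omega) (by omega)
      · intro n
        exact ⟨n.natAbs + 1, by simp only [Finset.mem_Ico]; omega⟩
    have hlim := hsum.comp hIco
    have hbd : ‖∑' n, latticeTerm kx ζ x z n - ∑ n ∈ Finset.Ico (-(A : ℤ)) B, latticeTerm kx ζ x z n‖
        ≤ 2 * τ := by
      refine le_of_tendsto (hlim.sub_const _).norm ?_
      filter_upwards [eventually_ge_atTop (max A B)] with M hM
      simp only [Function.comp]
      rw [sum_Ico_split _ ((le_max_left _ _).trans hM) ((le_max_right _ _).trans hM),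
        add_sub_cancel_left]
      simp only [latticeTerm_natCast, latticeTerm_neg_natCast]
      have ha := h2 (A + 1) (M + 1) (by have := le_max_right N₁ N₂; omega)
        (by have := le_max_left A B; omega) δ (-x) z hδ.le hd2 (by rwa [abs_neg]) hzL
      have hb := h1 B M (by have := le_max_left N₁ N₂; omega)
        (by have := le_max_right A B; omega) δ x z hδ.le hd1 hx hzL
      refine (norm_add_le _ _).trans ?_
      linarith
    rw [blochSeries_eq_tsum_latticeTerm kx x hz hup, ← mul_sub, norm_mul, norm_sub_rev]
    have hζn : ‖Complex.I * ζ ^ 2 / 4‖ ≤ k ^ 2 := by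
      rw [norm_div, norm_mul, Complex.norm_I, one_mul, norm_pow]
      have := pow_le_pow_left₀ (norm_nonneg _) (norm_add_I_mul_bounds hk hδ.le hdk).2 2
      rw [← hζ] at this
      norm_num
      linarith
    calc _ ≤ k ^ 2 * (2 * τ) := mul_le_mul hζn hbd (norm_nonneg _) (by positivity)
      _ = η := by rw [hτ]; field_simp
  have hcζ : ContinuousAt (fun δ : ℝ => (k + Complex.I * δ : ℂ)) 0 := by fun_prop
  have h0 : (k + Complex.I * (0 : ℝ) : ℂ) = k := by simp
  have hcL : ∀ n : ℤ, ContinuousAt (fun δ : ℝ => latticeTerm kx (k + Complex.I * δ) x z n) 0 := by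
    intro n
    refine ContinuousAt.comp (g := fun ζ => latticeTerm kx ζ x z n) ?_ hcζ
    rw [h0]
    exact (differentiableAt_latticeTerm kx (ofReal_mem_hankelDomain hk) x hz n).continuousAt
  have hcB : ContinuousAt (fun δ : ℝ => blochSeries kx ((k + Complex.I * δ : ℂ) ^ 2) x z) 0 := by
    refine ContinuousAt.comp (g := fun E => blochSeries kx E x z) ?_ (hcζ.pow 2)
    rw [h0]
    exact (analyticOnNhd_blochSeries kx x hz _ hE).continuousAt
  have hcont : ContinuousAt (fun δ : ℝ => ‖Complex.I * (k + Complex.I * δ : ℂ) ^ 2 / 4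
          * ∑ n ∈ Finset.Ico (-(A : ℤ)) B, latticeTerm kx (k + Complex.I * δ) x z n
        - blochSeries kx ((k + Complex.I * δ : ℂ) ^ 2) x z‖) 0 := by
    refine ContinuousAt.norm (ContinuousAt.sub (ContinuousAt.mul (by fun_prop) ?_) hcB)
    exact tendsto_finsetSum _ fun n _ => hcL n
  have hlim := hcont.tendsto.mono_left (nhdsWithin_le_nhds (s := Ioi 0))
  rw [h0] at hlim
  refine le_of_tendsto hlim ?_
  filter_upwards [Ioc_mem_nhdsGT (show (0 : ℝ) < min δ₁ (min δ₂ k) by positivity)] with δ hδ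
  exact key δ hδ.1 hδ.2

end

end SiegertStates

namespace SiegertStates

noncomputable section

/-! ### Unfolding the integral over a strip -/

theorem ae_fst_ne (c : ℝ) : ∀ᵐ r : ℝ × ℝ, r.1 ≠ c := by
  rw [Measure.volume_eq_prod]
  have h : ∀ᵐ x : ℝ, x ≠ c := by simp [ae_iff]
  exact Measure.quasiMeasurePreserving_fst.ae h

/-- From `ρ² ≥ |x||z|`; it splits the point singularity into a product of square integrable
functions of one variable. -/
theorem rho_rpow_neg_half_le {x z : ℝ} (hx : x ≠ 0) (hz : z ≠ 0) :
    rho x z ^ (-(1 / 2) : ℝ) ≤ |x| ^ (-(1 / 4) : ℝ) * |z| ^ (-(1 / 4) : ℝ) := by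
  have hx' := abs_pos.2 hx
  have hz' := abs_pos.2 hz
  have hρ := rho_pos x hz
  have h1 : rho x z ^ (-(1 / 2) : ℝ) = (rho x z ^ 2) ^ (-(1 / 4) : ℝ) := by
    rw [← Real.rpow_natCast, ← Real.rpow_mul hρ.le]
    norm_num
  have hsq : rho x z ^ 2 = x ^ 2 + z ^ 2 := Real.sq_sqrt (by positivity)
  rw [h1, ← Real.mul_rpow hx'.le hz'.le]
  refine Real.rpow_le_rpow_of_nonpos (by positivity) ?_ (by norm_num)
  rw [hsq, ← sq_abs x, ← sq_abs z]
  nlinarith [sq_nonneg (|x| - |z|), mul_pos hx' hz']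

variable {ε : ℝ × ℝ → ℝ} {kx k zm zp : ℝ}

theorem apply_add_intCast (hper : ∀ x z : ℝ, ε (x + 1, z) = ε (x, z)) (x z : ℝ) (n : ℤ) :
    ε (x + n, z) = ε (x, z) := by
  have h : Function.Periodic (fun x => ε (x, z)) 1 := fun x => hper x z
  simpa using h.int_mul n x

/-- The contribution of the `n`-th period to the integrand, moved to the period `0 ≤ x < 1`. -/
def cellTerm (ε : ℝ × ℝ → ℝ) (kx k : ℝ) (f : ℝ × ℝ → ℂ) (r : ℝ × ℝ) (n : ℤ) (r₀ : ℝ × ℝ) : ℂ :=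
  ((ε r₀ - 1 : ℝ) : ℂ) * (Complex.I * (k : ℂ) ^ 2 / 4 * latticeTerm kx k (r.1 - r₀.1) (r.2 - r₀.2) n)
    * f r₀

/-- Periodicity of `ε` and Bloch's condition for the field leave only the phase `exp (i k_x n)` and
a shifted Hankel function; the constants combine as `(k²/4π) · iπ = ik²/4`. -/
theorem lsIntegrand_add (hk : 0 < k) (hper : ∀ x z : ℝ, ε (x + 1, z) = ε (x, z))
    (f : ℝ × ℝ → ℂ) (r : ℝ × ℝ) (n : ℤ) {r₀ : ℝ × ℝ} (h₀ : r₀.1 ∈ Ico (0 : ℝ) 1) (hne : r₀.2 ≠ r.2) :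
    lsIntegrand ε kx k f r (r₀ + ((n : ℝ), 0)) = cellTerm ε kx k f r n r₀ := by
  obtain ⟨x, z⟩ := r₀
  simp only at h₀ hne
  have hfl : ⌊x⌋ = 0 := Int.floor_eq_zero_iff.2 h₀
  have hρ : 0 < rho (r.1 - x - n) (r.2 - z) := rho_pos _ (sub_ne_zero.2 hne.symm)
  have hh : greenFn k r (x + n, z)
      = Complex.I * Real.pi * hankelC (k * rho (r.1 - x - n) (r.2 - z)) := by
    have h := hankelH0_eq (mul_pos hk hρ)
    rw [greenFn]
    push_cast at h
    rw [← h, rho]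
    simp only [sub_add_eq_sub_sub]
  simp only [lsIntegrand, cellTerm, blochExt, latticeTerm, Prod.mk_add_mk, add_zero,
    apply_add_intCast hper, hh, Int.floor_add_intCast, Int.fract_add_intCast, hfl, zero_add,
    Int.fract_eq_self.2 h₀]
  push_cast
  have hpi : (Real.pi : ℂ) ≠ 0 := by exact_mod_cast Real.pi_ne_zero
  field_simp

theorem lsIntegrand_eq_zero (hsupp : ∀ x z : ℝ, ε (x, z) ≠ 1 → z ∈ Icc zm zp)
    (f : ℝ × ℝ → ℂ) (r : ℝ × ℝ) {r₀ : ℝ × ℝ} (h : r₀.2 ∉ Icc zm zp) : lsIntegrand ε kx k f r r₀ = 0 := by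
  have : ε r₀ = 1 := by
    by_contra hne
    exact h (hsupp r₀.1 r₀.2 hne)
  simp [lsIntegrand, this]

theorem aestronglyMeasurable_latticeTerm (hk : 0 < k) (r : ℝ × ℝ) (n : ℤ) :
    AEStronglyMeasurable (fun r₀ : ℝ × ℝ => latticeTerm kx k (r.1 - r₀.1) (r.2 - r₀.2) n)
      (volume.restrict (rect zm zp)) := by
  have hmem : ∀ᵐ r₀ ∂((volume : Measure (ℝ × ℝ)).restrict (rect zm zp)),
      r₀ ∈ {r₀ : ℝ × ℝ | r₀.2 ≠ r.2} := ae_restrict_of_ae (ae_snd_ne r.2)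
  rw [← Measure.restrict_eq_self_of_ae_mem hmem]
  refine ContinuousOn.aestronglyMeasurable (fun r₀ hr₀ => ?_)
    (measurableSet_singleton r.2 |>.compl.preimage measurable_snd)
  refine ContinuousAt.continuousWithinAt ?_
  unfold latticeTerm
  refine continuousAt_const.mul ?_
  have hρ := rho_pos (r.1 - r₀.1 - n) (sub_ne_zero.2 (Ne.symm hr₀))
  have h := (differentiableAt_hankelC
    (mul_ofReal_mem_hankelDomain (ofReal_mem_hankelDomain hk) hρ)).continuousAt
  refine ContinuousAt.comp (g := hankelC)
    (f := fun r₀ : ℝ × ℝ => (k : ℂ) * rho (r.1 - r₀.1 - n) (r.2 - r₀.2)) h ?_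
  unfold rho
  fun_prop

theorem norm_latticeTerm_le (hk : 0 < k) {x z : ℝ} {n : ℤ} (hx : x - n ≠ 0) (hz : z ≠ 0) :
    ‖latticeTerm kx k x z n‖
      ≤ 8 * k ^ (-(1 / 2) : ℝ) * (|x - n| ^ (-(1 / 4) : ℝ) * |z| ^ (-(1 / 4) : ℝ)) := by
  have hρ := rho_pos (x - n) hz
  rw [latticeTerm, norm_mul, norm_exp_I_mul_int, one_mul]
  refine (norm_hankelC_le (mul_ofReal_mem_hankelDomain (ofReal_mem_hankelDomain hk) hρ)).trans ?_
  rw [← Complex.ofReal_mul, Complex.ofReal_im, neg_zero, Real.exp_zero, mul_one, Complex.norm_real,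
    Real.norm_of_nonneg (by positivity), Real.mul_rpow hk.le hρ.le, mul_assoc]
  gcongr
  exact rho_rpow_neg_half_le hx hz

theorem integrableOn_cellTerm (hk : 0 < k) (hmeas : Measurable ε) (hone : ∀ r, 1 ≤ ε r)
    (hbdd : ∃ M : ℝ, ∀ r, ε r ≤ M) {f : ℝ × ℝ → ℂ} (hf : MemLp f 2 (volume.restrict (rect zm zp)))
    (r : ℝ × ℝ) (n : ℤ) : IntegrableOn (cellTerm ε kx k f r n) (rect zm zp) := by
  obtain ⟨M, hM⟩ := hbdd
  have hM0 : 0 ≤ M := zero_le_one.trans ((hone 0).trans (hM 0))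
  have hw := ((memLp_weight zm zp (r.1 - n) r.2).const_mul
    (M * (‖Complex.I * (k : ℂ) ^ 2 / 4‖ * (8 * k ^ (-(1 / 2) : ℝ)))))
  refine MemLp.integrable_mul (p := 2) (q := 2) (hw.mono' ?_ ?_) hf
  · refine AEStronglyMeasurable.mul ?_ ((aestronglyMeasurable_latticeTerm hk r n).const_mul _)
    exact (Complex.measurable_ofReal.comp (hmeas.sub_const 1)).aestronglyMeasurable
  · filter_upwards [ae_restrict_of_ae (ae_snd_ne r.2), ae_restrict_of_ae (ae_fst_ne (r.1 - n))]
      with r₀ h2 h1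
    rw [norm_mul, norm_mul]
    have h1' : r.1 - r₀.1 - n ≠ 0 := fun h => h1 (by linarith)
    have hl := norm_latticeTerm_le (kx := kx) hk h1' (sub_ne_zero.2 (Ne.symm h2))
    have hcomm : r.1 - n - r₀.1 = r.1 - r₀.1 - n := by ring
    rw [hcomm, mul_assoc M, mul_assoc ‖_‖]
    gcongr
    exact norm_sub_one_le hone hM r₀

theorem measurePreserving_add_fst (n : ℤ) :
    MeasurePreserving (fun r : ℝ × ℝ => r + ((n : ℝ), 0)) :=
  measurePreserving_add_right volume _

theorem Ico_prod_Icc_ae_eq (zm zp : ℝ) :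
    (Ico (0 : ℝ) 1 ×ˢ Icc zm zp : Set (ℝ × ℝ)) =ᵐ[volume] rect zm zp := by
  rw [Measure.volume_eq_prod]
  exact Measure.set_prod_ae_eq Ico_ae_eq_Icc (EventuallyEq.refl _ _)

theorem preimage_cell (n : ℤ) : (fun r : ℝ × ℝ => r + ((n : ℝ), 0)) ⁻¹' (Ico (n : ℝ) (n + 1) ×ˢ univ)
    = Ico (0 : ℝ) 1 ×ˢ univ := by
  ext ⟨x, z⟩
  simp only [mem_preimage, Prod.mk_add_mk, mem_prod, mem_Ico, mem_univ, and_true]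
  constructor <;> rintro ⟨h1, h2⟩ <;> constructor <;> linarith

theorem integrableOn_lsIntegrand_cell (hk : 0 < k) (hmeas : Measurable ε) (hone : ∀ r, 1 ≤ ε r)
    (hbdd : ∃ M : ℝ, ∀ r, ε r ≤ M) (hper : ∀ x z : ℝ, ε (x + 1, z) = ε (x, z))
    (hsupp : ∀ x z : ℝ, ε (x, z) ≠ 1 → z ∈ Icc zm zp) {f : ℝ × ℝ → ℂ}
    (hf : MemLp f 2 (volume.restrict (rect zm zp))) (r : ℝ × ℝ) (n : ℤ) :
    IntegrableOn (lsIntegrand ε kx k f r) (Ico (n : ℝ) (n + 1) ×ˢ univ) := by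
  rw [← (measurePreserving_add_fst n).integrableOn_comp_preimage (measurableEmbedding_addRight _),
    preimage_cell]
  have h1 : IntegrableOn (cellTerm ε kx k f r n) (Ico (0 : ℝ) 1 ×ˢ Icc zm zp) :=
    (integrableOn_cellTerm hk hmeas hone hbdd hf r n).congr_set_ae (Ico_prod_Icc_ae_eq zm zp)
  have hms : MeasurableSet (Ico (0 : ℝ) 1 ×ˢ Icc zm zp) := measurableSet_Ico.prod measurableSet_Icc
  have h2 : IntegrableOn (lsIntegrand ε kx k f r ∘ fun r : ℝ × ℝ => r + ((n : ℝ), 0))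
      (Ico (0 : ℝ) 1 ×ˢ Icc zm zp) := by
    refine Integrable.congr h1 ?_
    filter_upwards [ae_restrict_mem hms, ae_restrict_of_ae (ae_snd_ne r.2)] with r₀ hr₀ hne
    exact (lsIntegrand_add hk hper f r n hr₀.1 hne).symm
  refine h2.of_forall_sdiff_eq_zero (measurableSet_Ico.prod MeasurableSet.univ) ?_
  rintro ⟨x, z⟩ ⟨h3, h4⟩
  refine lsIntegrand_eq_zero hsupp f r fun h5 => h4 ⟨h3.1, ?_⟩
  simpa using h5

/-- The indicator is needed since the strip may end inside a period. -/
theorem setIntegral_lsIntegrand_cell (hk : 0 < k) (hper : ∀ x z : ℝ, ε (x + 1, z) = ε (x, z))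
    (hsupp : ∀ x z : ℝ, ε (x, z) ≠ 1 → z ∈ Icc zm zp) (f : ℝ × ℝ → ℂ) (r : ℝ × ℝ) (n : ℤ)
    {I : Set ℝ} (hI : MeasurableSet I) :
    ∫ r₀ in (I ∩ Ico (n : ℝ) (n + 1)) ×ˢ univ, lsIntegrand ε kx k f r r₀
      = ∫ r₀ in rect zm zp, {r₀ : ℝ × ℝ | r₀.1 + n ∈ I}.indicator (cellTerm ε kx k f r n) r₀ := by
  have hIm : MeasurableSet {r₀ : ℝ × ℝ | r₀.1 + n ∈ I} :=
    hI.preimage (measurable_fst.add_const (n : ℝ))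
  have hms : MeasurableSet (Ico (0 : ℝ) 1 ×ˢ Icc zm zp) := measurableSet_Ico.prod measurableSet_Icc
  have hpre : (fun r : ℝ × ℝ => r + ((n : ℝ), 0)) ⁻¹' ((I ∩ Ico (n : ℝ) (n + 1)) ×ˢ univ)
      = (Ico (0 : ℝ) 1 ×ˢ univ) ∩ {r₀ : ℝ × ℝ | r₀.1 + n ∈ I} := by
    rw [← preimage_cell n]
    ext ⟨x, z⟩
    simp [and_comm]
  rw [← (measurePreserving_add_fst n).setIntegral_preimage_emb (measurableEmbedding_addRight _),
    hpre, ← setIntegral_indicator hIm,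
    setIntegral_eq_of_subset_of_forall_sdiff_eq_zero (measurableSet_Ico.prod MeasurableSet.univ)
      (s := Ico (0 : ℝ) 1 ×ˢ Icc zm zp) (by gcongr; exact subset_univ _),
    ← setIntegral_congr_set (Ico_prod_Icc_ae_eq zm zp)]
  · refine integral_congr_ae ?_
    filter_upwards [ae_restrict_mem hms, ae_restrict_of_ae (ae_snd_ne r.2)] with r₀ hr₀ hne
    classical
    rw [indicator_apply, indicator_apply, lsIntegrand_add hk hper f r n hr₀.1 hne]
  · rintro ⟨x, z⟩ ⟨h3, h4⟩
    classical
    rw [indicator_apply, lsIntegrand_eq_zero hsupp f r fun h5 => h4 ⟨h3.1, by simpa using h5⟩,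
      ite_self]

end

end SiegertStates

namespace SiegertStates

noncomputable section

/-! ### The Lippmann–Schwinger integral -/

variable {ε : ℝ × ℝ → ℝ} {kx k zm zp : ℝ}

/-- The right bound is strict because the strip contains `R₂` whereas the cells are open on the
right. -/
theorem strip_eq_biUnion {R₁ R₂ : ℝ} {N : ℕ} (h₁ : R₁ ≤ N) (h₂ : R₂ < N) :
    (Ioc (-R₁) R₂ ×ˢ univ : Set (ℝ × ℝ))
      = ⋃ n ∈ Finset.Ico (-(N : ℤ)) N, (Ioc (-R₁) R₂ ∩ Ico (n : ℝ) (n + 1)) ×ˢ univ := by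
  ext ⟨x, z⟩
  simp only [mem_prod, mem_univ, and_true, mem_iUnion, exists_prop, mem_inter_iff, Finset.mem_Ico]
  constructor
  · intro h
    refine ⟨⌊x⌋, ⟨Int.le_floor.2 ?_, Int.floor_lt.2 ?_⟩, h, Int.floor_le x, Int.lt_floor_add_one x⟩
    · push_cast; linarith [h.1]
    · push_cast; linarith [h.2]
  · rintro ⟨n, -, h, -⟩
    exact h

theorem integrableOn_lsIntegrand_strip (hk : 0 < k) (hmeas : Measurable ε) (hone : ∀ r, 1 ≤ ε r)
    (hbdd : ∃ M : ℝ, ∀ r, ε r ≤ M) (hper : ∀ x z : ℝ, ε (x + 1, z) = ε (x, z))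
    (hsupp : ∀ x z : ℝ, ε (x, z) ≠ 1 → z ∈ Icc zm zp) {f : ℝ × ℝ → ℂ}
    (hf : MemLp f 2 (volume.restrict (rect zm zp))) (r : ℝ × ℝ) (R₁ R₂ : ℝ) :
    IntegrableOn (lsIntegrand ε kx k f r) (Ioc (-R₁) R₂ ×ˢ univ) := by
  obtain ⟨N, hN⟩ := exists_nat_gt (max R₁ R₂)
  rw [strip_eq_biUnion ((le_max_left _ _).trans hN.le) ((le_max_right _ _).trans_lt hN),
    integrableOn_finset_iUnion]
  intro n _
  refine (integrableOn_lsIntegrand_cell hk hmeas hone hbdd hper hsupp hf r n).mono_set ?_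
  gcongr
  exact inter_subset_right

/-- For fixed `r₀` the periods inside the strip form an interval whose ends depend on `r₀`, which is
why the convergence of the lattice sum must be uniform in both ends. -/
theorem sum_indicator_cellTerm (f : ℝ × ℝ → ℂ) (r : ℝ × ℝ) {r₀ : ℝ × ℝ} (h₀ : r₀.1 ∈ Icc (0 : ℝ) 1)
    {R₁ R₂ : ℝ} {N : ℕ} (h₁ : R₁ ≤ N) (h₂ : R₂ < N) :
    ∑ n ∈ Finset.Ico (-(N : ℤ)) N,
        {r₀ : ℝ × ℝ | r₀.1 + n ∈ Ioc (-R₁) R₂}.indicator (cellTerm ε kx k f r n) r₀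
      = ((ε r₀ - 1 : ℝ) : ℂ) * (Complex.I * (k : ℂ) ^ 2 / 4
          * ∑ n ∈ Finset.Ico (⌊-R₁ - r₀.1⌋ + 1) (⌊R₂ - r₀.1⌋ + 1),
            latticeTerm kx k (r.1 - r₀.1) (r.2 - r₀.2) n) * f r₀ := by
  classical
  have hset : (Finset.Ico (-(N : ℤ)) N).filter (fun n : ℤ => r₀.1 + n ∈ Ioc (-R₁) R₂)
      = Finset.Ico (⌊-R₁ - r₀.1⌋ + 1) (⌊R₂ - r₀.1⌋ + 1) := by
    ext n
    simp only [Finset.mem_filter, Finset.mem_Ico, mem_Ioc, Int.add_one_le_iff, Int.lt_add_one_iff,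
      Int.floor_lt, Int.le_floor]
    constructor
    · rintro ⟨-, h3, h4⟩
      constructor <;> linarith
    · rintro ⟨h3, h4⟩
      refine ⟨⟨?_, ?_⟩, by linarith, by linarith⟩
      · have : (-(N : ℤ) - 1 : ℤ) < n := by
          have : ((-(N : ℤ) - 1 : ℤ) : ℝ) < n := by push_cast; linarith [h₀.2]
          exact_mod_cast this
        omega
      · have : (n : ℝ) < (N : ℤ) := by push_cast; linarith [h₀.1]
        exact_mod_cast this
  rw [← hset, Finset.mul_sum, Finset.mul_sum, Finset.sum_mul, Finset.sum_filter]
  refine Finset.sum_congr rfl fun n _ => ?_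
  rw [indicator_apply]
  rfl

theorem exists_natCast_bounds {N₀ : ℕ} {R₁ R₂ x : ℝ} (hx : x ∈ Icc (0 : ℝ) 1) (h₁ : N₀ + 2 ≤ R₁)
    (h₂ : N₀ + 2 ≤ R₂) : ∃ A B : ℕ, N₀ ≤ A ∧ N₀ ≤ B ∧ ⌊-R₁ - x⌋ + 1 = -(A : ℤ) ∧ ⌊R₂ - x⌋ + 1 = B := by
  have ha : ⌊-R₁ - x⌋ + 1 ≤ -(N₀ : ℤ) := by
    rw [Int.add_one_le_iff, Int.floor_lt]
    push_cast
    linarith [hx.1]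
  have hb : (N₀ : ℤ) ≤ ⌊R₂ - x⌋ := by
    rw [Int.le_floor]
    push_cast
    linarith [hx.2]
  exact ⟨(-(⌊-R₁ - x⌋ + 1)).toNat, (⌊R₂ - x⌋ + 1).toNat, by omega, by omega, by omega, by omega⟩

/-- The integrals over long strips are close to the integral with the periodized kernel. -/
theorem norm_setIntegral_strip_sub_le (hk : 0 < k) (hmeas : Measurable ε) (hone : ∀ r, 1 ≤ ε r)
    {M : ℝ} (hM : ∀ r, ε r ≤ M) (hper : ∀ x z : ℝ, ε (x + 1, z) = ε (x, z))
    (hsupp : ∀ x z : ℝ, ε (x, z) ≠ 1 → z ∈ Icc zm zp) {f : ℝ × ℝ → ℂ}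
    (hf : MemLp f 2 (volume.restrict (rect zm zp))) {r : ℝ × ℝ} (hr : r ∈ rect zm zp)
    (hint : IntegrableOn (fun r₀ => lsKernel ε kx ((k : ℂ) ^ 2) r r₀ * f r₀) (rect zm zp))
    {η : ℝ} {N₀ : ℕ} (hclose : ∀ A B : ℕ, N₀ ≤ A → N₀ ≤ B → ∀ x z : ℝ,
      |x| ≤ 1 → z ≠ 0 → |z| ≤ zp - zm →
      ‖Complex.I * (k : ℂ) ^ 2 / 4 * ∑ n ∈ Finset.Ico (-(A : ℤ)) B, latticeTerm kx k x z n
        - blochSeries kx ((k : ℂ) ^ 2) x z‖ ≤ η)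
    {R₁ R₂ : ℝ} (h₁ : N₀ + 2 ≤ R₁) (h₂ : N₀ + 2 ≤ R₂) :
    ‖(∫ r₀ in Ioc (-R₁) R₂ ×ˢ univ, lsIntegrand ε kx k f r r₀)
        - ∫ r₀ in rect zm zp, lsKernel ε kx ((k : ℂ) ^ 2) r r₀ * f r₀‖
      ≤ M * η * ∫ r₀ in rect zm zp, ‖f r₀‖ := by
  have hbdd : ∃ M : ℝ, ∀ r, ε r ≤ M := ⟨M, hM⟩
  have hM0 : 0 ≤ M := zero_le_one.trans ((hone 0).trans (hM 0))
  obtain ⟨N, hN⟩ := exists_nat_gt (max R₁ R₂)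
  have hN1 : R₁ ≤ N := (le_max_left _ _).trans hN.le
  have hN2 : R₂ < N := (le_max_right _ _).trans_lt hN
  have hmI : ∀ n : ℤ, MeasurableSet {r₀ : ℝ × ℝ | r₀.1 + n ∈ Ioc (-R₁) R₂} := fun n =>
    measurableSet_Ioc.preimage (measurable_fst.add_const (n : ℝ))
  have hci : ∀ n ∈ Finset.Ico (-(N : ℤ)) N, Integrable
      ({r₀ : ℝ × ℝ | r₀.1 + n ∈ Ioc (-R₁) R₂}.indicator (cellTerm ε kx k f r n))
      (volume.restrict (rect zm zp)) := fun n _ =>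
    Integrable.indicator (integrableOn_cellTerm hk hmeas hone hbdd hf r n) (hmI n)
  rw [strip_eq_biUnion hN1 hN2, integral_biUnion_finset _
    (fun n _ => (measurableSet_Ioc.inter measurableSet_Ico).prod MeasurableSet.univ)]
  · simp only [setIntegral_lsIntegrand_cell hk hper hsupp f r _ measurableSet_Ioc]
    rw [← integral_finsetSum _ hci, ← integral_sub (integrable_finsetSum _ hci) hint,
      ← integral_const_mul]
    refine norm_integral_le_of_norm_le
      ((hf.integrable (by norm_num)).norm.const_mul _) ?_
    filter_upwards [ae_restrict_mem (measurableSet_rect zm zp), ae_restrict_of_ae (ae_snd_ne r.2)]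
      with r₀ hr₀ hne
    obtain ⟨A, B, hA, hB, hA', hB'⟩ := exists_natCast_bounds hr₀.1 h₁ h₂
    rw [sum_indicator_cellTerm f r hr₀.1 hN1 hN2, hA', hB', lsKernel, ← sub_mul, ← mul_sub, norm_mul,
      norm_mul]
    have hx : |r.1 - r₀.1| ≤ 1 := by
      rw [abs_le]; constructor <;> linarith [hr.1.1, hr.1.2, hr₀.1.1, hr₀.1.2]
    have hz : |r.2 - r₀.2| ≤ zp - zm := by
      rw [abs_le]; constructor <;> linarith [hr.2.1, hr.2.2, hr₀.2.1, hr₀.2.2]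
    gcongr
    · exact norm_sub_one_le hone hM r₀
    · exact hclose A B hA hB _ _ hx (sub_ne_zero.2 (Ne.symm hne)) hz
  · intro m _ n _ hmn
    refine Disjoint.set_prod_left ((pairwise_disjoint_Ico_intCast ℝ hmn).mono ?_ ?_) _ _
    · exact inter_subset_right
    · exact inter_subset_right
  · intro n _
    refine (integrableOn_lsIntegrand_cell hk hmeas hone hbdd hper hsupp hf r n).mono_set ?_
    gcongr
    exact inter_subset_right

theorem hasLSIntegral_of_integrableOn (hk : 0 < k) (hE : ((k : ℂ) ^ 2) ∈ cutPlane kx)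
    (hmeas : Measurable ε) (hone : ∀ r, 1 ≤ ε r) (hbdd : ∃ M : ℝ, ∀ r, ε r ≤ M)
    (hper : ∀ x z : ℝ, ε (x + 1, z) = ε (x, z))
    (hsupp : ∀ x z : ℝ, ε (x, z) ≠ 1 → z ∈ Icc zm zp) {f : ℝ × ℝ → ℂ}
    (hf : MemLp f 2 (volume.restrict (rect zm zp))) {r : ℝ × ℝ} (hr : r ∈ rect zm zp)
    (hint : IntegrableOn (fun r₀ => lsKernel ε kx ((k : ℂ) ^ 2) r r₀ * f r₀) (rect zm zp)) :
    HasLSIntegral ε kx k f r (∫ r₀ in rect zm zp, lsKernel ε kx ((k : ℂ) ^ 2) r r₀ * f r₀) := by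
  refine ⟨integrableOn_lsIntegrand_strip hk hmeas hone hbdd hper hsupp hf r, ?_⟩
  obtain ⟨M, hM⟩ := hbdd
  have hM0 : 0 ≤ M := zero_le_one.trans ((hone 0).trans (hM 0))
  set F := ∫ r₀ in rect zm zp, ‖f r₀‖ with hF
  have hF0 : 0 ≤ F := integral_nonneg fun _ => norm_nonneg _
  rw [Metric.tendsto_atTop]
  intro τ hτ
  obtain ⟨N₀, hN₀⟩ := exists_norm_sum_latticeTerm_sub_le hk hE (zp - zm)
    (η := τ / (M * F + 1)) (by positivity)
  -- The product order on the pair `R` makes this a limit in which both ends move independently.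
  refine ⟨((N₀ + 2 : ℝ), (N₀ + 2 : ℝ)), fun R hR => ?_⟩
  rw [dist_eq_norm]
  refine (norm_setIntegral_strip_sub_le hk hmeas hone hM hper hsupp hf hr hint hN₀ hR.1 hR.2).trans_lt ?_
  rw [← hF]
  have : M * (τ / (M * F + 1)) * F = τ * (M * F / (M * F + 1)) := by field_simp
  rw [this]
  refine mul_lt_of_lt_one_right hτ ?_
  rw [div_lt_one (by positivity)]
  linarith

end

end SiegertStates

/-! ### Assembly of the theorem -/

theorem mainTheorem2 (ε : ℝ × ℝ → ℝ) (kx zm zp : ℝ) (hz : zm < zp)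
    (hmeas : Measurable ε)
    (hone : ∀ r, 1 ≤ ε r)
    (hbdd : ∃ M : ℝ, ∀ r, ε r ≤ M)
    (hper : ∀ x z : ℝ, ε (x + 1, z) = ε (x, z))
    (hsupp : ∀ x z : ℝ, ε (x, z) ≠ 1 → z ∈ Set.Icc zm zp) :
    -- the series converges, with analytic sum
    (∀ x z : ℝ, z ≠ 0 →
      (∀ E ∈ SiegertStates.cutPlane kx, Summable (SiegertStates.seriesTerm kx E x z)) ∧
      AnalyticOnNhd ℂ (fun E => SiegertStates.blochSeries kx E x z)
        (SiegertStates.cutPlane kx)) ∧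
    ∃ T : ℂ → (SiegertStates.L2D zm zp →L[ℂ] SiegertStates.L2D zm zp),
      -- at physical `k`, `T (k²)` is the Lippmann–Schwinger operator
      (∀ k : ℝ, 0 < k → ((k : ℂ) ^ 2) ∈ SiegertStates.cutPlane kx →
        ∀ f : SiegertStates.L2D zm zp,
          ∀ᵐ r ∂(MeasureTheory.volume.restrict (SiegertStates.rect zm zp)),
            SiegertStates.HasLSIntegral ε kx k f r (T ((k : ℂ) ^ 2) f r)) ∧
      -- on the cut plane, `T E` is the integral operator with the periodized kernel
      (∀ E ∈ SiegertStates.cutPlane kx, ∀ f : SiegertStates.L2D zm zp,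
        ∀ᵐ r ∂(MeasureTheory.volume.restrict (SiegertStates.rect zm zp)),
          MeasureTheory.IntegrableOn
            (fun r₀ => SiegertStates.lsKernel ε kx E r r₀ * f r₀) (SiegertStates.rect zm zp) ∧
          T E f r = ∫ r₀ in SiegertStates.rect zm zp,
            SiegertStates.lsKernel ε kx E r r₀ * f r₀) ∧
      -- the kernel is square integrable and the operator is Hilbert–Schmidt and compact
      (∀ E ∈ SiegertStates.cutPlane kx,
        MeasureTheory.MemLp
          (fun p : (ℝ × ℝ) × (ℝ × ℝ) => SiegertStates.lsKernel ε kx E p.1 p.2) 2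
          ((MeasureTheory.volume.restrict (SiegertStates.rect zm zp)).prod
            (MeasureTheory.volume.restrict (SiegertStates.rect zm zp))) ∧
        SiegertStates.IsHilbertSchmidt (T E) ∧ IsCompactOperator (T E)) ∧
      -- analyticity in the operator norm
      AnalyticOnNhd ℂ T (SiegertStates.cutPlane kx) ∧
      -- the generalized resolvent is meromorphic; its poles are isolated, and it exists off them
      MeromorphicOn (SiegertStates.genResolvent T) (SiegertStates.cutPlane kx) ∧
      (∀ E₀ ∈ SiegertStates.cutPlane kx,
        ∀ᶠ E in nhdsWithin E₀ {E₀}ᶜ,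
          ¬ SiegertStates.IsPole (SiegertStates.genResolvent T) E ∧ IsUnit (1 - T E)) ∧
      (∀ E ∈ SiegertStates.cutPlane kx,
        (SiegertStates.IsPole (SiegertStates.genResolvent T) E ↔ ¬ IsUnit (1 - T E))) ∧
      -- Siegert states exist at the poles
      (∀ E ∈ SiegertStates.cutPlane kx,
        SiegertStates.IsPole (SiegertStates.genResolvent T) E →
          ∃ f : SiegertStates.L2D zm zp, f ≠ 0 ∧ T E f = f) := by
  have hT := SiegertStates.analyticOnNhd_lsOp (kx := kx) hz hmeas hone hbdd
  -- This holds at every `E`, because the kernel class is `0` where the kernel is not square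
  -- integrable.
  have hHS : ∀ E, SiegertStates.IsHilbertSchmidt (SiegertStates.lsOp ε kx zm zp E) := fun E =>
    SiegertStates.isHilbertSchmidt_kernelOp _
  have hunit : ∀ E₀ ∈ SiegertStates.cutPlane kx,
      ∀ᶠ E in 𝓝[≠] E₀, IsUnit (1 - SiegertStates.lsOp ε kx zm zp E) := fun E₀ hE₀ =>
    SiegertStates.eventually_isUnit_one_sub (SiegertStates.isPreconnected_cutPlane kx) hT
      (fun E _ => (hHS E).nearFinRank)
      (SiegertStates.exists_isUnit_one_sub_lsOp hz hmeas hone hbdd) hE₀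
  have hpole : ∀ E ∈ SiegertStates.cutPlane kx,
      (SiegertStates.IsPole (SiegertStates.genResolvent (SiegertStates.lsOp ε kx zm zp)) E
        ↔ ¬ IsUnit (1 - SiegertStates.lsOp ε kx zm zp E)) := fun E hE =>
    SiegertStates.isPole_genResolvent_iff (hT E hE) (hHS E).nearFinRank (hunit E hE)
  refine ⟨fun x z hz0 => ⟨fun E hE => SiegertStates.summable_seriesTerm hE x hz0,
    SiegertStates.analyticOnNhd_blochSeries kx x hz0⟩, SiegertStates.lsOp ε kx zm zp, ?_,
    fun E hE f => SiegertStates.lsOp_ae hz hmeas hone hbdd hE f,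
    fun E hE => ⟨SiegertStates.memLp_lsKernel hz hmeas hone hbdd hE, hHS E, (hHS E).isCompactOperator⟩,
    hT,
    fun E hE => SiegertStates.meromorphicAt_genResolvent (hT E hE) (hHS E).nearFinRank (hunit E hE),
    fun E₀ hE₀ => ?_, hpole,
    fun E hE h => SiegertStates.exists_fixed_of_not_isUnit (hHS E).isCompactOperator ((hpole E hE).1 h)⟩
  · intro k hk hE f
    filter_upwards [SiegertStates.lsOp_ae hz hmeas hone hbdd hE f,
      ae_restrict_mem (SiegertStates.measurableSet_rect zm zp)] with r h hr
    rw [h.2]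
    exact SiegertStates.hasLSIntegral_of_integrableOn hk hE hmeas hone hbdd hper hsupp
      (Lp.memLp f) hr h.1
  · filter_upwards [hunit E₀ hE₀, nhdsWithin_le_nhds
      ((SiegertStates.isOpen_cutPlane kx).mem_nhds hE₀)] with E h hE
    exact ⟨fun hp => (hpole E hE).1 hp h, h⟩
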